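/- Let $p\in(0,1)$ be a constant, and let $G(n,p)$ be the binomial random graph on $n$ labelled vertices, in which every pair of vertices is joined by an edge with probability $p$, independently of the other pairs. Let $\mathcal{E}_1^2$ be the class of all existential monadic second order sentences $\exists X\,\phi(X)$, where $X$ is a single monadic variable (ranging over sets of vertices) and $\phi(X)$ is a first-order sentence, built from adjacency, equality and the unary predicate $X$, of quantifier depth $2$ (i.e. the maximal number of nested quantifiers in $\phi$ is $2$). We say that $G(n,p)$ obeys the $\mathcal{E}_1^2$ zero-one law if, for every $\varphi\in\mathcal{E}_1^2$, the limit $\lim_{n\to\infty}\mathsf{P}(G(n,p)\models\varphi)$ exists and belongs to $\{0,1\}$, and that it obeys the $\mathcal{E}_1^2$ convergence law if this limit exists for every $\varphi\in\mathcal{E}_1^2$. Then: 1. $G(n,p)$ obeys the $\mathcal{E}_1^2$ zero-one law if and only if $p\notin\left\{\frac{3-\sqrt5}{2},\frac{\sqrt5-1}{2}\right\}$. 2. If $p\in\left\{\frac{3-\sqrt5}{2},\frac{\sqrt5-1}{2}\right\}$, then $G(n,p)$ does not obey the $\mathcal{E}_1^2$ convergence law. -/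

import Mathlib

namespace EMSO

open FirstOrder MeasureTheory Filter Topology unitInterval

/-- Relation symbols: adjacency and one unary predicate `X`. Equality is built into first-order
formulas. -/
inductive Rel : ℕ → Type
  | adj : Rel 2
  | mem : Rel 1

/-- The first-order language of graphs with one additional unary predicate. -/
def lang : Language := ⟨fun _ => Empty, Rel⟩

/-- The structure of a graph `G` together with a set `X` of its vertices. -/
@[reducible]
def str {V : Type*} (G : SimpleGraph V) (X : Set V) : lang.Structure V where
  funMap := fun f _ => nomatch f
  RelMap := fun r x =>
    match r, x with
    | Rel.adj, x => G.Adj (x 0) (x 1)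
    | Rel.mem, x => x 0 ∈ X

/-- Quantifier depth: the largest number of nested quantifiers. The primitive connectives are `⊥`,
`→` and `∀`, through which the others are defined without changing the depth. -/
def qdepth {α : Type*} : {k : ℕ} → lang.BoundedFormula α k → ℕ
  | _, .falsum => 0
  | _, .equal _ _ => 0
  | _, .rel _ _ => 0
  | _, .imp f g => max (qdepth f) (qdepth g)
  | _, .all f => qdepth f + 1

/-- An EMSO sentence `∃ X, φ(X)` with a single monadic variable, given by its first-order part. -/
structure Sentence₁ where
  /-- The first-order part. -/
  fo : lang.Sentence

/-- `G ⊨ ∃ X, φ(X)`. -/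
def Models {V : Type*} (G : SimpleGraph V) (φ : Sentence₁) : Prop :=
  ∃ X : Set V, @Language.Sentence.Realize lang V (str G X) φ.fo

/-- The class of the sentences `∃ X, φ(X)` with `φ` of quantifier depth `k`. -/
def E₁ (k : ℕ) : Set Sentence₁ := {φ | qdepth φ.fo = k}

/-- `P(G(n, p) ⊨ φ)` for the binomial random graph on `n` vertices. -/
noncomputable def prob (p : I) (φ : Sentence₁) (n : ℕ) : ℝ :=
  (SimpleGraph.binomialRandom (Fin n) p).real {G | Models G φ}

/-- `G(n, p)` obeys the zero-one law for the class `L`. -/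
def ZeroOneLaw (p : I) (L : Set Sentence₁) : Prop :=
  ∀ φ ∈ L, ∃ c ∈ ({0, 1} : Set ℝ), Tendsto (prob p φ) atTop (𝓝 c)

/-- `G(n, p)` obeys the convergence law for the class `L`. -/
def ConvergenceLaw (p : I) (L : Set Sentence₁) : Prop :=
  ∀ φ ∈ L, ∃ c : ℝ, Tendsto (prob p φ) atTop (𝓝 c)

end EMSO

namespace EMSO

open FirstOrder MeasureTheory Filter Topology unitInterval

/-! ### Back-and-forth equivalence and vertex types -/

section Logic

variable {V V' : Type*}

/-! A two-round game shows that a sentence of depth 2 about `(G, X)` sees only which vertex types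
occur, where a type records membership in `X` and the existence of neighbours and of other
non-neighbours inside and outside `X` (`realize_iff_of_range_vtype_eq`). So the truth of `∃ X, φ(X)`
depends only on which sets of types can be realised by a choice of `X`.

Asymptotically almost surely `Ext` holds, and it nearly forces these sets of types. Up to
complementing `X` or `G`, one of four cases applies: `X` is the neighbourhood of a vertex `s`, apart
from `s` itself; `X` has at most one element; `X` contains a vertex with both a neighbour and a
non-neighbour in `X`, and then every choice of the remaining kinds can be realised
(`Ext.exists_generic`); or `X` is a clique. Hence only the kinds of cliques (dominating or not,
maximal or not) present in `G` and in `Gᶜ` matter (`Ext.models_of_models`).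

Put `q = 1 - p`. Cliques reach size about `2 log n / log (1/p)`, and domination needs about `log n /
log (1/q)` vertices, so everything turns on comparing `p` with `q²`. If `q² < p`, a second moment
argument yields every kind (`aas_cliqueKind_of_lt`). If `p < q²`, the first moment excludes
dominating cliques (`aas_no_dominating_clique`), and the other kinds are always present.
Complementation exchanges `p` and `q`, so the zero-one law holds unless `p = q²` or `q = p²`, and
these equations define the two golden values.

At `p = q²` consider dominating cliques that extend by a vertex. The expected number of pairs
(clique of size `k`, extending vertex) is at most a constant times `x · x^k e^(-x) / k!` with `x = n
q^k`, a Poisson weight. Raising `k` by one multiplies `x` by `q`, so for suitable `n` every `x`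
misses `k` by a constant factor and the expectation tends to zero (`exists_seq_tendsto_zero`). For
`n` near `k q^(-k)` mean and size agree, and the second moment keeps the probability bounded below
(`le_real_hasExtendableDomClique`). The two subsequences preclude a limit; `q = p²` follows by
complementation. -/

/-- Two tuples satisfy the same atomic formulas. -/
def AtomEquiv (G : SimpleGraph V) (X : Set V) (G' : SimpleGraph V') (X' : Set V') {k : ℕ}
    (x : Fin k → V) (x' : Fin k → V') : Prop :=
  (∀ i j, x i = x j ↔ x' i = x' j) ∧ (∀ i j, G.Adj (x i) (x j) ↔ G'.Adj (x' i) (x' j)) ∧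
    ∀ i, x i ∈ X ↔ x' i ∈ X'

/-- Duplicator wins the `m`-round Ehrenfeucht–Fraïssé game from the given position. -/
def BackForth (G : SimpleGraph V) (X : Set V) (G' : SimpleGraph V') (X' : Set V') :
    ℕ → ∀ {k : ℕ}, (Fin k → V) → (Fin k → V') → Prop
  | 0, _, x, x' => AtomEquiv G X G' X' x x'
  | m + 1, _, x, x' => AtomEquiv G X G' X' x x' ∧
      (∀ a, ∃ a', BackForth G X G' X' m (Fin.snoc x a : Fin _ → V) (Fin.snoc x' a' : Fin _ → V')) ∧
      (∀ a', ∃ a, BackForth G X G' X' m (Fin.snoc x a : Fin _ → V) (Fin.snoc x' a' : Fin _ → V'))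

lemma BackForth.atomEquiv {G : SimpleGraph V} {X : Set V} {G' : SimpleGraph V'} {X' : Set V'}
    {m k : ℕ} {x : Fin k → V} {x' : Fin k → V'} (h : BackForth G X G' X' m x x') :
    AtomEquiv G X G' X' x x' := by
  cases m with
  | zero => exact h
  | succ m => exact h.1

lemma exists_term_eq_var {k : ℕ} (t : lang.Term (Empty ⊕ Fin k)) :
    ∃ i, t = Language.Term.var (Sum.inr i) := by
  cases t with
  | var a =>
    cases a with
    | inl e => exact e.elim
    | inr i => exact ⟨i, rfl⟩
  | func f _ => exact (f : Empty).elim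

/-- Induction on the formula. The language has no function symbols, so atomic formulas only compare
entries of the tuple; each universal quantifier consumes one round. -/
lemma BackForth.realize_iff {G : SimpleGraph V} {X : Set V} {G' : SimpleGraph V'} {X' : Set V'}
    {k : ℕ} (φ : lang.BoundedFormula Empty k) :
    ∀ {m : ℕ} {x : Fin k → V} {x' : Fin k → V'}, qdepth φ ≤ m → BackForth G X G' X' m x x' →
      (@Language.BoundedFormula.Realize lang V (str G X) _ _ φ default x ↔
        @Language.BoundedFormula.Realize lang V' (str G' X') _ _ φ default x') := by
  induction φ with
  | falsum => intros; rfl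
  | equal t₁ t₂ =>
    intro m x x' _ h
    obtain ⟨i, rfl⟩ := exists_term_eq_var t₁
    obtain ⟨j, rfl⟩ := exists_term_eq_var t₂
    exact h.atomEquiv.1 i j
  | rel R ts =>
    intro m x x' _ h
    choose f hf using fun i => exists_term_eq_var (ts i)
    obtain rfl : ts = fun i => Language.Term.var (Sum.inr (f i)) := funext hf
    cases R with
    | adj => exact h.atomEquiv.2.1 (f 0) (f 1)
    | mem => exact h.atomEquiv.2.2 (f 0)
  | imp f g ihf ihg =>
    intro m x x' hm h
    have hm' : qdepth f ≤ m ∧ qdepth g ≤ m := max_le_iff.mp hm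
    exact imp_congr (ihf hm'.1 h) (ihg hm'.2 h)
  | all f ih =>
    intro m x x' hm h
    change qdepth f + 1 ≤ m at hm
    obtain _ | m := m
    · omega
    constructor
    · intro hf a'
      obtain ⟨a, ha⟩ := h.2.2 a'
      exact (ih (by omega) ha).1 (hf a)
    · intro hf a
      obtain ⟨a', ha⟩ := h.2.1 a
      exact (ih (by omega) ha).2 (hf a')

/-- The type of a vertex: whether it lies in `X`, and whether it has a neighbour, respectively
another non-neighbour, in `X` and in its complement. -/
def vtype (G : SimpleGraph V) (X : Set V) (v : V) : Prop × Prop × Prop × Prop × Prop :=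
  (v ∈ X, (∃ y, y ∈ X ∧ G.Adj v y), (∃ y, y ∈ X ∧ y ≠ v ∧ ¬ G.Adj v y),
    (∃ y, y ∉ X ∧ G.Adj v y), ∃ y, y ∉ X ∧ y ≠ v ∧ ¬ G.Adj v y)

/-- A second move `y ≠ v` matters only through its membership in `X` and its adjacency to `v`. The
last four entries of a type record exactly which of these combinations occur; the move `y = v` is
answered by `v'`. -/
lemma exists_extension_of_vtype_eq {G : SimpleGraph V} {X : Set V} {G' : SimpleGraph V'}
    {X' : Set V'} {v : V} {v' : V'} (h : vtype G X v = vtype G' X' v') (y : V) :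
    ∃ y', (v = y ↔ v' = y') ∧ (G.Adj v y ↔ G'.Adj v' y') ∧ (y ∈ X ↔ y' ∈ X') := by
  simp only [vtype, Prod.mk.injEq, eq_iff_iff] at h
  obtain ⟨h0, h1, h2, h3, h4⟩ := h
  by_cases hvy : v = y
  · subst hvy
    exact ⟨v', by simp, by simp, h0⟩
  by_cases hX : y ∈ X <;> by_cases ha : G.Adj v y
  · obtain ⟨z, hz, hz'⟩ := h1.1 ⟨y, hX, ha⟩
    exact ⟨z, by simp [hvy, hz'.ne], by simp [ha, hz'], by simp [hX, hz]⟩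
  · obtain ⟨z, hz, hz1, hz2⟩ := h2.1 ⟨y, hX, Ne.symm hvy, ha⟩
    exact ⟨z, by simp [hvy, hz1.symm], by simp [ha, hz2], by simp [hX, hz]⟩
  · obtain ⟨z, hz, hz'⟩ := h3.1 ⟨y, hX, ha⟩
    exact ⟨z, by simp [hvy, hz'.ne], by simp [ha, hz'], by simp [hX, hz]⟩
  · obtain ⟨z, hz, hz1, hz2⟩ := h4.1 ⟨y, hX, Ne.symm hvy, ha⟩
    exact ⟨z, by simp [hvy, hz1.symm], by simp [ha, hz2], by simp [hX, hz]⟩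

lemma snoc_snoc_eq_vec (z : Fin 0 → V) (a b : V) :
    (Fin.snoc (Fin.snoc z a : Fin 1 → V) b : Fin 2 → V) = ![a, b] := by
  ext i
  fin_cases i <;> rfl

lemma atomEquiv_snoc_snoc {G : SimpleGraph V} {X : Set V} {G' : SimpleGraph V'}
    {X' : Set V'} {v y : V} {v' y' : V'} (hv : v ∈ X ↔ v' ∈ X') (h₁ : v = y ↔ v' = y')
    (h₂ : G.Adj v y ↔ G'.Adj v' y') (h₃ : y ∈ X ↔ y' ∈ X') (x : Fin 0 → V) (x' : Fin 0 → V') :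
    AtomEquiv G X G' X' (Fin.snoc (Fin.snoc x v : Fin 1 → V) y : Fin 2 → V)
      (Fin.snoc (Fin.snoc x' v' : Fin 1 → V') y' : Fin 2 → V') := by
  rw [snoc_snoc_eq_vec, snoc_snoc_eq_vec]
  refine ⟨?_, ?_, ?_⟩
  · simp [Fin.forall_fin_two, h₁, eq_comm (a := y), eq_comm (a := y')]
  · simp [Fin.forall_fin_two, h₂, G.adj_comm y, G'.adj_comm y']
  · simp [Fin.forall_fin_two, hv, h₃]

lemma atomEquiv_snoc {G : SimpleGraph V} {X : Set V} {G' : SimpleGraph V'}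
    {X' : Set V'} {v : V} {v' : V'} (hv : v ∈ X ↔ v' ∈ X') (x : Fin 0 → V) (x' : Fin 0 → V') :
    AtomEquiv G X G' X' (Fin.snoc x v : Fin 1 → V) (Fin.snoc x' v' : Fin 1 → V') := by
  refine ⟨?_, ?_, ?_⟩ <;> simp [Fin.snoc, hv]

lemma backForth_one_of_vtype_eq {G : SimpleGraph V} {X : Set V} {G' : SimpleGraph V'}
    {X' : Set V'} {v : V} {v' : V'} (h : vtype G X v = vtype G' X' v')
    (x : Fin 0 → V) (x' : Fin 0 → V') :
    BackForth G X G' X' 1 (Fin.snoc x v : Fin 1 → V) (Fin.snoc x' v' : Fin 1 → V') := by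
  have hv : v ∈ X ↔ v' ∈ X' := Iff.of_eq (congrArg Prod.fst h)
  refine ⟨atomEquiv_snoc hv x x', fun y => ?_, fun y' => ?_⟩
  · obtain ⟨y', h₁, h₂, h₃⟩ := exists_extension_of_vtype_eq h y
    exact ⟨y', atomEquiv_snoc_snoc hv h₁ h₂ h₃ x x'⟩
  · obtain ⟨y, h₁, h₂, h₃⟩ := exists_extension_of_vtype_eq h.symm y'
    exact ⟨y, atomEquiv_snoc_snoc hv h₁.symm h₂.symm h₃.symm x x'⟩

/-- Sentences of quantifier depth at most two depend only on the set of realised vertex types. -/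
theorem realize_iff_of_range_vtype_eq {G : SimpleGraph V} {X : Set V} {G' : SimpleGraph V'}
    {X' : Set V'} (h : Set.range (vtype G X) = Set.range (vtype G' X')) {φ : lang.Sentence}
    (hφ : qdepth φ ≤ 2) :
    @Language.Sentence.Realize lang V (str G X) φ ↔
      @Language.Sentence.Realize lang V' (str G' X') φ := by
  have hEF : BackForth G X G' X' 2 (default : Fin 0 → V) (default : Fin 0 → V') := by
    refine ⟨⟨fun i => i.elim0, fun i => i.elim0, fun i => i.elim0⟩, fun v => ?_, fun v' => ?_⟩
    · obtain ⟨v', hv'⟩ : vtype G X v ∈ Set.range (vtype G' X') := h ▸ ⟨v, rfl⟩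
      exact ⟨v', backForth_one_of_vtype_eq hv'.symm _ _⟩
    · obtain ⟨v, hv⟩ : vtype G' X' v' ∈ Set.range (vtype G X) := h ▸ ⟨v', rfl⟩
      exact ⟨v, backForth_one_of_vtype_eq hv _ _⟩
  exact BackForth.realize_iff φ hφ hEF

end Logic

/-! ### Type sets realised in graphs with an extension property -/

section Transfer

variable {V V' : Type*}

/-- Every adjacency pattern to at most six vertices is realised by a further vertex. -/
def Ext (G : SimpleGraph V) : Prop :=
  ∀ (s : Fin 6 → V) (T : Finset (Fin 6)),
    ∃ z, ∀ i, z ≠ s i ∧ (G.Adj z (s i) ↔ ∃ j ∈ T, s j = s i)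

/-- `X` is a nontrivial clique that is dominating iff `d` and maximal iff `m`. -/
def IsCliqueKind (G : SimpleGraph V) (A : Set V) (d m : Prop) : Prop :=
  A.Nontrivial ∧ (∀ u ∈ A, ∀ v ∈ A, u ≠ v → G.Adj u v) ∧
    ((∀ w ∉ A, ∃ a ∈ A, G.Adj w a) ↔ d) ∧ ((∀ w ∉ A, ∃ a ∈ A, ¬ G.Adj w a) ↔ m)

/-- Every vertex has a neighbour and another non-neighbour outside `X`. -/
def Reg (G : SimpleGraph V) (X : Set V) : Prop :=
  ∀ v, (∃ y, y ∉ X ∧ G.Adj v y) ∧ ∃ y, y ∉ X ∧ y ≠ v ∧ ¬ G.Adj v y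

/-- Some vertex has the given membership in `X` and the given neighbour and non-neighbour
existence in `X`. -/
def Has (G : SimpleGraph V) (X : Set V) (c n m : Prop) : Prop :=
  ∃ v, (v ∈ X ↔ c) ∧ ((∃ y, y ∈ X ∧ G.Adj v y) ↔ n) ∧ ((∃ y, y ∈ X ∧ y ≠ v ∧ ¬ G.Adj v y) ↔ m)

/-- Prescribing the pattern by a predicate on vertices keeps it consistent when vertices coincide,
so unused slots can be filled by repeating one. -/
lemma Ext.exists_pattern {G : SimpleGraph V} (hG : Ext G) (P : V → Prop) (a b c d e f : V) :
    ∃ z, (z ≠ a ∧ (G.Adj z a ↔ P a)) ∧ (z ≠ b ∧ (G.Adj z b ↔ P b)) ∧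
      (z ≠ c ∧ (G.Adj z c ↔ P c)) ∧ (z ≠ d ∧ (G.Adj z d ↔ P d)) ∧
      (z ≠ e ∧ (G.Adj z e ↔ P e)) ∧ (z ≠ f ∧ (G.Adj z f ↔ P f)) := by
  classical
  let s : Fin 6 → V := ![a, b, c, d, e, f]
  obtain ⟨z, hz⟩ := hG s (Finset.univ.filter fun i => P (s i))
  have key : ∀ i, z ≠ s i ∧ (G.Adj z (s i) ↔ P (s i)) := fun i => by
    refine ⟨(hz i).1, (hz i).2.trans ⟨?_, fun h => ⟨i, by simpa using h, rfl⟩⟩⟩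
    rintro ⟨j, hj, hji⟩
    rw [← hji]
    simpa using hj
  exact ⟨z, key 0, key 1, key 2, key 3, key 4, key 5⟩

lemma Ext.compl {G : SimpleGraph V} (hG : Ext G) : Ext Gᶜ := by
  classical
  intro s T
  obtain ⟨z, hz⟩ := hG s (Finset.univ.filter fun i => ¬ ∃ j ∈ T, s j = s i)
  refine ⟨z, fun i => ⟨(hz i).1, ?_⟩⟩
  rw [SimpleGraph.compl_adj, (hz i).2]
  constructor
  · rintro ⟨-, h⟩
    by_contra hc
    exact h ⟨i, by simpa using hc, rfl⟩
  · rintro h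
    refine ⟨(hz i).1, ?_⟩
    rintro ⟨j, hj, hji⟩
    simp only [Finset.mem_filter, Finset.mem_univ, true_and, hji] at hj
    exact hj h

lemma vtype_compl_set (G : SimpleGraph V) (X : Set V) :
    vtype G Xᶜ = (fun t => (¬ t.1, t.2.2.2.1, t.2.2.2.2, t.2.1, t.2.2.1)) ∘ vtype G X := by
  funext v
  simp [vtype]

lemma compl_adj_iff (G : SimpleGraph V) (v y : V) : Gᶜ.Adj v y ↔ y ≠ v ∧ ¬ G.Adj v y := by
  rw [SimpleGraph.compl_adj, ne_comm]

lemma ne_and_not_compl_adj_iff (G : SimpleGraph V) (v y : V) :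
    (y ≠ v ∧ ¬ Gᶜ.Adj v y) ↔ G.Adj v y := by
  have := fun h : G.Adj v y => h.ne
  rw [compl_adj_iff]
  grind

lemma vtype_compl_graph (G : SimpleGraph V) (X : Set V) :
    vtype Gᶜ X = (fun t => (t.1, t.2.2.1, t.2.1, t.2.2.2.2, t.2.2.2.1)) ∘ vtype G X := by
  funext v
  simp only [vtype, Function.comp, ne_and_not_compl_adj_iff]
  simp only [compl_adj_iff]

/-- Complementing `X` acts on types by one fixed map, independent of the graph, so equality of
ranges is preserved; the same holds for complementing `G`. -/
lemma range_vtype_compl_set {G : SimpleGraph V} {X : Set V} {G' : SimpleGraph V'} {X' : Set V'}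
    (h : Set.range (vtype G X) = Set.range (vtype G' X')) :
    Set.range (vtype G Xᶜ) = Set.range (vtype G' X'ᶜ) := by
  rw [vtype_compl_set, vtype_compl_set, Set.range_comp, Set.range_comp, h]

lemma range_vtype_compl_graph {G : SimpleGraph V} {X : Set V} {G' : SimpleGraph V'} {X' : Set V'}
    (h : Set.range (vtype G X) = Set.range (vtype G' X')) :
    Set.range (vtype Gᶜ X) = Set.range (vtype G'ᶜ X') := by
  rw [vtype_compl_graph, vtype_compl_graph, Set.range_comp, Set.range_comp, h]

lemma has_compl {G : SimpleGraph V} {X : Set V} {c n m : Prop} :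
    Has Gᶜ X c n m ↔ Has G X c m n := by
  simp only [Has, ne_and_not_compl_adj_iff]
  simp only [compl_adj_iff]
  exact exists_congr fun v => and_congr_right fun _ => and_comm

/-- Regularity makes the last two entries of every type true, so only the three entries tracked by
`Has` can vary. -/
lemma range_vtype_subset_of_has {G : SimpleGraph V} {X : Set V} {G' : SimpleGraph V'} {X' : Set V'}
    (hr : Reg G X) (hr' : Reg G' X') (h : ∀ c n m, Has G X c n m → Has G' X' c n m) :
    Set.range (vtype G X) ⊆ Set.range (vtype G' X') := by
  rintro _ ⟨v, rfl⟩
  obtain ⟨v', h0, h1, h2⟩ := h _ _ _ ⟨v, Iff.rfl, Iff.rfl, Iff.rfl⟩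
  refine ⟨v', ?_⟩
  simp only [vtype, Prod.mk.injEq, eq_iff_iff]
  exact ⟨h0, h1, h2, iff_of_true (hr' v').1 (hr v).1, iff_of_true (hr' v').2 (hr v).2⟩

lemma range_vtype_eq_of_has {G : SimpleGraph V} {X : Set V} {G' : SimpleGraph V'} {X' : Set V'}
    (hr : Reg G X) (hr' : Reg G' X') (h : ∀ c n m, Has G X c n m ↔ Has G' X' c n m) :
    Set.range (vtype G X) = Set.range (vtype G' X') :=
  (range_vtype_subset_of_has hr hr' fun c n m => (h c n m).1).antisymm
    (range_vtype_subset_of_has hr' hr fun c n m => (h c n m).2)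

lemma not_has_false_false {G : SimpleGraph V} {X : Set V} (hX : X.Nontrivial) (c : Prop) :
    ¬ Has G X c False False := by
  rintro ⟨v, -, h1, h2⟩
  obtain ⟨y, hy, hyv⟩ := hX.exists_ne v
  by_cases h : G.Adj v y
  · exact h1.1 ⟨y, hy, h⟩
  · exact h2.1 ⟨y, hy, hyv, h⟩

/-- Of the eight combinations, the two with neither a neighbour nor another non-neighbour in `X` are
impossible once `X` has two elements; the six others are the hypotheses. -/
lemma range_vtype_eq_of_nontrivial {G : SimpleGraph V} {X : Set V} {G' : SimpleGraph V'}
    {X' : Set V'} (hr : Reg G X) (hr' : Reg G' X') (hX : X.Nontrivial) (hX' : X'.Nontrivial)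
    (h₁ : Has G X True True True ↔ Has G' X' True True True)
    (h₂ : Has G X True True False ↔ Has G' X' True True False)
    (h₃ : Has G X True False True ↔ Has G' X' True False True)
    (h₄ : Has G X False True True ↔ Has G' X' False True True)
    (h₅ : Has G X False True False ↔ Has G' X' False True False)
    (h₆ : Has G X False False True ↔ Has G' X' False False True) :
    Set.range (vtype G X) = Set.range (vtype G' X') := by
  refine range_vtype_eq_of_has hr hr' fun c n m => ?_
  have e : ∀ b : Prop, b = True ∨ b = False := fun b => by
    by_cases hb : b <;> simp [hb]
  have hff : ∀ c, (Has G X c False False ↔ Has G' X' c False False) := fun c =>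
    iff_of_false (not_has_false_false hX c) (not_has_false_false hX' c)
  rcases e c with rfl | rfl <;> rcases e n with rfl | rfl <;> rcases e m with rfl | rfl
  all_goals first | assumption | exact hff _

/-! #### Sets with at most one element -/

lemma Ext.reg_singleton {G : SimpleGraph V} (hG : Ext G) (s : V) : Reg G {s} := by
  intro v
  obtain ⟨z, hz⟩ := hG.exists_pattern (fun _ => True) v s s s s s
  obtain ⟨y, hy⟩ := hG.exists_pattern (fun _ => False) v s s s s s
  exact ⟨⟨z, by simpa using hz.2.1.1, (by simpa using hz.1.2 : G.Adj z v).symm⟩,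
    ⟨y, by simpa using hy.2.1.1, hy.1.1, fun h => by simpa using hy.1.2.1 h.symm⟩⟩

lemma Reg.mono {G : SimpleGraph V} {X Y : Set V} (h : Reg G Y) (hXY : X ⊆ Y) : Reg G X :=
  fun v => ⟨(h v).1.imp fun _ hy => ⟨fun hX => hy.1 (hXY hX), hy.2⟩,
    (h v).2.imp fun _ hy => ⟨fun hX => hy.1 (hXY hX), hy.2⟩⟩

lemma has_empty_iff [Nonempty V] (G : SimpleGraph V) (c n m : Prop) :
    Has G ∅ c n m ↔ ¬ c ∧ ¬ n ∧ ¬ m := by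
  simp [Has]

lemma Ext.has_singleton_iff {G : SimpleGraph V} (hG : Ext G) (s : V) (c n m : Prop) :
    Has G {s} c n m ↔ (c ∧ ¬ n ∧ ¬ m) ∨ (¬ c ∧ n ∧ ¬ m) ∨ (¬ c ∧ ¬ n ∧ m) := by
  constructor
  · rintro ⟨v, h1, h2, h3⟩
    by_cases hv : v = s
    · subst hv
      simp at h1 h2 h3
      tauto
    · have : s ≠ v := Ne.symm hv
      simp [hv, this] at h1 h2 h3
      tauto
  · rintro (⟨h1, h2, h3⟩ | ⟨h1, h2, h3⟩ | ⟨h1, h2, h3⟩)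
    · exact ⟨s, by simp [*]⟩
    · obtain ⟨z, ⟨hz, hz'⟩, -⟩ := hG.exists_pattern (fun _ => True) s s s s s s
      have : G.Adj z s := by simpa using hz'
      exact ⟨z, by simp [*]⟩
    · obtain ⟨z, ⟨hz, hz'⟩, -⟩ := hG.exists_pattern (fun _ => False) s s s s s s
      have : ¬ G.Adj z s := by simpa using hz'
      exact ⟨z, by simp [*, hz.symm]⟩

/-! #### Cliques -/

/-- A neighbour `x` of `v` that lies in `A` can be exchanged for a neighbour `y` of `v` not adjacent
to `x`, and `y` cannot lie in the clique. Non-neighbours are treated alike. -/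
lemma Ext.reg_of_clique {G : SimpleGraph V} (hG : Ext G) {A : Set V}
    (hA : ∀ u ∈ A, ∀ v ∈ A, u ≠ v → G.Adj u v) : Reg G A := by
  intro v
  constructor
  · obtain ⟨x, ⟨-, hx⟩, -⟩ := hG.exists_pattern (fun _ => True) v v v v v v
    have hx' : G.Adj x v := by simpa using hx
    obtain ⟨y, ⟨-, hy⟩, ⟨hyx, hy'⟩, -⟩ := hG.exists_pattern (fun a => a = v) v x x x x x
    have hyv : G.Adj y v := by simpa using hy
    have hyx' : ¬ G.Adj y x := by simpa [hx'.ne] using hy'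
    by_cases hxA : x ∈ A
    · exact ⟨y, fun h => hyx' (hA y h x hxA hyx), hyv.symm⟩
    · exact ⟨x, hxA, hx'.symm⟩
  · obtain ⟨x, ⟨hxv, hx⟩, -⟩ := hG.exists_pattern (fun _ => False) v v v v v v
    have hx' : ¬ G.Adj x v := by simpa using hx
    obtain ⟨y, ⟨hyv, hy⟩, ⟨hyx, hy'⟩, -⟩ := hG.exists_pattern (fun _ => False) v x x x x x
    have hyv' : ¬ G.Adj y v := by simpa using hy
    have hyx' : ¬ G.Adj y x := by simpa using hy'
    by_cases hxA : x ∈ A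
    · exact ⟨y, fun h => hyx' (hA y h x hxA hyx), hyv, fun h => hyv' h.symm⟩
    · exact ⟨x, hxA, hxv, fun h => hx' h.symm⟩

/-- A vertex outside `X` with both a neighbour and a non-neighbour in `X`. -/
lemma Ext.has_mixed {G : SimpleGraph V} (hG : Ext G) {X : Set V} (hr : Reg G X)
    (hX : X.Nontrivial) : Has G X False True True := by
  obtain ⟨u, hu, v, hv, huv⟩ := hX
  by_contra hno
  -- Without mixed vertices, every outer vertex is adjacent to all of `X` or to none of it.
  have key : ∀ w ∉ X, ∀ a ∈ X, ∀ b ∈ X, G.Adj w a → G.Adj w b := by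
    intro w hw a ha b hb hwa
    by_contra hwb
    exact hno ⟨w, by simp [hw], by simpa using ⟨a, ha, hwa⟩,
      by simpa using ⟨b, hb, fun h => hw (h ▸ hb), hwb⟩⟩
  obtain ⟨⟨w', hw', huw'⟩, ⟨w, hw, -, huw⟩⟩ := hr u
  have hww : w' ≠ w := fun h => huw (h ▸ huw')
  have h1 : u ≠ w := fun h => hw (h ▸ hu)
  have h2 : v ≠ w := fun h => hw (h ▸ hv)
  have h3 : w' ≠ u := fun h => hw' (h ▸ hu)
  have h4 : v ≠ w' := fun h => hw' (h ▸ hv)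
  -- If `x` is outside `X`, it separates `u` from `v`. If `x` is inside, then `w` is adjacent to `x`
  -- but not to `u`. Both contradict `key`.
  obtain ⟨x, ⟨-, x1⟩, ⟨-, x2⟩, ⟨-, x3⟩, ⟨-, x4⟩, -⟩ :=
    hG.exists_pattern (fun a => a = u ∨ a = w) u v w w' u u
  simp [huv.symm, h2, h1.symm, hww, h3] at x1 x2 x3 x4
  by_cases hx : x ∈ X
  · exact huw ((key w hw x hx u hu x3.symm).symm)
  · exact x2 (key x hx u hu v hv x1)

/-- All members of a nontrivial clique have the same kind. An outer vertex without non-neighbours in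
`A` is a failure of maximality, and one without neighbours in `A` a failure of domination. -/
lemma has_clique {G : SimpleGraph V} {A : Set V} {d m : Prop} (hA : IsCliqueKind G A d m) :
    (¬ Has G A True True True) ∧ Has G A True True False ∧ (¬ Has G A True False True) ∧
      (Has G A False True False ↔ ¬ m) ∧ (Has G A False False True ↔ ¬ d) := by
  obtain ⟨hn, hA, hd, hm⟩ := hA
  have hfull : ∀ v ∈ A, ¬ ∃ y, y ∈ A ∧ y ≠ v ∧ ¬ G.Adj v y := by
    rintro v hv ⟨y, hy, hyv, h⟩
    exact h (hA v hv y hy hyv.symm)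
  have hnb : ∀ v ∈ A, ∃ y, y ∈ A ∧ G.Adj v y := by
    intro v hv
    obtain ⟨y, hy, hyv⟩ := hn.exists_ne v
    exact ⟨y, hy, hA v hv y hy hyv.symm⟩
  refine ⟨?_, ?_, ?_, ?_, ?_⟩
  · rintro ⟨v, h1, h2, h3⟩
    exact hfull v (h1.2 trivial) (h3.2 trivial)
  · obtain ⟨v, hv⟩ := hn.nonempty
    exact ⟨v, iff_of_true hv trivial, iff_of_true (hnb v hv) trivial,
      iff_of_false (hfull v hv) id⟩
  · rintro ⟨v, h1, h2, h3⟩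
    exact hfull v (h1.2 trivial) (h3.2 trivial)
  · rw [← hm]
    constructor
    · rintro ⟨v, h1, h2, h3⟩ h
      have hv : v ∉ A := fun h => h1.1 h
      obtain ⟨a, ha, hva⟩ := h v hv
      exact h3.1 ⟨a, ha, fun h => hv (h ▸ ha), hva⟩
    · intro h
      push Not at h
      obtain ⟨w, hw, h⟩ := h
      obtain ⟨a, ha⟩ := hn.nonempty
      exact ⟨w, iff_of_false hw id, iff_of_true ⟨a, ha, h a ha⟩ trivial,
        iff_of_false (fun ⟨y, hy, _, hy'⟩ => hy' (h y hy)) id⟩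
  · rw [← hd]
    constructor
    · rintro ⟨v, h1, h2, h3⟩ h
      exact h2.1 (h v (fun h => h1.1 h))
    · intro h
      push Not at h
      obtain ⟨w, hw, h⟩ := h
      obtain ⟨a, ha⟩ := hn.nonempty
      exact ⟨w, iff_of_false hw id, iff_of_false (fun ⟨y, hy, hy'⟩ => h y hy hy') id,
        iff_of_true ⟨a, ha, fun h => hw (h ▸ ha), h a ha⟩ trivial⟩

lemma Ext.range_vtype_eq_of_clique {G : SimpleGraph V} {G' : SimpleGraph V'} (hG : Ext G)
    (hG' : Ext G') {A : Set V} {A' : Set V'} {d m : Prop} (hA : IsCliqueKind G A d m)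
    (hA' : IsCliqueKind G' A' d m) :
    Set.range (vtype G A) = Set.range (vtype G' A') := by
  have hr := hG.reg_of_clique hA.2.1
  have hr' := hG'.reg_of_clique hA'.2.1
  obtain ⟨h1, h2, h3, h4, h5⟩ := has_clique hA
  obtain ⟨h1', h2', h3', h4', h5'⟩ := has_clique hA'
  exact range_vtype_eq_of_nontrivial hr hr' hA.1 hA'.1 (iff_of_false h1 h1') (iff_of_true h2 h2')
    (iff_of_false h3 h3') (iff_of_true (hG.has_mixed hr hA.1) (hG'.has_mixed hr' hA'.1))
    (h4.trans h4'.symm) (h5.trans h5'.symm)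

/-- A single edge serves: the extension property gives a common neighbour of its ends and a vertex
adjacent to neither. -/
lemma Ext.exists_edge_kind [Nonempty V] {G : SimpleGraph V} (hG : Ext G) :
    ∃ A, IsCliqueKind G A False False := by
  obtain ⟨s⟩ := ‹Nonempty V›
  obtain ⟨t, ⟨hts, h⟩, -⟩ := hG.exists_pattern (fun _ => True) s s s s s s
  have hst : G.Adj t s := by simpa using h
  obtain ⟨x, ⟨x1, x2⟩, ⟨x3, x4⟩, -⟩ := hG.exists_pattern (fun _ => True) s t s s s s
  obtain ⟨y, ⟨y1, y2⟩, ⟨y3, y4⟩, -⟩ := hG.exists_pattern (fun _ => False) s t s s s s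
  simp only [iff_true, iff_false] at x2 x4 y2 y4
  refine ⟨{s, t}, Set.nontrivial_pair hts.symm, ?_, ?_, ?_⟩
  · simp [hst, hst.symm]
  · refine iff_of_false (fun h => ?_) id
    obtain ⟨a, ha, ha'⟩ := h y (by simp [y1, y3])
    rcases ha with rfl | rfl
    exacts [y2 ha', y4 ha']
  · refine iff_of_false (fun h => ?_) id
    obtain ⟨a, ha, ha'⟩ := h x (by simp [x1, x3])
    rcases ha with rfl | rfl
    exacts [ha' x2, ha' x4]

end Transfer

/-! ### Sets with generic vertices and any admissible exceptional kinds -/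

section Transfer

variable {V V' : Type*}

/-- Vertices for `Ext.exists_generic`: `u`, `v` serve to keep vertices out of the set, and `a`, `b`,
`c` will be the exceptional ones. Since `a` may itself enter the set, its adjacency to `b` and `c`
must fit their roles. -/
lemma Ext.exists_five [Nonempty V] {G : SimpleGraph V} (hG : Ext G) :
    ∃ u v a b c : V, [u, v, a, b, c].Nodup ∧ ¬ G.Adj a b ∧ G.Adj a c := by
  obtain ⟨a⟩ := ‹Nonempty V›
  obtain ⟨b, hb, -⟩ := hG.exists_pattern (fun _ => False) a a a a a a
  obtain ⟨c, hc, hc', -⟩ := hG.exists_pattern (fun _ => True) a b a a a a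
  obtain ⟨v, hv1, hv2, hv3, -⟩ := hG.exists_pattern (fun _ => True) a b c a a a
  obtain ⟨u, hu1, hu2, hu3, hu4, -⟩ := hG.exists_pattern (fun _ => True) a b c v a a
  refine ⟨u, v, a, b, c, ?_, fun h => hb.2.1 h.symm, (hc.2.2 trivial).symm⟩
  have := hb.1.symm
  have := hc.1.symm
  have := hc'.1.symm
  simp [*]

/-- Realisation of patterns on five distinct vertices and a further vertex. -/
lemma Ext.exists_pattern_five {G : SimpleGraph V} (hG : Ext G) {u v a b c : V}
    (hnd : [u, v, a, b, c].Nodup) (w : V) (hw : w ∉ [u, v, a, b, c]) (βu βv βa βb βc βw : Prop) :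
    ∃ z, (z ≠ u ∧ z ≠ v ∧ z ≠ a ∧ z ≠ b ∧ z ≠ c) ∧ z ≠ w ∧ (G.Adj u z ↔ βu) ∧ (G.Adj v z ↔ βv) ∧
      (G.Adj a z ↔ βa) ∧ (G.Adj b z ↔ βb) ∧ (G.Adj c z ↔ βc) ∧ (G.Adj w z ↔ βw) := by
  simp only [List.nodup_cons, List.mem_cons, List.not_mem_nil, or_false, not_or] at hnd hw
  obtain ⟨⟨huv, hua, hub, huc⟩, ⟨hva, hvb, hvc⟩, ⟨hab', hac'⟩, hbc, -⟩ := hnd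
  obtain ⟨wu, wv, wa, wb, wc⟩ := hw
  obtain ⟨z, h1, h2, h3, h4, h5, h6⟩ := hG.exists_pattern (fun x => (x = u ∧ βu) ∨ (x = v ∧ βv) ∨
    (x = a ∧ βa) ∨ (x = b ∧ βb) ∨ (x = c ∧ βc) ∨ (x = w ∧ βw)) u v a b c w
  refine ⟨z, ⟨h1.1, h2.1, h3.1, h4.1, h5.1⟩, h6.1, ?_, ?_, ?_, ?_, ?_, ?_⟩ <;> rw [G.adj_comm]
  · rw [h1.2]; simp [huv, hua, hub, huc, Ne.symm wu]
  · rw [h2.2]; simp [hva, hvb, hvc, Ne.symm wv, Ne.symm huv]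
  · rw [h3.2]; simp [hab', hac', Ne.symm wa, Ne.symm hua, Ne.symm hva]
  · rw [h4.2]; simp [hbc, Ne.symm wb, Ne.symm hub, Ne.symm hvb, Ne.symm hab']
  · rw [h5.2]; simp [Ne.symm wc, Ne.symm huc, Ne.symm hvc, Ne.symm hac', Ne.symm hbc]
  · rw [h6.2]; simp [wu, wv, wa, wb, wc]

/-- For every admissible choice of the remaining kinds of vertices there is a set in which
vertices of all these kinds occur besides generic vertices. -/
lemma Ext.exists_generic [Nonempty V] {G : SimpleGraph V} (hG : Ext G) (e₁ e₂ e₃ : Prop) :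
    ∃ X : Set V, X.Nontrivial ∧ Reg G X ∧ Has G X True True True ∧
      (Has G X True True False ↔ e₁) ∧ (¬ Has G X True False True) ∧
      (Has G X False False True ↔ e₂) ∧ (Has G X False True False ↔ e₃) := by
  obtain ⟨u, v, a, b, c, hnd, hab, hac⟩ := hG.exists_five
  have hpat := hG.exists_pattern_five hnd
  simp only [List.nodup_cons, List.mem_cons, List.not_mem_nil, or_false, not_or] at hnd hpat
  obtain ⟨⟨huv, hua, hub, huc⟩, ⟨hva, hvb, hvc⟩, ⟨hab', hac'⟩, hbc, -⟩ := hnd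
  -- A dummy sixth vertex, for patterns on the five vertices alone.
  obtain ⟨w₀, w1, w2, w3, w4, w5, -⟩ := hG.exists_pattern (fun _ => True) u v a b c c
  have hpat' := fun βu βv βa βb βc : Prop =>
    hpat w₀ ⟨w1.1, w2.1, w3.1, w4.1, w5.1⟩ βu βv βa βb βc True
  clear huv hub huc hua hva hvb hvc hbc w1 w2 w3 w4 w5
  -- Members other than `a` do not separate `u` from `v`. When requested, `a` is a member adjacent
  -- to all others, `b` an outer vertex without neighbours in `X`, and `c` an outer vertex adjacent
  -- to all of `X`.
  obtain ⟨X, hX⟩ : ∃ X : Set V, ∀ x, x ∈ X ↔ ((x ≠ u ∧ x ≠ v ∧ x ≠ a ∧ x ≠ b ∧ x ≠ c) ∧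
      (G.Adj u x ↔ G.Adj v x) ∧ (e₁ → G.Adj a x) ∧ (e₂ → ¬ G.Adj b x) ∧ (e₃ → G.Adj c x)) ∨
      (x = a ∧ e₁) := ⟨{x | _}, fun x => Iff.rfl⟩
  have hmem : ∀ z, (z ≠ u ∧ z ≠ v ∧ z ≠ a ∧ z ≠ b ∧ z ≠ c) → (G.Adj u z ↔ G.Adj v z) →
      (e₁ → G.Adj a z) → (e₂ → ¬ G.Adj b z) → (e₃ → G.Adj c z) → z ∈ X :=
    fun z hz h h1 h2 h3 => (hX z).2 (Or.inl ⟨hz, h, h1, h2, h3⟩)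
  have hnot : ∀ z, (z ≠ u ∧ z ≠ v ∧ z ≠ a ∧ z ≠ b ∧ z ≠ c) → G.Adj u z = ¬ G.Adj v z → z ∉ X := by
    intro z hz h hzX
    rcases (hX z).1 hzX with h' | h'
    · have := h'.2.1
      rw [h] at this
      exact not_iff_self this
    · exact hz.2.2.1 h'.1
  -- A vertex separating `u` from `v` is outside `X`, whatever its adjacency to `w`; for `w = u` or
  -- `w = v` the other of the two is given the opposite adjacency.
  have hout : ∀ w, ∀ β : Prop, ∃ z, z ∉ X ∧ z ≠ w ∧ (G.Adj w z ↔ β) := by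
    intro w β
    by_cases hwu : w = u
    · subst hwu
      obtain ⟨z, h, -, h1, h2, h3, h4, h5, -⟩ := hpat' β (¬ β) True True True
      exact ⟨z, hnot z h (by simp [h1, h2]), h.1, h1⟩
    by_cases hwv : w = v
    · subst hwv
      obtain ⟨z, h, -, h1, h2, h3, h4, h5, -⟩ := hpat' (¬ β) β True True True
      exact ⟨z, hnot z h (by simp [h1, h2]), h.2.1, h2⟩
    by_cases hwa : w = a
    · subst hwa
      obtain ⟨z, h, -, h1, h2, h3, h4, h5, -⟩ := hpat' True False β True True
      exact ⟨z, hnot z h (by simp [h1, h2]), h.2.2.1, h3⟩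
    by_cases hwb : w = b
    · subst hwb
      obtain ⟨z, h, -, h1, h2, h3, h4, h5, -⟩ := hpat' True False True β True
      exact ⟨z, hnot z h (by simp [h1, h2]), h.2.2.2.1, h4⟩
    by_cases hwc : w = c
    · subst hwc
      obtain ⟨z, h, -, h1, h2, h3, h4, h5, -⟩ := hpat' True False True True β
      exact ⟨z, hnot z h (by simp [h1, h2]), h.2.2.2.2, h5⟩
    obtain ⟨z, h, hw, h1, h2, h3, h4, h5, h6⟩ :=
      hpat w ⟨hwu, hwv, hwa, hwb, hwc⟩ True False True True True β
    exact ⟨z, hnot z h (by simp [h1, h2]), hw, h6⟩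
  have hreg : Reg G X := fun w => by
    obtain ⟨y, h1, h2, h3⟩ := hout w True
    obtain ⟨z, h1', h2', h3'⟩ := hout w False
    exact ⟨⟨y, h1, h3.2 trivial⟩, ⟨z, h1', h2', h3'.1⟩⟩
  -- Dually, a vertex that respects all constraints is in `X`, and its adjacency to `w` is free
  -- unless `w` is an active exceptional vertex.
  have hin : ∀ w, (w = a → ¬ e₁) → (w = b → ¬ e₂) → (w = c → ¬ e₃) → ∀ β : Prop,
      ∃ z, z ∈ X ∧ z ≠ w ∧ (G.Adj w z ↔ β) := by
    intro w ha hb hc β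
    by_cases hwu : w = u
    · subst hwu
      obtain ⟨z, h, -, h1, h2, h3, h4, h5, -⟩ := hpat' β β True False True
      exact ⟨z, hmem z h (by simp [h1, h2]) (by simp [h3]) (by simp [h4]) (by simp [h5]), h.1, h1⟩
    by_cases hwv : w = v
    · subst hwv
      obtain ⟨z, h, -, h1, h2, h3, h4, h5, -⟩ := hpat' β β True False True
      exact ⟨z, hmem z h (by simp [h1, h2]) (by simp [h3]) (by simp [h4]) (by simp [h5]), h.2.1, h2⟩
    by_cases hwa : w = a
    · subst hwa
      obtain ⟨z, h, -, h1, h2, h3, h4, h5, -⟩ := hpat' True True β False True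
      exact ⟨z, hmem z h (by simp [h1, h2]) (by simp [ha rfl]) (by simp [h4]) (by simp [h5]),
        h.2.2.1, h3⟩
    by_cases hwb : w = b
    · subst hwb
      obtain ⟨z, h, -, h1, h2, h3, h4, h5, -⟩ := hpat' True True True β True
      exact ⟨z, hmem z h (by simp [h1, h2]) (by simp [h3]) (by simp [hb rfl]) (by simp [h5]),
        h.2.2.2.1, h4⟩
    by_cases hwc : w = c
    · subst hwc
      obtain ⟨z, h, -, h1, h2, h3, h4, h5, -⟩ := hpat' True True True False β
      exact ⟨z, hmem z h (by simp [h1, h2]) (by simp [h3]) (by simp [h4]) (by simp [hc rfl]),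
        h.2.2.2.2, h5⟩
    obtain ⟨z, h, hw, h1, h2, h3, h4, h5, h6⟩ :=
      hpat w ⟨hwu, hwv, hwa, hwb, hwc⟩ True True True False True β
    exact ⟨z, hmem z h (by simp [h1, h2]) (by simp [h3]) (by simp [h4]) (by simp [h5]), hw, h6⟩
  have hfull : ∀ w, (w = a → ¬ e₁) → (w = b → ¬ e₂) → (w = c → ¬ e₃) →
      (∃ y, y ∈ X ∧ G.Adj w y) ∧ ∃ y, y ∈ X ∧ y ≠ w ∧ ¬ G.Adj w y := by
    intro w ha hb hc
    obtain ⟨y, h1, h2, h3⟩ := hin w ha hb hc True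
    obtain ⟨z, h1', h2', h3'⟩ := hin w ha hb hc False
    exact ⟨⟨y, h1, h3.2 trivial⟩, ⟨z, h1', h2', h3'.1⟩⟩
  have haX : a ∈ X ↔ e₁ := by rw [hX]; simp
  have hbX : b ∉ X := by rw [hX]; simp [Ne.symm hab']
  have hcX : c ∉ X := by rw [hX]; simp [Ne.symm hac']
  obtain ⟨x, hx, -, x1, x2, x3, x4, x5, -⟩ := hpat' True True True False True
  have hxX : x ∈ X := hmem x hx (by simp [x1, x2]) (by simp [x3]) (by simp [x4]) (by simp [x5])
  have hxa : G.Adj a x := x3.2 trivial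
  have hxb : ¬ G.Adj b x := x4.1
  have hxc : G.Adj c x := x5.2 trivial
  obtain ⟨y, hy, hyx, -⟩ := hin x (fun h => absurd h hx.2.2.1) (fun h => absurd h hx.2.2.2.1)
    (fun h => absurd h hx.2.2.2.2) True
  clear hpat hpat' hmem hnot hin hout x1 x2 x3 x4 x5
  have ha1 : e₁ → ¬ ∃ y, y ∈ X ∧ y ≠ a ∧ ¬ G.Adj a y := by
    rintro h ⟨y, hy, hya, hy'⟩
    rcases (hX y).1 hy with hy | hy
    · exact hy' (hy.2.2.1 h)
    · exact hya hy.1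
  have hb1 : e₂ → ¬ ∃ y, y ∈ X ∧ G.Adj b y := by
    rintro h ⟨y, hy, hy'⟩
    rw [hX] at hy
    rcases hy with hy | ⟨rfl, -⟩
    · exact hy.2.2.2.1 h hy'
    · exact hab hy'.symm
  have hc1 : e₃ → ¬ ∃ y, y ∈ X ∧ y ≠ c ∧ ¬ G.Adj c y := by
    rintro h ⟨y, hy, hyc, hy'⟩
    rw [hX] at hy
    rcases hy with hy | ⟨rfl, -⟩
    · exact hy' (hy.2.2.2.2 h)
    · exact hy' hac.symm
  refine ⟨X, ⟨x, hxX, y, hy, hyx.symm⟩, hreg, ?_, ?_, ?_, ?_, ?_⟩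
  · have := hfull x (fun h => absurd h hx.2.2.1) (fun h => absurd h hx.2.2.2.1)
      (fun h => absurd h hx.2.2.2.2)
    exact ⟨x, iff_of_true hxX trivial, iff_of_true this.1 trivial, iff_of_true this.2 trivial⟩
  · constructor
    · rintro ⟨w, h1, h2, h3⟩
      by_contra he
      have hwX : w ∈ X := h1.2 trivial
      exact h3.1 (hfull w (fun _ => he) (fun h => absurd (h ▸ hwX) hbX)
        (fun h => absurd (h ▸ hwX) hcX)).2
    · intro he
      exact ⟨a, iff_of_true (haX.2 he) trivial, iff_of_true ⟨x, hxX, hxa⟩ trivial,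
        iff_of_false (ha1 he) id⟩
  · rintro ⟨w, h1, h2, h3⟩
    have hwX : w ∈ X := h1.2 trivial
    by_cases hw : w = a ∧ e₁
    · obtain ⟨rfl, he⟩ := hw
      exact ha1 he (h3.2 trivial)
    · exact h2.1 (hfull w (not_and.1 hw) (fun h => absurd (h ▸ hwX) hbX)
        (fun h => absurd (h ▸ hwX) hcX)).1
  · constructor
    · rintro ⟨w, h1, h2, h3⟩
      by_contra he
      have hwX : w ∉ X := h1.1
      by_cases hw : w = c ∧ e₃
      · obtain ⟨rfl, -⟩ := hw
        exact h2.1 ⟨x, hxX, hxc⟩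
      · exact h2.1 (hfull w (fun h h' => hwX (h ▸ haX.2 h')) (fun _ => he) (not_and.1 hw)).1
    · intro he
      exact ⟨b, iff_of_false hbX id, iff_of_false (hb1 he) id,
        iff_of_true ⟨x, hxX, hx.2.2.2.1, hxb⟩ trivial⟩
  · constructor
    · rintro ⟨w, h1, h2, h3⟩
      by_contra he
      have hwX : w ∉ X := h1.1
      by_cases hw : w = b ∧ e₂
      · obtain ⟨rfl, -⟩ := hw
        exact h3.1 ⟨x, hxX, hx.2.2.2.1, hxb⟩
      · exact h3.1 (hfull w (fun h h' => hwX (h ▸ haX.2 h')) (not_and.1 hw) (fun _ => he)).2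
    · intro he
      exact ⟨c, iff_of_false hcX id, iff_of_true ⟨x, hxX, hxc⟩ trivial,
        iff_of_false (hc1 he) id⟩

end Transfer

/-! ### Case analysis of sets and transfer of types between graphs -/

section Transfer

variable {V V' : Type*}

lemma Reg.compl {G : SimpleGraph V} {X : Set V} (h : Reg G X) : Reg Gᶜ X := by
  intro v
  obtain ⟨⟨y, hy, hy'⟩, ⟨z, hz, hz', hz''⟩⟩ := h v
  exact ⟨⟨z, hz, (compl_adj_iff G v z).2 ⟨hz', hz''⟩⟩,
    ⟨y, hy, (ne_and_not_compl_adj_iff G v y).2 hy'⟩⟩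

/-- Either some member of `X` is generic and `Ext.exists_generic` applies in `G'`, or no member has
a non-neighbour in `X`, so that `X` is a clique and `hQ` provides one of the same kind. -/
lemma Ext.exists_range_vtype_eq_of_no_isolated [Nonempty V'] {G : SimpleGraph V}
    {G' : SimpleGraph V'} (hG : Ext G) (hG' : Ext G')
    (hQ : ∀ d m, (∃ A, IsCliqueKind G A d m) → ∃ A, IsCliqueKind G' A d m) {X : Set V}
    (hr : Reg G X) (hX : X.Nontrivial) (ha : ¬ Has G X True False True) :
    ∃ X', Set.range (vtype G X) = Set.range (vtype G' X') := by
  by_cases h0 : Has G X True True True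
  · obtain ⟨X', hX', hr', h1, h2, h3, h4, h5⟩ := hG'.exists_generic (Has G X True True False)
      (Has G X False False True) (Has G X False True False)
    exact ⟨X', range_vtype_eq_of_nontrivial hr hr' hX hX' (iff_of_true h0 h1) h2.symm
      (iff_of_false ha h3) (iff_of_true (hG.has_mixed hr hX) (hG'.has_mixed hr' hX'))
      h5.symm h4.symm⟩
  · have hcl : ∀ u ∈ X, ∀ v ∈ X, u ≠ v → G.Adj u v := by
      intro u hu v hv huv
      by_contra hadj
      have hn : ∃ y, y ∈ X ∧ y ≠ u ∧ ¬ G.Adj u y := ⟨v, hv, huv.symm, hadj⟩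
      by_cases hy : ∃ y, y ∈ X ∧ G.Adj u y
      · exact h0 ⟨u, iff_of_true hu trivial, iff_of_true hy trivial, iff_of_true hn trivial⟩
      · exact ha ⟨u, iff_of_true hu trivial, iff_of_false hy id, iff_of_true hn trivial⟩
    have hkind : IsCliqueKind G X _ _ := ⟨hX, hcl, Iff.rfl, Iff.rfl⟩
    obtain ⟨X', hX'⟩ := hQ _ _ ⟨X, hkind⟩
    exact ⟨X', hG.range_vtype_eq_of_clique hG' hkind hX'⟩

lemma Ext.exists_range_vtype_eq_of_reg [Nonempty V] [Nonempty V'] {G : SimpleGraph V}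
    {G' : SimpleGraph V'} (hG : Ext G) (hG' : Ext G')
    (hQ : ∀ d m, (∃ A, IsCliqueKind G A d m) → ∃ A, IsCliqueKind G' A d m)
    (hQc : ∀ d m, (∃ A, IsCliqueKind Gᶜ A d m) → ∃ A, IsCliqueKind G'ᶜ A d m) {X : Set V}
    (hr : Reg G X) : ∃ X', Set.range (vtype G X) = Set.range (vtype G' X') := by
  obtain ⟨s'⟩ := ‹Nonempty V'›
  by_cases hX : X.Nontrivial
  · by_cases ha : Has G X True False True
    · have ha' : ¬ Has Gᶜ X True False True := by
        rw [has_compl]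
        rintro ⟨v, h1, h2, h3⟩
        obtain ⟨w, h1', h2', h3'⟩ := ha
        have hv : v ∈ X := h1.2 trivial
        have hw : w ∈ X := h1'.2 trivial
        by_cases hvw : v = w
        · subst hvw
          exact h3.1 (h3'.2 trivial)
        · by_cases hadj : G.Adj v w
          · exact h2'.1 ⟨v, hv, hadj.symm⟩
          · exact h3.1 ⟨w, hw, Ne.symm hvw, hadj⟩
      obtain ⟨X', hX'⟩ :=
        hG.compl.exists_range_vtype_eq_of_no_isolated hG'.compl hQc hr.compl hX ha'
      refine ⟨X', ?_⟩
      simpa only [compl_compl] using range_vtype_compl_graph hX'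
    · exact hG.exists_range_vtype_eq_of_no_isolated hG' hQ hr hX ha
  · rcases (Set.not_nontrivial_iff.1 hX).eq_empty_or_singleton with rfl | ⟨s, rfl⟩
    · exact ⟨∅, range_vtype_eq_of_has hr ((hG'.reg_singleton s').mono (Set.empty_subset _))
        fun c n m => by rw [has_empty_iff, has_empty_iff]⟩
    · exact ⟨{s'}, range_vtype_eq_of_has hr (hG'.reg_singleton s')
        fun c n m => by rw [hG.has_singleton_iff, hG'.has_singleton_iff]⟩

/-- Vertices other than `s` see all four combinations, because adjacency to `s` and to `v ≠ s` can
be prescribed independently. Only `s` is special, and its own membership in `X` is left open. -/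
lemma Ext.range_vtype_neighborhood {G : SimpleGraph V} (hG : Ext G) {s : V} {X : Set V}
    (hX : ∀ y, y ≠ s → (y ∈ X ↔ G.Adj s y)) :
    Set.range (vtype G X) = {(s ∈ X, True, False, False, True), (True, True, True, True, True),
      (False, True, True, True, True)} := by
  have hs : vtype G X s = (s ∈ X, True, False, False, True) := by
    obtain ⟨y, ⟨y1, y2⟩, -⟩ := hG.exists_pattern (fun _ => True) s s s s s s
    obtain ⟨z, ⟨z1, z2⟩, -⟩ := hG.exists_pattern (fun _ => False) s s s s s s
    have hy : G.Adj s y := (y2.2 trivial).symm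
    have hz : ¬ G.Adj s z := fun h => z2.1 h.symm
    simp only [vtype, Prod.mk.injEq, eq_iff_iff, true_and, iff_true, iff_false]
    refine ⟨⟨y, (hX y y1).2 hy, hy⟩, ?_, ?_, ⟨z, fun h => hz ((hX z z1).1 h), z1, hz⟩⟩
    · rintro ⟨a, ha, has, h⟩
      exact h ((hX a has).1 ha)
    · rintro ⟨a, ha, h⟩
      exact ha ((hX a h.ne').2 h)
  have hne : ∀ v, v ≠ s → vtype G X v = (v ∈ X, True, True, True, True) := by
    intro v hv
    have key : ∀ α β : Prop, ∃ y, y ≠ v ∧ (y ∈ X ↔ α) ∧ (G.Adj v y ↔ β) := by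
      intro α β
      obtain ⟨y, ⟨y1, y2⟩, ⟨y3, y4⟩, -⟩ :=
        hG.exists_pattern (fun x => (x = s ∧ α) ∨ (x = v ∧ β)) s v s s s s
      refine ⟨y, y3, ?_, ?_⟩
      · rw [hX y y1, G.adj_comm, y2]
        simp [hv.symm]
      · rw [G.adj_comm, y4]
        simp [hv]
    simp only [vtype, Prod.mk.injEq, eq_iff_iff, true_and, iff_true]
    refine ⟨?_, ?_, ?_, ?_⟩
    · obtain ⟨y, h1, h2, h3⟩ := key True True
      exact ⟨y, h2.2 trivial, h3.2 trivial⟩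
    · obtain ⟨y, h1, h2, h3⟩ := key True False
      exact ⟨y, h2.2 trivial, h1, h3.1⟩
    · obtain ⟨y, h1, h2, h3⟩ := key False True
      exact ⟨y, h2.1, h3.2 trivial⟩
    · obtain ⟨y, h1, h2, h3⟩ := key False False
      exact ⟨y, h2.1, h1, h3.1⟩
  ext t
  simp only [Set.mem_range, Set.mem_insert_iff, Set.mem_singleton_iff]
  constructor
  · rintro ⟨v, rfl⟩
    by_cases hv : v = s
    · subst hv
      exact Or.inl hs
    · right
      rw [hne v hv]
      by_cases hvX : v ∈ X <;> simp [hvX]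
  · rintro (rfl | rfl | rfl)
    · exact ⟨s, hs⟩
    · obtain ⟨y, ⟨y1, y2⟩, -⟩ := hG.exists_pattern (fun _ => True) s s s s s s
      refine ⟨y, ?_⟩
      rw [hne y y1]
      simp [hX y y1, G.adj_comm s, y2]
    · obtain ⟨y, ⟨y1, y2⟩, -⟩ := hG.exists_pattern (fun _ => False) s s s s s s
      refine ⟨y, ?_⟩
      rw [hne y y1]
      simp [hX y y1, G.adj_comm s, y2]

lemma Ext.exists_range_vtype_eq_of_neighborhood [Nonempty V'] {G : SimpleGraph V}
    {G' : SimpleGraph V'} (hG : Ext G) (hG' : Ext G') {s : V} {X : Set V}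
    (hX : ∀ y, y ≠ s → (y ∈ X ↔ G.Adj s y)) :
    ∃ X', Set.range (vtype G X) = Set.range (vtype G' X') := by
  obtain ⟨s'⟩ := ‹Nonempty V'›
  refine ⟨{y | G'.Adj s' y ∨ (y = s' ∧ s ∈ X)}, ?_⟩
  rw [hG.range_vtype_neighborhood hX, hG'.range_vtype_neighborhood (s := s')]
  · simp
  · intro y hy
    simp [hy]

/-- Sets realising the same vertex types can be found in any two graphs with the extension property
that have the same kinds of cliques and of independent sets. -/
theorem Ext.exists_range_vtype_eq [Nonempty V] [Nonempty V'] {G : SimpleGraph V}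
    {G' : SimpleGraph V'} (hG : Ext G) (hG' : Ext G')
    (hQ : ∀ d m, (∃ A, IsCliqueKind G A d m) → ∃ A, IsCliqueKind G' A d m)
    (hQc : ∀ d m, (∃ A, IsCliqueKind Gᶜ A d m) → ∃ A, IsCliqueKind G'ᶜ A d m) (X : Set V) :
    ∃ X', Set.range (vtype G X) = Set.range (vtype G' X') := by
  by_cases hr : Reg G X
  · exact hG.exists_range_vtype_eq_of_reg hG' hQ hQc hr
  by_cases hrc : Reg G Xᶜ
  · obtain ⟨X', hX'⟩ := hG.exists_range_vtype_eq_of_reg hG' hQ hQc hrc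
    refine ⟨X'ᶜ, ?_⟩
    simpa only [compl_compl] using range_vtype_compl_set hX'
  simp only [Reg, not_forall] at hr hrc
  obtain ⟨s, hs⟩ := hr
  obtain ⟨t, ht⟩ := hrc
  -- Failure of regularity at `s` means that `X` contains all neighbours of `s` or all its other
  -- non-neighbours; `β` tells which.
  have hs' : ∃ β : Prop, ∀ y, y ≠ s → (G.Adj s y ↔ β) → y ∈ X := by
    by_contra hc
    push Not at hc
    obtain ⟨y, h1, h2, h3⟩ := hc True
    obtain ⟨z, h1', h2', h3'⟩ := hc False
    exact hs ⟨⟨y, h3, h2.2 trivial⟩, ⟨z, h3', h1', h2'.1⟩⟩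
  have ht' : ∃ β : Prop, ∀ y, y ≠ t → (G.Adj t y ↔ β) → y ∉ X := by
    by_contra hc
    push Not at hc
    obtain ⟨y, h1, h2, h3⟩ := hc True
    obtain ⟨z, h1', h2', h3'⟩ := hc False
    exact ht ⟨⟨y, by simpa using h3, h2.2 trivial⟩, ⟨z, by simpa using h3', h1', h2'.1⟩⟩
  obtain ⟨β, hβ⟩ := hs'
  obtain ⟨γ, hγ⟩ := ht'
  have hst : s = t := by
    by_contra hst
    -- For `s ≠ t` this vertex would be forced both into `X` and out of it.
    obtain ⟨z, ⟨z1, z2⟩, ⟨z3, z4⟩, -⟩ :=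
      hG.exists_pattern (fun x => (x = s ∧ β) ∨ (x = t ∧ γ)) s t s s s s
    refine hγ z z3 ?_ (hβ z z1 ?_)
    · rw [G.adj_comm, z4]; simp [Ne.symm hst]
    · rw [G.adj_comm, z2]; simp [hst]
  subst hst
  -- `β` and `γ` must be opposite, since otherwise one vertex would be in `X` and outside it. So,
  -- apart from `s`, either `X` or `Xᶜ` is the neighbourhood of `s`.
  by_cases hb : β
  · have hX : ∀ y, y ≠ s → (y ∈ X ↔ G.Adj s y) := by
      have hc : ¬ γ := by
        intro hc
        obtain ⟨z, ⟨z1, z2⟩, -⟩ := hG.exists_pattern (fun _ => True) s s s s s s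
        have : G.Adj s z := (z2.2 trivial).symm
        exact hγ z z1 (iff_of_true this hc) (hβ z z1 (iff_of_true this hb))
      intro y hy
      refine ⟨fun h => ?_, fun h => hβ y hy (iff_of_true h hb)⟩
      by_contra h'
      exact hγ y hy (iff_of_false h' hc) h
    exact hG.exists_range_vtype_eq_of_neighborhood hG' hX
  · have hX : ∀ y, y ≠ s → (y ∈ Xᶜ ↔ G.Adj s y) := by
      have hc : γ := by
        by_contra hc
        obtain ⟨z, ⟨z1, z2⟩, -⟩ := hG.exists_pattern (fun _ => False) s s s s s s
        have : ¬ G.Adj s z := fun h => z2.1 h.symm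
        exact hγ z z1 (iff_of_false this hc) (hβ z z1 (iff_of_false this hb))
      intro y hy
      refine ⟨fun h => ?_, fun h => hγ y hy (iff_of_true h hc)⟩
      by_contra h'
      exact h (hβ y hy (iff_of_false h' hb))
    obtain ⟨X', hX'⟩ := hG.exists_range_vtype_eq_of_neighborhood hG' hX
    refine ⟨X'ᶜ, ?_⟩
    simpa only [compl_compl] using range_vtype_compl_set hX'

/-- The sentences of quantifier depth two do not distinguish between graphs with the extension
property that have the same kinds of cliques and of independent sets. -/
theorem Ext.models_of_models [Nonempty V] [Nonempty V'] {G : SimpleGraph V}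
    {G' : SimpleGraph V'} (hG : Ext G) (hG' : Ext G')
    (hQ : ∀ d m, (∃ A, IsCliqueKind G A d m) → ∃ A, IsCliqueKind G' A d m)
    (hQc : ∀ d m, (∃ A, IsCliqueKind Gᶜ A d m) → ∃ A, IsCliqueKind G'ᶜ A d m)
    {φ : Sentence₁} (hφ : φ ∈ E₁ 2) (h : Models G φ) : Models G' φ := by
  obtain ⟨X, hX⟩ := h
  obtain ⟨X', hX'⟩ := hG.exists_range_vtype_eq hG' hQ hQc X
  exact ⟨X', (realize_iff_of_range_vtype_eq hX' (le_of_eq hφ)).1 hX⟩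

end Transfer

/-! ### Edge patterns in the binomial random graph -/

section EdgePatterns

open SimpleGraph ProbabilityTheory

variable {V : Type*}

instance [Fintype V] : MeasurableSingletonClass (SimpleGraph V) where
  measurableSet_singleton G := by
    have : ({G} : Set (SimpleGraph V)) = edgeSet ⁻¹' {G.edgeSet} := by
      ext H
      simp
    rw [this]
    exact measurable_edgeSet (measurableSet_singleton _)

lemma measurable_fromEdgeSet_setOf :
    Measurable fun f : Sym2 V → Prop => fromEdgeSet {e | f e} :=
  measurable_fromEdgeSet.comp MeasurableEquiv.setOfPred.measurable

lemma binomialRandom_eq_map_infinitePi [Fintype V] (p : I) :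
    binomialRandom V p = Measure.map (fun f : Sym2 V → Prop => fromEdgeSet {e | f e})
      (Measure.infinitePi fun e : Sym2 V ↦
        toNNReal p • .dirac (e ∈ Sym2.diagSetᶜ) + toNNReal (σ p) • .dirac False) := by
  rw [binomialRandom_eq_map, setBernoulli_eq_map]
  exact Measure.map_map measurable_fromEdgeSet MeasurableEquiv.setOfPred.measurable

/-- `fromEdgeSet` discards the diagonal, so membership of `e` is a function of the single coordinate
`e` of the product measure, with diagonal coordinates made constantly false. -/
lemma iIndepFun_mem_edgeSet [Fintype V] (p : I) :
    iIndepFun (fun (e : Sym2 V) (G : SimpleGraph V) => e ∈ G.edgeSet) (binomialRandom V p) := by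
  have key := iIndepFun_infinitePi (P := fun e : Sym2 V ↦
    toNNReal p • Measure.dirac (e ∈ Sym2.diagSetᶜ) + toNNReal (σ p) • Measure.dirac False)
    (X := fun e (b : Prop) => (b ∧ ¬ e.IsDiag)) (fun e => measurable_from_top)
  rw [iIndepFun_iff_measure_inter_preimage_eq_mul] at key ⊢
  intro S sets hsets
  have hpre : ∀ e, (fun f : Sym2 V → Prop => fromEdgeSet {e | f e}) ⁻¹'
      ((fun G : SimpleGraph V => e ∈ G.edgeSet) ⁻¹' sets e) =
      (fun f : Sym2 V → Prop => (f e ∧ ¬ e.IsDiag)) ⁻¹' sets e := by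
    intro e
    ext f
    simp [edgeSet_fromEdgeSet]
  rw [binomialRandom_eq_map_infinitePi,
    Measure.map_apply measurable_fromEdgeSet_setOf (Set.toFinite _).measurableSet, Set.preimage_iInter₂]
  simp only [hpre]
  rw [key S hsets]
  refine Finset.prod_congr rfl fun e _ => ?_
  rw [Measure.map_apply measurable_fromEdgeSet_setOf (Set.toFinite _).measurableSet, hpre]

lemma real_mem_edgeSet [Fintype V] (p : I) {e : Sym2 V} (he : ¬ e.IsDiag) :
    (binomialRandom V p).real {G | e ∈ G.edgeSet} = p := by
  have hpre : (fun f : Sym2 V → Prop => fromEdgeSet {e | f e}) ⁻¹' {G | e ∈ G.edgeSet} =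
      (fun f => f e) ⁻¹' {True} := by
    ext f
    simpa [edgeSet_fromEdgeSet] using fun _ => he
  rw [measureReal_def, binomialRandom_eq_map_infinitePi,
    Measure.map_apply measurable_fromEdgeSet_setOf (Set.toFinite _).measurableSet, hpre,
    ← Measure.map_apply (measurable_pi_apply e) (measurableSet_singleton _),
    Measure.infinitePi_map_eval]
  simp [he]

/-- The event `D` depends only on the edges in `S`. -/
def DetBy (S : Finset (Sym2 V)) (D : Set (SimpleGraph V)) : Prop :=
  ∀ G H : SimpleGraph V, (∀ e ∈ S, e ∈ G.edgeSet ↔ e ∈ H.edgeSet) → (G ∈ D ↔ H ∈ D)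

/-- Each event is the preimage of a set under restriction to its own edges, and restrictions to
disjoint edge sets are independent. -/
lemma DetBy.real_inter [Fintype V] (p : I) {S T : Finset (Sym2 V)} {D E : Set (SimpleGraph V)}
    (hD : DetBy S D) (hE : DetBy T E) (hST : Disjoint S T) :
    (binomialRandom V p).real (D ∩ E) =
      (binomialRandom V p).real D * (binomialRandom V p).real E := by
  have hind := (iIndepFun_mem_edgeSet (V := V) p).indepFun_finset S T hST
    (fun e => measurable_of_finite _)
  have aux : ∀ (S : Finset (Sym2 V)) (D : Set (SimpleGraph V)), DetBy S D →
      D = (fun G (e : S) => (e : Sym2 V) ∈ G.edgeSet) ⁻¹'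
        ((fun G (e : S) => (e : Sym2 V) ∈ G.edgeSet) '' D) := by
    intro S D hD
    refine (Set.subset_preimage_image _ _).antisymm ?_
    rintro G ⟨H, hH, hGH⟩
    refine (hD H G fun e he => ?_).1 hH
    exact Iff.of_eq (congrFun hGH ⟨e, he⟩)
  rw [aux S D hD, aux T E hE, measureReal_def, measureReal_def, measureReal_def,
    hind.measure_inter_preimage_eq_mul _ _ (Set.toFinite _).measurableSet
      (Set.toFinite _).measurableSet, ENNReal.toReal_mul]

/-- The first conclusion feeds the induction, where the new event must be independent of the
intersection of the earlier ones. -/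
lemma DetBy.real_iInter [Fintype V] (p : I) {ι : Type*} [DecidableEq (Sym2 V)] (s : Finset ι)
    {S : ι → Finset (Sym2 V)} {D : ι → Set (SimpleGraph V)} (hD : ∀ i ∈ s, DetBy (S i) (D i))
    (hS : (s : Set ι).PairwiseDisjoint S) :
    DetBy (s.biUnion S) {G | ∀ i ∈ s, G ∈ D i} ∧
    (binomialRandom V p).real {G | ∀ i ∈ s, G ∈ D i} =
      ∏ i ∈ s, (binomialRandom V p).real (D i) := by
  classical
  induction s using Finset.induction_on with
  | empty => simp [DetBy]
  | insert i s hi ih =>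
    have ih' := ih (fun j hj => hD j (Finset.mem_insert_of_mem hj))
      (hS.subset (by simp))
    have hdet := hD i (Finset.mem_insert_self _ _)
    have heq : {G : SimpleGraph V | ∀ j ∈ insert i s, G ∈ D j} =
        D i ∩ {G | ∀ j ∈ s, G ∈ D j} := by
      ext G
      simp
    refine ⟨?_, ?_⟩
    · intro G H hGH
      refine forall₂_congr fun j hj => hD j hj G H fun e he => hGH e ?_
      exact Finset.mem_biUnion.2 ⟨j, hj, he⟩
    · rw [heq, hdet.real_inter p ih'.1, ih'.2, Finset.prod_insert hi]
      rw [Finset.disjoint_biUnion_right]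
      intro j hj
      exact hS (by simp) (by simp [hj]) (fun h => hi (h ▸ hj))

lemma detBy_pattern (E : Finset (Sym2 V)) (b : Sym2 V → Prop) :
    DetBy E {G | ∀ e ∈ E, e ∈ G.edgeSet ↔ b e} := by
  intro G H hGH
  exact forall₂_congr fun e he => by rw [hGH e he]

/-- The probability of a prescribed pattern of edges and non-edges. -/
lemma real_pattern [Fintype V] [DecidableEq V] (p : I) {E F : Finset (Sym2 V)} (hE : ∀ e ∈ E, ¬ e.IsDiag)
    (hF : ∀ e ∈ F, ¬ e.IsDiag) (hEF : Disjoint E F) :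
    (binomialRandom V p).real {G | (∀ e ∈ E, e ∈ G.edgeSet) ∧ ∀ e ∈ F, e ∉ G.edgeSet} =
      (p : ℝ) ^ E.card * (1 - (p : ℝ)) ^ F.card := by
  have h1 : ∀ (E : Finset (Sym2 V)) (b : Prop), DetBy E {G | ∀ e ∈ E, e ∈ G.edgeSet ↔ b} ∧
      (binomialRandom V p).real {G | ∀ e ∈ E, e ∈ G.edgeSet ↔ b} =
      ∏ e ∈ E, (binomialRandom V p).real {G | e ∈ G.edgeSet ↔ b} := by
    intro E b
    have := DetBy.real_iInter p E (S := fun e => {e})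
      (D := fun e => {G : SimpleGraph V | e ∈ G.edgeSet ↔ b})
      (fun e _ G H h => by simp [h e (Finset.mem_singleton_self e)])
      (fun e _ f _ hef => by simpa using hef)
    exact ⟨detBy_pattern E fun _ => b, this.2⟩
  have hset : {G : SimpleGraph V | (∀ e ∈ E, e ∈ G.edgeSet) ∧ ∀ e ∈ F, e ∉ G.edgeSet} =
      {G | ∀ e ∈ E, e ∈ G.edgeSet ↔ True} ∩ {G | ∀ e ∈ F, e ∈ G.edgeSet ↔ False} := by
    ext G
    simp
  rw [hset, (h1 E True).1.real_inter p (h1 F False).1 hEF, (h1 E True).2, (h1 F False).2,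
    Finset.prod_congr rfl (g := fun _ => (p : ℝ)), Finset.prod_const,
    Finset.prod_congr rfl (g := fun _ => 1 - (p : ℝ)), Finset.prod_const]
  · intro e he
    rw [← real_mem_edgeSet p (hF e he), ← probReal_compl_eq_one_sub (Set.toFinite _).measurableSet]
    congr 1
    ext G
    simp
  · intro e he
    rw [← real_mem_edgeSet p (hE e he)]
    simp

/-- The complement of the binomial random graph is a binomial random graph. -/
lemma real_compl_mem [Fintype V] (p : I) (D : Set (SimpleGraph V)) :
    (binomialRandom V p).real {G | Gᶜ ∈ D} = (binomialRandom V (σ p)).real D := by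
  classical
  have hmeas : Measurable (fun G : SimpleGraph V => Gᶜ) := measurable_of_finite _
  suffices h : (binomialRandom V p).map (fun G => Gᶜ) = binomialRandom V (σ p) by
    rw [← h, map_measureReal_apply hmeas (Set.toFinite _).measurableSet]
    rfl
  -- On a singleton both measures are products over edges and non-edges, with `p` and `1 - p`
  -- exchanged.
  refine Measure.ext_of_singleton fun G => ?_
  rw [Measure.map_apply hmeas (measurableSet_singleton _),
    ← ENNReal.toReal_eq_toReal_iff' (measure_ne_top _ _) (measure_ne_top _ _)]
  set E := Finset.univ.filter fun e : Sym2 V => ¬ e.IsDiag ∧ e ∈ G.edgeSet with hE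
  set F := Finset.univ.filter fun e : Sym2 V => ¬ e.IsDiag ∧ e ∉ G.edgeSet with hF
  have hEd : ∀ e ∈ E, ¬ e.IsDiag := fun e he => (Finset.mem_filter.1 he).2.1
  have hFd : ∀ e ∈ F, ¬ e.IsDiag := fun e he => (Finset.mem_filter.1 he).2.1
  have hEF : Disjoint E F := by
    rw [Finset.disjoint_left]
    intro e he hf
    exact (Finset.mem_filter.1 hf).2.2 (Finset.mem_filter.1 he).2.2
  have h1 : (fun G : SimpleGraph V => Gᶜ) ⁻¹' {G} =
      {H | (∀ e ∈ F, e ∈ H.edgeSet) ∧ ∀ e ∈ E, e ∉ H.edgeSet} := by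
    ext H
    simp only [Set.mem_preimage, Set.mem_singleton_iff, Set.mem_ofPred_eq, hE, hF,
      Finset.mem_filter, Finset.mem_univ, true_and, Sym2.forall, Sym2.mk_isDiag_iff, mem_edgeSet,
      SimpleGraph.ext_iff, funext_iff, SimpleGraph.compl_adj, eq_iff_iff]
    rw [← forall_and]
    refine forall_congr' fun a => ?_
    rw [← forall_and]
    refine forall_congr' fun b => ?_
    have := fun h : G.Adj a b => h.ne
    have := fun h : H.Adj a b => h.ne
    grind
  have h2 : ({G} : Set (SimpleGraph V)) =
      {H | (∀ e ∈ E, e ∈ H.edgeSet) ∧ ∀ e ∈ F, e ∉ H.edgeSet} := by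
    ext H
    simp only [Set.mem_singleton_iff, Set.mem_ofPred_eq, hE, hF,
      Finset.mem_filter, Finset.mem_univ, true_and, Sym2.forall, Sym2.mk_isDiag_iff, mem_edgeSet,
      SimpleGraph.ext_iff, funext_iff, eq_iff_iff]
    rw [← forall_and]
    refine forall_congr' fun a => ?_
    rw [← forall_and]
    refine forall_congr' fun b => ?_
    have := fun h : G.Adj a b => h.ne
    have := fun h : H.Adj a b => h.ne
    grind
  rw [h1, h2]
  have h3 := real_pattern p hFd hEd hEF.symm
  have h4 := real_pattern (σ p) hEd hFd hEF
  simp only [measureReal_def, coe_symm_eq, sub_sub_cancel] at h3 h4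
  rw [h3, h4, mul_comm]

end EdgePatterns

/-! ### Cliques, stars and domination probabilities -/

section Cliques

open SimpleGraph ProbabilityTheory

variable {V : Type*} [DecidableEq V]

/-- The edges of the complete graph on `C`. -/
def cliqueEdges (C : Finset V) : Finset (Sym2 V) := C.offDiag.image fun x => s(x.1, x.2)

/-- The edges between `w` and `A`. -/
def starEdges (w : V) (A : Finset V) : Finset (Sym2 V) := A.image fun a => s(w, a)

lemma mk_mem_cliqueEdges {C : Finset V} {a b : V} :
    s(a, b) ∈ cliqueEdges C ↔ a ∈ C ∧ b ∈ C ∧ a ≠ b := by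
  simp only [cliqueEdges, Finset.mem_image, Finset.mem_offDiag, Sym2.eq_iff, Prod.exists]
  constructor
  · rintro ⟨x, y, ⟨hx, hy, hxy⟩, ⟨rfl, rfl⟩ | ⟨rfl, rfl⟩⟩
    exacts [⟨hx, hy, hxy⟩, ⟨hy, hx, hxy.symm⟩]
  · rintro ⟨h1, h2, h3⟩
    exact ⟨a, b, ⟨h1, h2, h3⟩, Or.inl ⟨rfl, rfl⟩⟩

lemma card_cliqueEdges (C : Finset V) : (cliqueEdges C).card = C.card.choose 2 :=
  Sym2.card_image_offDiag C

lemma not_isDiag_of_mem_cliqueEdges {C : Finset V} {e : Sym2 V} (he : e ∈ cliqueEdges C) :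
    ¬ e.IsDiag := by
  induction e with
  | _ a b => simpa using (mk_mem_cliqueEdges.1 he).2.2

lemma cliqueEdges_inter (C D : Finset V) :
    cliqueEdges C ∩ cliqueEdges D = cliqueEdges (C ∩ D) := by
  ext e
  induction e with
  | _ a b =>
    simp only [Finset.mem_inter, mk_mem_cliqueEdges]
    tauto

/-- Inclusion-exclusion, written additively to avoid truncated subtraction. -/
lemma card_cliqueEdges_union (C D : Finset V) :
    (cliqueEdges C ∪ cliqueEdges D).card + (C ∩ D).card.choose 2 =
      C.card.choose 2 + D.card.choose 2 := by
  rw [← card_cliqueEdges, ← cliqueEdges_inter, Finset.card_union_add_card_inter, card_cliqueEdges,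
    card_cliqueEdges]

lemma forall_cliqueEdges_iff {G : SimpleGraph V} {C : Finset V} :
    (∀ e ∈ cliqueEdges C, e ∈ G.edgeSet) ↔ ∀ a ∈ C, ∀ b ∈ C, a ≠ b → G.Adj a b := by
  constructor
  · intro h a ha b hb hab
    exact h s(a, b) (mk_mem_cliqueEdges.2 ⟨ha, hb, hab⟩)
  · intro h e
    induction e with
    | _ a b =>
      intro he
      obtain ⟨ha, hb, hab⟩ := mk_mem_cliqueEdges.1 he
      exact h a ha b hb hab

lemma card_starEdges (w : V) (A : Finset V) : (starEdges w A).card = A.card :=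
  Finset.card_image_of_injective _ fun a b h => by
    rcases Sym2.eq_iff.1 h with h | h
    exacts [h.2, h.2.trans h.1]

lemma not_isDiag_of_mem_starEdges {w : V} {A : Finset V} (hw : w ∉ A) {e : Sym2 V}
    (he : e ∈ starEdges w A) :
    ¬ e.IsDiag := by
  obtain ⟨a, ha, rfl⟩ := Finset.mem_image.1 he
  simpa using fun h : w = a => hw (h ▸ ha)

lemma disjoint_star_star {w w' : V} {A A' : Finset V} (hww : w ≠ w') (hw : w ∉ A') :
    Disjoint (starEdges w A) (starEdges w' A') := by
  rw [Finset.disjoint_left]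
  intro e he he'
  obtain ⟨a, ha, rfl⟩ := Finset.mem_image.1 he
  obtain ⟨b, hb, h⟩ := Finset.mem_image.1 he'
  rcases Sym2.eq_iff.1 h with ⟨h1, h2⟩ | ⟨h1, h2⟩
  · exact hww h1.symm
  · exact hw (h2 ▸ hb)

lemma disjoint_cliqueEdges_star {w : V} {A C : Finset V} (hw : w ∉ C) :
    Disjoint (cliqueEdges C) (starEdges w A) := by
  rw [Finset.disjoint_left]
  intro e he he'
  obtain ⟨b, hb, rfl⟩ := Finset.mem_image.1 he'
  exact hw (mk_mem_cliqueEdges.1 he).1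

lemma detBy_star {w : V} {A : Finset V} {D : Set (SimpleGraph V)}
    (h : ∀ G H : SimpleGraph V, (∀ a ∈ A, G.Adj w a ↔ H.Adj w a) → (G ∈ D ↔ H ∈ D)) :
    DetBy (starEdges w A) D :=
  fun G H hGH => h G H fun a ha => hGH s(w, a) (Finset.mem_image_of_mem _ ha)

variable [Fintype V]

lemma real_not_adj (p : I) {w : V} {A : Finset V} (hw : w ∉ A) :
    (binomialRandom V p).real {G | ∀ a ∈ A, ¬ G.Adj w a} = (1 - (p : ℝ)) ^ A.card := by
  have := real_pattern p (E := ∅) (F := starEdges w A) (by simp)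
    (fun e he => not_isDiag_of_mem_starEdges hw he) (by simp)
  rw [card_starEdges] at this
  simpa [starEdges] using this

/-- The probability of having neighbours in both of two sets. -/
lemma real_adj_and_adj (p : I) {w : V} {B B' : Finset V} (hw : w ∉ B) (hw' : w ∉ B') :
    (binomialRandom V p).real {G | (∃ a ∈ B, G.Adj w a) ∧ ∃ a ∈ B', G.Adj w a} =
      1 - (1 - (p : ℝ)) ^ B.card - (1 - (p : ℝ)) ^ B'.card + (1 - (p : ℝ)) ^ (B ∪ B').card := by
  have hset : {G : SimpleGraph V | (∃ a ∈ B, G.Adj w a) ∧ ∃ a ∈ B', G.Adj w a} =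
      ({G | ∀ a ∈ B, ¬ G.Adj w a} ∪ {G | ∀ a ∈ B', ¬ G.Adj w a})ᶜ := by
    ext G
    simp
  have hint : {G : SimpleGraph V | ∀ a ∈ B, ¬ G.Adj w a} ∩ {G | ∀ a ∈ B', ¬ G.Adj w a} =
      {G | ∀ a ∈ B ∪ B', ¬ G.Adj w a} := by
    ext G
    simp only [Set.mem_inter_iff, Set.mem_ofPred_eq, Finset.mem_union, or_imp, forall_and]
  have h := measureReal_union_add_inter (μ := binomialRandom V p)
    (s := {G | ∀ a ∈ B, ¬ G.Adj w a}) (t := {G | ∀ a ∈ B', ¬ G.Adj w a})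
    (Set.toFinite _).measurableSet
  rw [hint, real_not_adj p hw, real_not_adj p hw',
    real_not_adj p (show w ∉ B ∪ B' by simp [hw, hw'])] at h
  rw [hset, probReal_compl_eq_one_sub (Set.toFinite _).measurableSet]
  linarith

/-- The probability that two sets are cliques and that subsets of these dominate a further set. -/
lemma real_cliques_dominating (p : I) {C C' B B' W : Finset V} (hB : B ⊆ C) (hB' : B' ⊆ C')
    (hW : Disjoint W (C ∪ C')) :
    (binomialRandom V p).real {G | (∀ e ∈ cliqueEdges C ∪ cliqueEdges C', e ∈ G.edgeSet) ∧
      ∀ w ∈ W, (∃ a ∈ B, G.Adj w a) ∧ ∃ a ∈ B', G.Adj w a} =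
    (p : ℝ) ^ (cliqueEdges C ∪ cliqueEdges C').card *
      (1 - (1 - (p : ℝ)) ^ B.card - (1 - (p : ℝ)) ^ B'.card + (1 - (p : ℝ)) ^ (B ∪ B').card) ^
        W.card := by
  have hWC : ∀ w ∈ W, w ∉ C ∧ w ∉ C' := by
    intro w hw
    simpa using Finset.disjoint_left.1 hW hw
  have hWB : ∀ w ∈ W, w ∉ B ∪ B' := by
    intro w hw
    have := hWC w hw
    simp only [Finset.mem_union, not_or]
    exact ⟨fun h => this.1 (hB h), fun h => this.2 (hB' h)⟩
  -- The stars from different vertices of `W` share no edge, so domination is independent over `W`.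
  have h1 := DetBy.real_iInter p W (S := fun w => starEdges w (B ∪ B'))
    (D := fun w => {G : SimpleGraph V | (∃ a ∈ B, G.Adj w a) ∧ ∃ a ∈ B', G.Adj w a})
    (fun w _ => detBy_star fun G H h => by
      refine and_congr (exists_congr fun a => and_congr_right fun ha => h a (by simp [ha]))
        (exists_congr fun a => and_congr_right fun ha => h a (by simp [ha])))
    (fun w hw w' _ hww => disjoint_star_star hww (hWB w hw))
  have h2 := detBy_pattern (cliqueEdges C ∪ cliqueEdges C') (fun _ => True)
  have h3 := real_pattern p (E := cliqueEdges C ∪ cliqueEdges C') (F := ∅) (fun e he => by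
    rcases Finset.mem_union.1 he with h | h <;> exact not_isDiag_of_mem_cliqueEdges h) (by simp)
    (by simp)
  have hdisj : Disjoint (cliqueEdges C ∪ cliqueEdges C') (W.biUnion fun w => starEdges w (B ∪ B')) := by
    rw [Finset.disjoint_biUnion_right]
    intro w hw
    rw [Finset.disjoint_union_left]
    exact ⟨disjoint_cliqueEdges_star (hWC w hw).1, disjoint_cliqueEdges_star (hWC w hw).2⟩
  have h4 := h2.real_inter p h1.1 hdisj
  simp only [iff_true] at h4
  simp only [Finset.notMem_empty, false_imp_iff, implies_true, and_true, Finset.card_empty,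
    pow_zero, mul_one] at h3
  rw [h3, h1.2, Finset.prod_congr rfl fun w hw => real_adj_and_adj p
    (fun h => hWB w hw (Finset.mem_union_left _ h)) (fun h => hWB w hw (Finset.mem_union_right _ h)),
    Finset.prod_const] at h4
  exact h4

/-- The probability that a set is a clique a subset of which dominates a further set. -/
lemma real_clique_dominating (p : I) {C B W : Finset V} (hB : B ⊆ C) (hW : Disjoint W C) :
    (binomialRandom V p).real {G | (∀ e ∈ cliqueEdges C, e ∈ G.edgeSet) ∧
      ∀ w ∈ W, ∃ a ∈ B, G.Adj w a} =
    (p : ℝ) ^ C.card.choose 2 * (1 - (1 - (p : ℝ)) ^ B.card) ^ W.card := by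
  have := real_cliques_dominating p hB hB (W := W) (by simpa using hW)
  simpa [card_cliqueEdges] using this

end Cliques

/-! ### Events of high probability -/

section HighProbability

open SimpleGraph ProbabilityTheory

/-- The property `Q` holds asymptotically almost surely in `G(n, p)`. -/
def AAS (p : I) (Q : ∀ n, SimpleGraph (Fin n) → Prop) : Prop :=
  Tendsto (fun n => (binomialRandom (Fin n) p).real {G | ¬ Q n G}) atTop (𝓝 0)

lemma AAS.of_le {p : I} {Q : ∀ n, SimpleGraph (Fin n) → Prop} {u : ℕ → ℝ}
    (hu : Tendsto u atTop (𝓝 0))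
    (h : ∀ᶠ n in atTop, (binomialRandom (Fin n) p).real {G | ¬ Q n G} ≤ u n) : AAS p Q :=
  tendsto_of_tendsto_of_tendsto_of_le_of_le' tendsto_const_nhds hu
    (Eventually.of_forall fun _ => measureReal_nonneg) h

lemma AAS.mono {p : I} {Q R : ∀ n, SimpleGraph (Fin n) → Prop} (hQ : AAS p Q)
    (h : ∀ᶠ n in atTop, ∀ G, Q n G → R n G) : AAS p R :=
  AAS.of_le hQ (h.mono fun _ hn => measureReal_mono fun G hG hQG => hG (hn G hQG))

lemma AAS.and {p : I} {Q R : ∀ n, SimpleGraph (Fin n) → Prop} (hQ : AAS p Q) (hR : AAS p R) :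
    AAS p fun n G => Q n G ∧ R n G := by
  have := Filter.Tendsto.add hQ hR
  rw [add_zero] at this
  refine AAS.of_le this (Eventually.of_forall fun n => ?_)
  refine (measureReal_mono ?_).trans (measureReal_union_le _ _)
  intro G hG
  exact not_and_or.1 hG

lemma AAS.compl {p : I} {Q : ∀ n, SimpleGraph (Fin n) → Prop} (hQ : AAS (σ p) Q) :
    AAS p fun n G => Q n Gᶜ := by
  refine hQ.congr fun n => ?_
  rw [← real_compl_mem]
  rfl

/-- A common lower bound `c` for `p` and `1 - p` makes the estimate independent of the pattern. -/
lemma real_pattern_star_ge {V : Type*} [Fintype V] [DecidableEq V] (p : I) {c : ℝ} (hc : 0 ≤ c)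
    (hp : c ≤ p) (hq : c ≤ 1 - p) {z : V} {S U : Finset V} (hz : z ∉ S) (hU : U ⊆ S) :
    c ^ S.card ≤
      (binomialRandom V p).real {G | ∀ s ∈ S, G.Adj z s ↔ s ∈ U} := by
  have h := real_pattern p (E := starEdges z U) (F := starEdges z (S \ U))
    (fun e he => not_isDiag_of_mem_starEdges (fun h => hz (hU h)) he)
    (fun e he => not_isDiag_of_mem_starEdges (fun h => hz (Finset.sdiff_subset h)) he) (by
      rw [Finset.disjoint_left]
      intro e he he'
      obtain ⟨a, ha, rfl⟩ := Finset.mem_image.1 he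
      obtain ⟨b, hb, h⟩ := Finset.mem_image.1 he'
      obtain ⟨hb1, hb2⟩ := Finset.mem_sdiff.1 hb
      rcases Sym2.eq_iff.1 h with ⟨h1, h2⟩ | ⟨h1, h2⟩
      · exact hb2 (h2 ▸ ha)
      · exact hz (h2 ▸ hb1))
  rw [card_starEdges, card_starEdges] at h
  have hset : {G : SimpleGraph V | ∀ s ∈ S, G.Adj z s ↔ s ∈ U} =
      {G | (∀ e ∈ starEdges z U, e ∈ G.edgeSet) ∧ ∀ e ∈ starEdges z (S \ U), e ∉ G.edgeSet} := by
    ext G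
    simp only [starEdges, Set.mem_ofPred_eq, Finset.forall_mem_image, mem_edgeSet,
      Finset.mem_sdiff]
    constructor
    · intro h
      exact ⟨fun s hs => (h s (hU hs)).2 hs, fun s hs h' => hs.2 ((h s hs.1).1 h')⟩
    · rintro ⟨h1, h2⟩ s hs
      exact ⟨fun h => by_contra fun h' => h2 ⟨hs, h'⟩ h, fun h => h1 h⟩
  rw [hset, h, ← Finset.card_sdiff_add_card_eq_card hU, pow_add, mul_comm]
  have := pow_nonneg p.2.1 U.card
  gcongr

/-- The probability that no vertex realises a given pattern. -/
lemma real_no_pattern_le {V : Type*} [Fintype V] [DecidableEq V] (p : I) {c : ℝ} (hc : 0 ≤ c)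
    (hp : c ≤ p) (hq : c ≤ 1 - p) {S U : Finset V} (hU : U ⊆ S) {m : ℕ} (hS : S.card ≤ m) :
    (binomialRandom V p).real {G | ∀ z, z ∉ S → ¬ ∀ s ∈ S, G.Adj z s ↔ s ∈ U} ≤
      (1 - c ^ m) ^ (Fintype.card V - m) := by
  have hc1 : c ≤ 1 := hp.trans p.2.2
  have h := DetBy.real_iInter p Sᶜ (S := fun z => starEdges z S)
    (D := fun z => {G : SimpleGraph V | ¬ ∀ s ∈ S, G.Adj z s ↔ s ∈ U})
    (fun z _ => detBy_star fun G H h => by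
      refine not_congr (forall₂_congr fun s hs => by rw [h s hs]))
    (fun w hw w' _ hww => disjoint_star_star hww (Finset.mem_compl.1 hw))
  have h2 := h.2
  simp only [Finset.mem_compl] at h2
  refine h2.trans_le ?_
  have hbound : ∀ z ∈ Sᶜ, (binomialRandom V p).real
      {G : SimpleGraph V | ¬ ∀ s ∈ S, G.Adj z s ↔ s ∈ U} ≤ 1 - c ^ m := by
    intro z hz
    have h3 := real_pattern_star_ge p hc hp hq (Finset.mem_compl.1 hz) hU
    have h4 : c ^ m ≤ c ^ S.card := pow_le_pow_of_le_one hc hc1 hS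
    have h5 := probReal_compl_eq_one_sub (μ := binomialRandom V p)
      (s := {G : SimpleGraph V | ∀ s ∈ S, G.Adj z s ↔ s ∈ U}) (Set.toFinite _).measurableSet
    have h6 : {G : SimpleGraph V | ∀ s ∈ S, G.Adj z s ↔ s ∈ U}ᶜ =
      {G : SimpleGraph V | ¬ ∀ s ∈ S, G.Adj z s ↔ s ∈ U} := rfl
    rw [← h6, h5]
    linarith
  refine (Finset.prod_le_prod (fun _ _ => measureReal_nonneg) hbound).trans ?_
  rw [Finset.prod_const, Finset.card_compl]
  refine pow_le_pow_of_le_one ?_ ?_ (Nat.sub_le_sub_left hS _)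
  · exact sub_nonneg.2 (pow_le_one₀ hc hc1)
  · exact sub_le_self _ (pow_nonneg hc _)

/-- Union bound over the polynomially many choices of six vertices and a pattern; each one fails
with exponentially small probability. -/
theorem aas_ext {p : I} (hp0 : 0 < (p : ℝ)) (hp1 : (p : ℝ) < 1) : AAS p fun _ G => Ext G := by
  set c := min (p : ℝ) (1 - p) with hcdef
  have hc0 : 0 < c := lt_min hp0 (by linarith)
  have hc1 : c < 1 := (min_le_left _ _).trans_lt hp1
  have hcp : c ≤ p := min_le_left _ _
  have hcq : c ≤ 1 - p := min_le_right _ _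
  set r := 1 - c ^ 6 with hr
  have hr0 : 0 ≤ r := sub_nonneg.2 (pow_le_one₀ hc0.le hc1.le)
  have hr1 : r < 1 := sub_lt_self _ (pow_pos hc0 _)
  have hlim : Tendsto (fun n : ℕ => ((n + 6 : ℕ) : ℝ) ^ 6 * 2 ^ 6 * r ^ n) atTop (𝓝 0) := by
    have h1 := tendsto_pow_const_mul_const_pow_of_lt_one 6 hr0 hr1
    have h2 := h1.const_mul (7 ^ 6 * 2 ^ 6 : ℝ)
    rw [mul_zero] at h2
    refine squeeze_zero' (Eventually.of_forall fun n => by positivity) ?_ h2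
    filter_upwards [eventually_ge_atTop 1] with n hn
    have hn' : ((n + 6 : ℕ) : ℝ) ≤ 7 * n := by
      have : (1 : ℝ) ≤ n := by exact_mod_cast hn
      push_cast
      linarith
    calc ((n + 6 : ℕ) : ℝ) ^ 6 * 2 ^ 6 * r ^ n ≤ (7 * n) ^ 6 * 2 ^ 6 * r ^ n := by gcongr
      _ = _ := by ring
  -- With `n + 6` vertices at least `n` candidates lie outside the pattern, which removes a
  -- truncated exponent.
  rw [AAS, ← tendsto_add_atTop_iff_nat 6]
  refine squeeze_zero (fun _ => measureReal_nonneg) (fun n => ?_) hlim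
  have hsub : {G : SimpleGraph (Fin (n + 6)) | ¬ Ext G} ⊆
      ⋃ x ∈ (Finset.univ : Finset ((Fin 6 → Fin (n + 6)) × Finset (Fin 6))),
        {G | ∀ z, z ∉ Finset.univ.image x.1 →
          ¬ ∀ s ∈ Finset.univ.image x.1, G.Adj z s ↔ s ∈ x.2.image x.1} := by
    intro G hG
    simp only [Ext, Set.mem_ofPred_eq, not_forall, not_exists] at hG
    obtain ⟨s, T, hG⟩ := hG
    simp only [Set.mem_iUnion]
    refine ⟨(s, T), Finset.mem_univ _, fun z hz h => ?_⟩
    obtain ⟨i, hi⟩ := hG z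
    refine hi ⟨fun h' => hz (by simp [h']), ?_⟩
    rw [h (s i) (by simp)]
    simp
  refine (measureReal_mono hsub (measure_ne_top _ _)).trans ((measureReal_biUnion_finset_le _ _).trans ?_)
  refine (Finset.sum_le_card_nsmul _ _ (r ^ n) fun x _ => ?_).trans (le_of_eq ?_)
  · refine (real_no_pattern_le p hc0.le hcp hcq (m := 6)
      (Finset.image_subset_image (Finset.subset_univ _)) ?_).trans (le_of_eq ?_)
    · exact Finset.card_image_le.trans (by simp)
    · simp [hr]
  · simp [nsmul_eq_mul]
    norm_num

end HighProbability

/-! ### The second moment method -/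

section SecondMoment

variable {Ω ι : Type*} [Fintype Ω] [MeasurableSpace Ω] [MeasurableSingletonClass Ω]
  (μ : Measure Ω) [IsProbabilityMeasure μ]

lemma integral_indicator_sum (s : Finset ι) (F : ι → Set Ω) :
    ∫ ω, ∑ a ∈ s, (F a).indicator (fun _ => (1 : ℝ)) ω ∂μ = ∑ a ∈ s, μ.real (F a) := by
  rw [integral_finsetSum _ fun _ _ => Integrable.of_finite]
  refine Finset.sum_congr rfl fun a _ => ?_
  rw [integral_indicator_const _ (Set.toFinite _).measurableSet]
  simp

lemma integral_indicator_sum_sq (s : Finset ι) (F : ι → Set Ω) :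
    ∫ ω, (∑ a ∈ s, (F a).indicator (fun _ => (1 : ℝ)) ω) ^ 2 ∂μ =
      ∑ a ∈ s, ∑ b ∈ s, μ.real (F a ∩ F b) := by
  have : ∀ ω, (∑ a ∈ s, (F a).indicator (fun _ => (1 : ℝ)) ω) ^ 2 =
      ∑ x ∈ s ×ˢ s, (F x.1 ∩ F x.2).indicator (fun _ => (1 : ℝ)) ω := by
    intro ω
    rw [sq, Finset.sum_mul_sum, Finset.sum_product]
    refine Finset.sum_congr rfl fun a _ => Finset.sum_congr rfl fun b _ => ?_
    by_cases h1 : ω ∈ F a <;> by_cases h2 : ω ∈ F b <;> simp [Set.indicator, h1, h2]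
  simp only [this]
  rw [integral_indicator_sum, Finset.sum_product]

/-- If the sum of the pair probabilities is at most `K` times the square of the sum of the
probabilities, then some event holds with probability at least `1 / K`. -/
theorem inv_le_real_exists (s : Finset ι) (F : ι → Set Ω) {K : ℝ} (hK : 0 < K)
    (hM : 0 < ∑ a ∈ s, μ.real (F a))
    (h : ∑ a ∈ s, ∑ b ∈ s, μ.real (F a ∩ F b) ≤ K * (∑ a ∈ s, μ.real (F a)) ^ 2) :
    K⁻¹ ≤ μ.real {ω | ∃ a ∈ s, ω ∈ F a} := by
  set M := ∑ a ∈ s, μ.real (F a) with hMdef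
  set N : Ω → ℝ := fun ω => ∑ a ∈ s, (F a).indicator (fun _ => (1 : ℝ)) ω with hN
  have hEN : ∫ ω, N ω ∂μ = M := integral_indicator_sum μ s F
  have hEN2 : ∫ ω, N ω ^ 2 ∂μ ≤ K * M ^ 2 := (integral_indicator_sum_sq μ s F).trans_le h
  -- The pointwise bound `2tN - t²N² ≤ 1` on the event holds for every `t`; this one maximises `2tM
  -- - t²KM²`.
  set t := (K * M)⁻¹ with ht
  have hpt : ∀ ω, 2 * t * N ω - t ^ 2 * N ω ^ 2 ≤
      {ω | ∃ a ∈ s, ω ∈ F a}.indicator (fun _ => (1 : ℝ)) ω := by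
    intro ω
    by_cases hω : ∃ a ∈ s, ω ∈ F a
    · rw [Set.indicator_of_mem (by exact hω)]
      nlinarith [sq_nonneg (1 - t * N ω)]
    · rw [Set.indicator_of_notMem (by exact hω)]
      have : N ω = 0 := Finset.sum_eq_zero fun a ha =>
        Set.indicator_of_notMem (fun h => hω ⟨a, ha, h⟩) _
      simp [this]
  have hint := integral_mono (μ := μ) Integrable.of_finite Integrable.of_finite hpt
  rw [integral_sub Integrable.of_finite Integrable.of_finite, integral_const_mul,
    integral_const_mul, hEN, integral_indicator_const _ (Set.toFinite _).measurableSet] at hint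
  simp only [smul_eq_mul, mul_one] at hint
  refine le_trans ?_ hint
  have h2 : t ^ 2 * ∫ ω, N ω ^ 2 ∂μ ≤ t ^ 2 * (K * M ^ 2) := by gcongr
  have h3 : 2 * t * M - t ^ 2 * (K * M ^ 2) = K⁻¹ := by
    rw [ht]
    field_simp
    ring
  linarith

/-- If the number of events that hold is concentrated, and few of them are bad on average, then it
is unlikely that all events that hold are bad. -/
theorem real_all_bad_le (s : Finset ι) (F B : ι → Set Ω) {ε β : ℝ}
    (hM : 0 < ∑ a ∈ s, μ.real (F a))
    (h : ∑ a ∈ s, ∑ b ∈ s, μ.real (F a ∩ F b) ≤ (1 + ε) * (∑ a ∈ s, μ.real (F a)) ^ 2)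
    (hB : ∑ a ∈ s, μ.real (F a ∩ B a) ≤ β * ∑ a ∈ s, μ.real (F a)) :
    μ.real {ω | ∀ a ∈ s, ω ∈ F a → ω ∈ B a} ≤ 4 * ε + 2 * β := by
  set M := ∑ a ∈ s, μ.real (F a) with hMdef
  set N : Ω → ℝ := fun ω => ∑ a ∈ s, (F a).indicator (fun _ => (1 : ℝ)) ω with hN
  set N' : Ω → ℝ := fun ω => ∑ a ∈ s, (F a ∩ B a).indicator (fun _ => (1 : ℝ)) ω with hN'
  have hEN : ∫ ω, N ω ∂μ = M := integral_indicator_sum μ s F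
  have hEN' : ∫ ω, N' ω ∂μ ≤ β * M :=
    (integral_indicator_sum μ s fun a => F a ∩ B a).trans_le hB
  have hEN2 : ∫ ω, N ω ^ 2 ∂μ ≤ (1 + ε) * M ^ 2 := (integral_indicator_sum_sq μ s F).trans_le h
  -- If every event that holds is bad, then `N = N'`, and either `N ≤ M / 2`, a large deviation, or
  -- `N' ≥ M / 2`. The inequality merges the Chebyshev and Markov bounds for these cases.
  have hpt : ∀ ω, {ω | ∀ a ∈ s, ω ∈ F a → ω ∈ B a}.indicator (fun _ => (1 : ℝ)) ω ≤
      4 / M ^ 2 * (N ω ^ 2 - (2 * M * N ω - M ^ 2)) + 2 / M * N' ω := by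
    intro ω
    have hN'0 : 0 ≤ N' ω := Finset.sum_nonneg fun a _ =>
      Set.indicator_nonneg (fun _ _ => zero_le_one) _
    have e : N ω ^ 2 - (2 * M * N ω - M ^ 2) = (N ω - M) ^ 2 := by ring
    rw [e]
    by_cases hω : ∀ a ∈ s, ω ∈ F a → ω ∈ B a
    · rw [Set.indicator_of_mem (by exact hω)]
      have hNN : N ω = N' ω := by
        refine Finset.sum_congr rfl fun a ha => ?_
        by_cases hF : ω ∈ F a
        · rw [Set.indicator_of_mem hF, Set.indicator_of_mem (Set.mem_inter hF (hω a ha hF))]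
        · rw [Set.indicator_of_notMem hF, Set.indicator_of_notMem fun h => hF h.1]
      rw [← hNN]
      have : 4 / M ^ 2 * (N ω - M) ^ 2 + 2 / M * N ω - 1 =
          (4 * (N ω) ^ 2 - 6 * M * N ω + 3 * M ^ 2) / M ^ 2 := by
        field_simp
        ring
      have h2 : 0 ≤ (4 * (N ω) ^ 2 - 6 * M * N ω + 3 * M ^ 2) / M ^ 2 := by
        apply div_nonneg _ (by positivity)
        nlinarith [sq_nonneg (2 * N ω - 3 / 2 * M)]
      linarith
    · rw [Set.indicator_of_notMem (by exact hω)]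
      positivity
  have hint := integral_mono (μ := μ) Integrable.of_finite Integrable.of_finite hpt
  rw [integral_add Integrable.of_finite Integrable.of_finite, integral_const_mul,
    integral_const_mul, integral_sub Integrable.of_finite Integrable.of_finite,
    integral_sub Integrable.of_finite Integrable.of_finite, integral_const_mul, hEN,
    integral_indicator_const _ (Set.toFinite _).measurableSet] at hint
  simp only [smul_eq_mul, mul_one, integral_const, probReal_univ, one_mul] at hint
  refine hint.trans ?_
  have h2 : 4 / M ^ 2 * (∫ ω, N ω ^ 2 ∂μ - (2 * M * M - M ^ 2)) ≤
      4 / M ^ 2 * ((1 + ε) * M ^ 2 - (2 * M * M - M ^ 2)) := by gcongr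
  have h3 : 2 / M * ∫ ω, N' ω ∂μ ≤ 2 / M * (β * M) := by gcongr
  have h4 : 4 / M ^ 2 * ((1 + ε) * M ^ 2 - (2 * M * M - M ^ 2)) = 4 * ε := by
    field_simp
    ring
  have h5 : 2 / M * (β * M) = 2 * β := by field_simp
  linarith

end SecondMoment

/-! ### Pairs of sets with a given intersection -/

section Pairs

variable {V : Type*} [DecidableEq V]

lemma choose_sub_mul_descFactorial {m k j : ℕ} (hj : j ≤ k) :
    (m - j).choose (k - j) * m.descFactorial j = m.choose k * k.descFactorial j := by
  rw [Nat.descFactorial_eq_factorial_mul_choose, Nat.descFactorial_eq_factorial_mul_choose]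
  have := Nat.choose_mul (n := m) hj
  calc (m - j).choose (k - j) * (j.factorial * m.choose j)
      = j.factorial * (m.choose j * (m - j).choose (k - j)) := by ring
    _ = _ := by rw [← this]; ring

/-- Factor by factor, `(k - j) / (m - j) ≤ k / m` when `k ≤ m`. -/
lemma descFactorial_mul_pow_le {m k : ℕ} (hk : k ≤ m) (j : ℕ) :
    k.descFactorial j * m ^ j ≤ m.descFactorial j * k ^ j := by
  induction j with
  | zero => simp
  | succ j ih =>
    have h : (k - j) * m ≤ (m - j) * k := by
      rw [Nat.sub_mul, Nat.sub_mul, mul_comm m k]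
      exact Nat.sub_le_sub_left (Nat.mul_le_mul_left j hk) _
    calc k.descFactorial (j + 1) * m ^ (j + 1)
        = ((k - j) * m) * (k.descFactorial j * m ^ j) := by
          rw [Nat.descFactorial_succ, pow_succ]; ring
      _ ≤ ((m - j) * k) * (m.descFactorial j * k ^ j) := Nat.mul_le_mul h ih
      _ = _ := by rw [Nat.descFactorial_succ, pow_succ]; ring

lemma choose_sub_eq {m k j : ℕ} (hj : j ≤ k) (hk : k ≤ m) :
    ((m - j).choose (k - j) : ℝ) = m.choose k * (k.descFactorial j / m.descFactorial j) := by
  have h : (m.descFactorial j : ℝ) ≠ 0 := by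
    exact_mod_cast Nat.descFactorial_eq_zero_iff_lt.not.2 (by omega)
  field_simp
  exact_mod_cast choose_sub_mul_descFactorial hj

lemma descFactorial_div_le {m k : ℕ} (hk : k ≤ m) (hm : 0 < m) {j : ℕ} (hj : j ≤ m) :
    (k.descFactorial j / m.descFactorial j : ℝ) ≤ (k / m) ^ j := by
  have h : (0 : ℝ) < m.descFactorial j := by
    exact_mod_cast Nat.pos_of_ne_zero (Nat.descFactorial_eq_zero_iff_lt.not.2 (by omega))
  have hm' : (0 : ℝ) < m := by exact_mod_cast hm
  rw [div_pow, div_le_div_iff₀ h (by positivity)]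
  exact_mod_cast (descFactorial_mul_pow_le hk j).trans (le_of_eq (mul_comm _ _))

lemma card_filter_superset_le (U J : Finset V) (hJ : J ⊆ U) (k : ℕ) :
    ((U.powersetCard k).filter (J ⊆ ·)).card ≤ (U.card - J.card).choose (k - J.card) := by
  rw [← Finset.card_sdiff_of_subset hJ, ← Finset.card_powersetCard]
  refine Finset.card_le_card_of_injOn (· \ J) (fun A hA => ?_) fun A hA B hB h => ?_
  · simp only [Finset.coe_filter, Set.mem_ofPred_eq, Finset.mem_powersetCard] at hA
    simp only [Finset.mem_coe, Finset.mem_powersetCard]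
    exact ⟨Finset.sdiff_subset_sdiff hA.1.1 subset_rfl, by
      rw [Finset.card_sdiff_of_subset hA.2, hA.1.2]⟩
  · simp only [Finset.coe_filter, Set.mem_ofPred_eq] at hA hB
    simp only at h
    rw [← Finset.sdiff_union_of_subset hA.2, ← Finset.sdiff_union_of_subset hB.2, h]

/-- Summation over the sets of a given size according to their intersection with a given set. -/
lemma sum_powersetCard_inter_le {U A : Finset V} {k : ℕ} (hA : A ∈ U.powersetCard k) {g : ℕ → ℝ}
    (hg : ∀ j, 0 ≤ g j) :
    ∑ B ∈ U.powersetCard k, g (A ∩ B).card ≤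
      (U.card.choose k : ℝ) * ∑ j ∈ Finset.range (k + 1),
        k.choose j * (k.descFactorial j / U.card.descFactorial j) * g j := by
  obtain ⟨hAU, hAk⟩ := Finset.mem_powersetCard.1 hA
  have hkU : k ≤ U.card := hAk ▸ Finset.card_le_card hAU
  -- Summing over all `J ⊆ A` with `J ⊆ B`, instead of `J = A ∩ B` alone, overcounts harmlessly
  -- since `g ≥ 0`, and leaves only supersets of `J` to count.
  calc ∑ B ∈ U.powersetCard k, g (A ∩ B).card
      ≤ ∑ B ∈ U.powersetCard k, ∑ J ∈ A.powerset, if J ⊆ B then g J.card else 0 := by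
        refine Finset.sum_le_sum fun B _ => ?_
        have h := Finset.single_le_sum (s := A.powerset)
          (f := fun J => if J ⊆ B then g J.card else 0)
          (fun J _ => by split_ifs; exacts [hg _, le_rfl])
          (Finset.mem_powerset.2 (Finset.inter_subset_left : A ∩ B ⊆ A))
        simpa [Finset.inter_subset_right] using h
    _ = ∑ J ∈ A.powerset, (((U.powersetCard k).filter (J ⊆ ·)).card : ℝ) * g J.card := by
        rw [Finset.sum_comm]
        refine Finset.sum_congr rfl fun J _ => ?_
        rw [← Finset.sum_filter, Finset.sum_const, nsmul_eq_mul]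
    _ ≤ ∑ J ∈ A.powerset, ((U.card - J.card).choose (k - J.card) : ℝ) * g J.card := by
        refine Finset.sum_le_sum fun J hJ => ?_
        have := card_filter_superset_le U J ((Finset.mem_powerset.1 hJ).trans hAU) k
        have := hg J.card
        gcongr
    _ = ∑ j ∈ Finset.range (k + 1), k.choose j • (((U.card - j).choose (k - j) : ℝ) * g j) := by
        rw [Finset.sum_powerset_apply_card
          (fun j => ((U.card - j).choose (k - j) : ℝ) * g j), hAk]
    _ = _ := by
        rw [Finset.mul_sum]
        refine Finset.sum_congr rfl fun j hj => ?_
        rw [choose_sub_eq (by simpa [Nat.lt_succ_iff] using hj) hkU, nsmul_eq_mul]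
        ring

end Pairs

/-! ### Cliques far from the dominating threshold -/

section GoodCliques

open SimpleGraph ProbabilityTheory

variable {V : Type*} [DecidableEq V]

/-- The edges between `D` and `A`. -/
def crossEdges (D A : Finset V) : Finset (Sym2 V) := (D ×ˢ A).image fun x => s(x.1, x.2)

lemma card_crossEdges {D A : Finset V} (h : Disjoint D A) :
    (crossEdges D A).card = D.card * A.card := by
  rw [crossEdges, Finset.card_image_of_injOn, Finset.card_product]
  rintro ⟨a, b⟩ hx ⟨a', b'⟩ hy hxy
  simp only [Finset.coe_product, Set.mem_prod, Finset.mem_coe] at hx hy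
  rcases Sym2.eq_iff.1 hxy with ⟨h1, h2⟩ | ⟨h1, h2⟩
  · exact Prod.ext h1 h2
  · obtain rfl : a = b' := h1
    exact absurd hy.2 (Finset.disjoint_left.1 h hx.1)

lemma not_isDiag_of_mem_crossEdges {D A : Finset V} (h : Disjoint D A) {e : Sym2 V}
    (he : e ∈ crossEdges D A) : ¬ e.IsDiag := by
  obtain ⟨⟨a, b⟩, hx, rfl⟩ := Finset.mem_image.1 he
  obtain ⟨ha, hb⟩ := Finset.mem_product.1 hx
  simpa using fun hab : a = b => Finset.disjoint_left.1 h ha (hab ▸ hb)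

lemma disjoint_cliqueEdges_crossEdges {D A C : Finset V} (h : Disjoint D C) :
    Disjoint (cliqueEdges C) (crossEdges D A) := by
  rw [Finset.disjoint_left]
  intro e he he'
  obtain ⟨⟨a, b⟩, hx, rfl⟩ := Finset.mem_image.1 he'
  exact Finset.disjoint_left.1 h (Finset.mem_product.1 hx).1 (mk_mem_cliqueEdges.1 he).1

lemma crossEdges_union (D A A' : Finset V) :
    crossEdges D (A ∪ A') = crossEdges D A ∪ crossEdges D A' := by
  rw [crossEdges, Finset.product_union, Finset.image_union]
  rfl

/-- The event that `A` is a clique without neighbours in `D`. -/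
def isolatedClique (D A : Finset V) : Set (SimpleGraph V) :=
  {G | (∀ e ∈ cliqueEdges A, e ∈ G.edgeSet) ∧ ∀ e ∈ crossEdges D A, e ∉ G.edgeSet}

/-- The event that some outer vertex is adjacent to all of `A`, or to at most one vertex of `A`. -/
def exceptionalVertex (D A : Finset V) : Set (SimpleGraph V) :=
  {G | ∃ w, w ∉ A ∧ w ∉ D ∧ ((∃ v ∈ A, ∀ a ∈ A.erase v, ¬ G.Adj w a) ∨ ∀ a ∈ A, G.Adj w a)}

lemma detBy_isolatedClique (D A : Finset V) :
    DetBy (cliqueEdges A ∪ crossEdges D A) (isolatedClique D A) := by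
  intro G H h
  refine and_congr (forall₂_congr fun e he => h e (Finset.mem_union_left _ he))
    (forall₂_congr fun e he => not_congr (h e (Finset.mem_union_right _ he)))

variable [Fintype V]

lemma real_isolatedClique (p : I) {D A : Finset V} (h : Disjoint D A) :
    (binomialRandom V p).real (isolatedClique D A) =
      (p : ℝ) ^ A.card.choose 2 * (1 - (p : ℝ)) ^ (D.card * A.card) := by
  rw [isolatedClique, real_pattern p (fun e he => not_isDiag_of_mem_cliqueEdges he)
    (fun e he => not_isDiag_of_mem_crossEdges h he) (disjoint_cliqueEdges_crossEdges h),
    card_cliqueEdges, card_crossEdges h]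

/-- Shared edges are counted twice in the product of the probabilities, so the correction depends
only on the size of `A ∩ B`. -/
lemma real_isolatedClique_inter {p : I} (hp0 : 0 < (p : ℝ)) (hp1 : (p : ℝ) < 1) {D A B : Finset V}
    (hA : Disjoint D A) (hB : Disjoint D B) :
    (binomialRandom V p).real (isolatedClique D A ∩ isolatedClique D B) =
      (binomialRandom V p).real (isolatedClique D A) *
      (binomialRandom V p).real (isolatedClique D B) *
        ((p : ℝ)⁻¹ ^ (A ∩ B).card.choose 2 * ((1 - (p : ℝ))⁻¹) ^ (D.card * (A ∩ B).card)) := by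
  have hAB : Disjoint D (A ∪ B) := Finset.disjoint_union_right.2 ⟨hA, hB⟩
  have hset : isolatedClique D A ∩ isolatedClique D B =
      {G | (∀ e ∈ cliqueEdges A ∪ cliqueEdges B, e ∈ G.edgeSet) ∧
        ∀ e ∈ crossEdges D (A ∪ B), e ∉ G.edgeSet} := by
    ext G
    simp only [isolatedClique, Set.mem_inter_iff, Set.mem_ofPred_eq, crossEdges_union,
      Finset.mem_union, or_imp, forall_and]
    tauto
  rw [hset, real_pattern p _ (fun e he => not_isDiag_of_mem_crossEdges hAB he) _,
    card_crossEdges hAB, real_isolatedClique p hA, real_isolatedClique p hB]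
  · have hq : 0 < 1 - (p : ℝ) := by linarith
    have h1 := card_cliqueEdges_union A B
    have h2 := Finset.card_union_add_card_inter A B
    have e1 : (p : ℝ) ^ (cliqueEdges A ∪ cliqueEdges B).card * (p : ℝ) ^ (A ∩ B).card.choose 2 =
        (p : ℝ) ^ A.card.choose 2 * (p : ℝ) ^ B.card.choose 2 := by
      rw [← pow_add, ← pow_add, h1]
    have e2 : (1 - (p : ℝ)) ^ (D.card * (A ∪ B).card) * (1 - (p : ℝ)) ^ (D.card * (A ∩ B).card) =
        (1 - (p : ℝ)) ^ (D.card * A.card) * (1 - (p : ℝ)) ^ (D.card * B.card) := by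
      rw [← pow_add, ← pow_add, ← mul_add, ← mul_add, h2]
    rw [inv_pow, inv_pow]
    field_simp
    calc _ = ((p : ℝ) ^ (cliqueEdges A ∪ cliqueEdges B).card * (p : ℝ) ^ (A ∩ B).card.choose 2) *
          ((1 - (p : ℝ)) ^ (D.card * (A ∪ B).card) *
            (1 - (p : ℝ)) ^ (D.card * (A ∩ B).card)) := by ring
      _ = _ := by rw [e1, e2]; ring
  · intro e he
    rcases Finset.mem_union.1 he with h | h <;> exact not_isDiag_of_mem_cliqueEdges h
  · rw [Finset.disjoint_union_left]
    exact ⟨disjoint_cliqueEdges_crossEdges hA, disjoint_cliqueEdges_crossEdges hB⟩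

lemma real_adj_all (p : I) {w : V} {A : Finset V} (hw : w ∉ A) :
    (binomialRandom V p).real {G | ∀ a ∈ A, G.Adj w a} = (p : ℝ) ^ A.card := by
  have := real_pattern p (E := starEdges w A) (F := ∅)
    (fun e he => not_isDiag_of_mem_starEdges hw he) (by simp) (by simp)
  rw [card_starEdges] at this
  simpa [starEdges] using this

/-- For `w` outside `A` and `D`, the edges from `w` to `A` are independent of `isolatedClique D A`.
A union bound over `w`, and over the vertex `v` removed from `A`, finishes. -/
lemma real_isolatedClique_inter_exceptionalVertex_le (p : I) (D A : Finset V) :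
    (binomialRandom V p).real (isolatedClique D A ∩ exceptionalVertex D A) ≤
      (Fintype.card V * (A.card * (1 - (p : ℝ)) ^ (A.card - 1) + (p : ℝ) ^ A.card)) *
        (binomialRandom V p).real (isolatedClique D A) := by
  set F := isolatedClique D A with hF
  set μ := binomialRandom V p with hμ
  have hind : ∀ w, w ∉ A → w ∉ D → ∀ E : Set (SimpleGraph V), DetBy (starEdges w A) E →
      μ.real (F ∩ E) = μ.real F * μ.real E := by
    intro w hwA hwD E hE
    refine (detBy_isolatedClique D A).real_inter p hE ?_
    rw [Finset.disjoint_union_left]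
    refine ⟨disjoint_cliqueEdges_star hwA, ?_⟩
    rw [Finset.disjoint_left]
    intro e he he'
    obtain ⟨⟨a, b⟩, hx, rfl⟩ := Finset.mem_image.1 he
    obtain ⟨ha, hb⟩ := Finset.mem_product.1 hx
    obtain ⟨c, hc, h⟩ := Finset.mem_image.1 he'
    rcases Sym2.eq_iff.1 h with ⟨h1, h2⟩ | ⟨h1, h2⟩
    · exact hwD (h1 ▸ ha)
    · exact hwA (h1 ▸ hb)
  have hsub : F ∩ exceptionalVertex D A ⊆ ⋃ w ∈ (Finset.univ.filter fun w => w ∉ A ∧ w ∉ D),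
      ((⋃ v ∈ A, F ∩ {G | ∀ a ∈ A.erase v, ¬ G.Adj w a}) ∪ (F ∩ {G | ∀ a ∈ A, G.Adj w a})) := by
    rintro G ⟨hGF, w, hwA, hwD, h⟩
    simp only [Set.mem_iUnion]
    refine ⟨w, by simp [hwA, hwD], ?_⟩
    rcases h with ⟨v, hv, h⟩ | h
    · left
      simp only [Set.mem_iUnion]
      exact ⟨v, hv, hGF, h⟩
    · exact Or.inr ⟨hGF, h⟩
  refine (measureReal_mono hsub (measure_ne_top _ _)).trans
    ((measureReal_biUnion_finset_le _ _).trans ?_)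
  have hq : 0 ≤ 1 - (p : ℝ) := by linarith [p.2.2]
  have hp := p.2.1
  set X := (A.card * (1 - (p : ℝ)) ^ (A.card - 1) + (p : ℝ) ^ A.card) * μ.real F with hX
  have hX0 : 0 ≤ X := by positivity
  calc _ ≤ ∑ w ∈ Finset.univ.filter fun w => w ∉ A ∧ w ∉ D, X := by
        refine Finset.sum_le_sum fun w hw => ?_
        obtain ⟨-, hwA, hwD⟩ := Finset.mem_filter.1 hw
        refine (measureReal_union_le _ _).trans ?_
        have h1 : μ.real (F ∩ {G | ∀ a ∈ A, G.Adj w a}) = μ.real F * (p : ℝ) ^ A.card := by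
          rw [hind w hwA hwD {G | ∀ a ∈ A, G.Adj w a}
            (detBy_star fun G H h => forall₂_congr fun a ha => h a ha),
            real_adj_all p hwA]
        have h2 : μ.real (⋃ v ∈ A, F ∩ {G | ∀ a ∈ A.erase v, ¬ G.Adj w a}) ≤
            A.card * (μ.real F * (1 - (p : ℝ)) ^ (A.card - 1)) := by
          refine (measureReal_biUnion_finset_le _ _).trans ?_
          rw [← nsmul_eq_mul]
          refine Finset.sum_le_card_nsmul _ _ _ fun v hv => le_of_eq ?_
          rw [hind w hwA hwD {G | ∀ a ∈ A.erase v, ¬ G.Adj w a}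
            (detBy_star fun G H h => forall₂_congr fun a ha => not_congr (h a (Finset.mem_of_mem_erase ha))),
            real_not_adj p fun h => hwA (Finset.mem_of_mem_erase h), Finset.card_erase_of_mem hv]
        rw [h1, hX]
        nlinarith [h2]
    _ ≤ Fintype.card V * X := by
        rw [Finset.sum_const, nsmul_eq_mul]
        have : (Finset.univ.filter fun w => w ∉ A ∧ w ∉ D).card ≤ Fintype.card V :=
          Finset.card_le_univ _
        gcongr
    _ = _ := by rw [hX]; ring

/-- With high probability some clique of moderate size has no exceptional vertex. -/
theorem real_all_exceptional_le {p : I} (hp0 : 0 < (p : ℝ)) (hp1 : (p : ℝ) < 1) {D : Finset V}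
    (hD : D.card ≤ 1) {k : ℕ} (hk : 1 ≤ k) (hkD : k ≤ Dᶜ.card) {ρ : ℝ}
    (hρ : (k : ℝ) ^ 2 / Dᶜ.card * √((p : ℝ)⁻¹) ^ (k - 1) * (1 - (p : ℝ))⁻¹ ≤ ρ) (hρ' : ρ ≤ 1 / 2) :
    (binomialRandom V p).real {G | ∀ A ∈ Dᶜ.powersetCard k,
      G ∈ isolatedClique D A → G ∈ exceptionalVertex D A} ≤
      8 * ρ + 2 * (Fintype.card V * (k * (1 - (p : ℝ)) ^ (k - 1) + (p : ℝ) ^ k)) := by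
  set μ := binomialRandom V p with hμ
  have hq0 : 0 < 1 - (p : ℝ) := by linarith
  have hm0 : (0 : ℝ) < Dᶜ.card := by exact_mod_cast hk.trans hkD
  have hk0 : (0 : ℝ) < k := by exact_mod_cast hk
  set P := (p : ℝ) ^ k.choose 2 * (1 - (p : ℝ)) ^ (D.card * k) with hP
  have hP0 : 0 < P := by positivity
  have hAD : ∀ A ∈ Dᶜ.powersetCard k, Disjoint D A ∧ A.card = k := by
    intro A hA
    obtain ⟨h1, h2⟩ := Finset.mem_powersetCard.1 hA
    exact ⟨Finset.disjoint_left.2 fun x hx hxA => Finset.mem_compl.1 (h1 hxA) hx, h2⟩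
  have hPA : ∀ A ∈ Dᶜ.powersetCard k, μ.real (isolatedClique D A) = P := by
    intro A hA
    rw [real_isolatedClique p (hAD A hA).1, (hAD A hA).2]
  have hsum : ∑ A ∈ Dᶜ.powersetCard k, μ.real (isolatedClique D A) = Dᶜ.card.choose k * P := by
    rw [Finset.sum_congr rfl hPA, Finset.sum_const, Finset.card_powersetCard, nsmul_eq_mul]
  have hch : (0 : ℝ) < Dᶜ.card.choose k := by exact_mod_cast Nat.choose_pos hkD
  have hp1' : 1 ≤ (p : ℝ)⁻¹ := (one_le_inv₀ hp0).2 hp1.le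
  have hq1' : 1 ≤ (1 - (p : ℝ))⁻¹ := (one_le_inv₀ hq0).2 (by linarith)
  set g : ℕ → ℝ := fun j => (p : ℝ)⁻¹ ^ j.choose 2 * ((1 - (p : ℝ))⁻¹) ^ (D.card * j) with hg
  have hg0 : ∀ j, 0 ≤ g j := fun j => by positivity
  set t := √((p : ℝ)⁻¹) with ht
  have ht1 : 1 ≤ t := Real.one_le_sqrt.2 hp1'
  have ht2 : t ^ 2 = (p : ℝ)⁻¹ := Real.sq_sqrt (by positivity)
  -- `2 * j.choose 2 = j * (j - 1) ≤ j * (k - 1)`, so each contribution is at most a `j`th power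
  -- with a base independent of `j`, and the sum is dominated by a geometric series.
  have hterm : ∀ j ∈ Finset.range (k + 1),
      (k.choose j * (k.descFactorial j / Dᶜ.card.descFactorial j) * g j : ℝ) ≤ ρ ^ j := by
    intro j hj
    have hjk : j ≤ k := Nat.lt_succ_iff.1 (Finset.mem_range.1 hj)
    have h1 : (k.choose j : ℝ) ≤ (k : ℝ) ^ j := by exact_mod_cast Nat.choose_le_pow k j
    have h2 := descFactorial_div_le hkD (hk.trans hkD) (hjk.trans hkD)
    have h3 : g j ≤ (t ^ (k - 1) * (1 - (p : ℝ))⁻¹) ^ j := by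
      rw [mul_pow, hg]
      gcongr ?_ * ?_
      · rw [← ht2, ← pow_mul, ← pow_mul]
        refine pow_le_pow_right₀ ht1 ?_
        rw [mul_comm 2, Nat.choose_two_right, Nat.div_mul_cancel (Nat.even_mul_pred_self j).two_dvd,
          mul_comm]
        exact Nat.mul_le_mul_right _ (Nat.sub_le_sub_right hjk 1)
      · exact pow_le_pow_right₀ hq1' (by nlinarith)
    calc (k.choose j * (k.descFactorial j / Dᶜ.card.descFactorial j) * g j : ℝ)
        ≤ (k : ℝ) ^ j * (k / Dᶜ.card) ^ j * (t ^ (k - 1) * (1 - (p : ℝ))⁻¹) ^ j := by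
          gcongr
      _ = ((k : ℝ) ^ 2 / Dᶜ.card * t ^ (k - 1) * (1 - (p : ℝ))⁻¹) ^ j := by
          rw [← mul_pow, ← mul_pow]
          congr 1
          ring
      _ ≤ ρ ^ j := by gcongr
  have hρ0 : 0 ≤ ρ := le_trans (by positivity) hρ
  have hgeom : ∑ j ∈ Finset.range (k + 1), ρ ^ j ≤ 1 + 2 * ρ := by
    have h1 : ∑ j ∈ Finset.range (k + 1), ρ ^ j ≤ (1 - ρ)⁻¹ := by
      rw [← tsum_geometric_of_lt_one hρ0 (by linarith)]
      exact (summable_geometric_of_lt_one hρ0 (by linarith)).sum_le_tsum _ fun _ _ => by positivity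
    refine h1.trans ?_
    rw [inv_le_iff_one_le_mul₀ (by linarith)]
    nlinarith
  have hpairs : ∑ A ∈ Dᶜ.powersetCard k, ∑ B ∈ Dᶜ.powersetCard k,
      μ.real (isolatedClique D A ∩ isolatedClique D B) ≤
      (1 + 2 * ρ) * (∑ A ∈ Dᶜ.powersetCard k, μ.real (isolatedClique D A)) ^ 2 := by
    have h1 : ∀ A ∈ Dᶜ.powersetCard k, ∑ B ∈ Dᶜ.powersetCard k,
        μ.real (isolatedClique D A ∩ isolatedClique D B) ≤
        P ^ 2 * (Dᶜ.card.choose k * (1 + 2 * ρ)) := by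
      intro A hA
      have h2 : ∀ B ∈ Dᶜ.powersetCard k, μ.real (isolatedClique D A ∩ isolatedClique D B) =
          P ^ 2 * g (A ∩ B).card := by
        intro B hB
        rw [real_isolatedClique_inter hp0 hp1 (hAD A hA).1 (hAD B hB).1, hPA A hA, hPA B hB, sq]
      rw [Finset.sum_congr rfl h2, ← Finset.mul_sum]
      have h3 := sum_powersetCard_inter_le hA hg0
      have h4 := Finset.sum_le_sum hterm
      have h5 := h4.trans hgeom
      gcongr
      refine h3.trans ?_
      gcongr
    refine (Finset.sum_le_sum h1).trans (le_of_eq ?_)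
    rw [hsum, Finset.sum_const, Finset.card_powersetCard, nsmul_eq_mul]
    ring
  have hbad : ∑ A ∈ Dᶜ.powersetCard k, μ.real (isolatedClique D A ∩ exceptionalVertex D A) ≤
      (Fintype.card V * (k * (1 - (p : ℝ)) ^ (k - 1) + (p : ℝ) ^ k)) *
        ∑ A ∈ Dᶜ.powersetCard k, μ.real (isolatedClique D A) := by
    rw [Finset.mul_sum]
    refine Finset.sum_le_sum fun A hA => ?_
    have := real_isolatedClique_inter_exceptionalVertex_le p D A
    rwa [(hAD A hA).2] at this
  have := real_all_bad_le μ (Dᶜ.powersetCard k) (isolatedClique D) (exceptionalVertex D)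
    (by rw [hsum]; positivity) hpairs hbad
  refine this.trans (le_of_eq ?_)
  ring

end GoodCliques

/-! ### All kinds of cliques exist when `(1 - p)² < p` -/

section Supercritical

open SimpleGraph ProbabilityTheory

lemma tendsto_sq_mul_exp_neg {c η : ℝ} (hη : 0 < η) :
    Tendsto (fun x : ℝ => (c * x + 2) ^ 2 * Real.exp (-(η * x))) atTop (𝓝 0) := by
  have h : ∀ s : ℕ, Tendsto (fun x : ℝ => x ^ s * Real.exp (-(η * x))) atTop (𝓝 0) := by
    intro s
    have := tendsto_rpow_mul_exp_neg_mul_atTop_nhds_zero s η hη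
    refine this.congr fun x => ?_
    rw [Real.rpow_natCast, neg_mul]
  have := ((h 2).const_mul (c ^ 2)).add (((h 1).const_mul (4 * c)).add ((h 0).const_mul 4))
  simp only [mul_zero, add_zero] at this
  refine this.congr fun x => ?_
  ring

/-- Sizes between the domination number and the clique number of the random graph. -/
lemma exists_clique_size {p : ℝ} (hp0 : 0 < p) (hp1 : p < 1) (h : (1 - p) ^ 2 < p) :
    ∃ k : ℕ → ℕ, (∀ᶠ n in atTop, 3 ≤ k n) ∧
      Tendsto (fun n : ℕ => (k n : ℝ) ^ 2 / (n - 1 : ℕ) * √(p⁻¹) ^ (k n - 1) * (1 - p)⁻¹)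
        atTop (𝓝 0) ∧
      Tendsto (fun n : ℕ => (n : ℝ) * (k n * (1 - p) ^ (k n - 1) + p ^ k n)) atTop (𝓝 0) := by
  have hq0 : 0 < 1 - p := by linarith
  set a := -Real.log p with ha
  set b := -Real.log (1 - p) with hb
  have ha0 : 0 < a := neg_pos.2 (Real.log_neg hp0 hp1)
  have hb0 : 0 < b := neg_pos.2 (Real.log_neg hq0 (by linarith))
  have hab : a < 2 * b := by
    have := Real.log_lt_log (by positivity) h
    rw [Real.log_pow] at this
    push_cast at this
    linarith
  -- Sizes will be about `c log n`. The lower bounds on `c` make exceptional vertices rare, and the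
  -- upper bound makes the second moment concentrate. The interval is nonempty since `a < 2 * b`.
  obtain ⟨c, hc1, hc2⟩ : ∃ c, max (1 / a) (1 / b) < c ∧ c < 2 / a := by
    refine exists_between (max_lt ?_ ?_)
    · gcongr
      norm_num
    · rw [div_lt_div_iff₀ hb0 ha0]
      linarith
  have hc0 : 0 < c := lt_of_lt_of_le (by positivity : 0 < 1 / a) ((le_max_left _ _).trans hc1.le)
  have hca : 1 < c * a := by
    have := (le_max_left _ _).trans_lt hc1
    rwa [div_lt_iff₀ ha0] at this
  have hcb : 1 < c * b := by
    have := (le_max_right _ _).trans_lt hc1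
    rwa [div_lt_iff₀ hb0] at this
  have hca2 : c * a < 2 := by rwa [lt_div_iff₀ ha0] at hc2
  obtain ⟨η, hη0, hη⟩ : ∃ η, 0 < η ∧ η ≤ 1 - c * a / 2 ∧ η ≤ c * b - 1 ∧ η ≤ c * a - 1 :=
    ⟨min (1 - c * a / 2) (min (c * b - 1) (c * a - 1)),
      lt_min (by linarith) (lt_min (by linarith) (by linarith)), min_le_left _ _,
      (min_le_right _ _).trans (min_le_left _ _), (min_le_right _ _).trans (min_le_right _ _)⟩
  obtain ⟨hη1, hη2, hη3⟩ := hη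
  have hlog : Tendsto (fun n : ℕ => Real.log n) atTop atTop :=
    Real.tendsto_log_atTop.comp tendsto_natCast_atTop_atTop
  have hlim := (tendsto_sq_mul_exp_neg (c := c) hη0).comp hlog
  -- The `+ 2` keeps even `k n - 1` above `c * Real.log n`.
  set k : ℕ → ℕ := fun n => ⌊c * Real.log n⌋₊ + 2 with hk
  have hk1 : ∀ n : ℕ, 1 ≤ n → c * Real.log n ≤ ((k n - 1 : ℕ) : ℝ) ∧
      ((k n - 1 : ℕ) : ℝ) ≤ c * Real.log n + 1 ∧ (k n : ℝ) ≤ c * Real.log n + 2 ∧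
      c * Real.log n ≤ k n := by
    intro n hn
    have h0 : 0 ≤ c * Real.log n := mul_nonneg hc0.le (Real.log_natCast_nonneg n)
    have h1 := Nat.lt_floor_add_one (c * Real.log n)
    have h2 := Nat.floor_le h0
    have e : ((k n - 1 : ℕ) : ℝ) = ⌊c * Real.log n⌋₊ + 1 := by simp [hk]
    have e' : (k n : ℝ) = ⌊c * Real.log n⌋₊ + 2 := by simp [hk]
    rw [e, e']
    refine ⟨h1.le, by linarith, by linarith, by linarith⟩
  have hpexp : ∀ m : ℕ, p ^ m = Real.exp (-(a * m)) := by
    intro m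
    rw [ha, neg_mul, neg_neg, mul_comm, Real.exp_nat_mul, Real.exp_log hp0]
  have hqexp : ∀ m : ℕ, (1 - p) ^ m = Real.exp (-(b * m)) := by
    intro m
    rw [hb, neg_mul, neg_neg, mul_comm, Real.exp_nat_mul, Real.exp_log hq0]
  have hsexp : ∀ m : ℕ, √(p⁻¹) ^ m = Real.exp (a / 2 * m) := by
    intro m
    have : √(p⁻¹) = Real.exp (a / 2) := by
      rw [Real.exp_half, ha, Real.exp_neg, Real.exp_log hp0]
    rw [this, mul_comm, Real.exp_nat_mul]
  refine ⟨k, ?_, ?_, ?_⟩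
  · filter_upwards [hlog.eventually_ge_atTop (1 / c)] with n hn
    have : 1 ≤ ⌊c * Real.log n⌋₊ := by
      rw [Nat.one_le_floor_iff]
      rw [div_le_iff₀ hc0] at hn
      linarith
    simp only [hk]
    omega
  · have h2 := hlim.const_mul (2 * Real.exp (a / 2) * (1 - p)⁻¹)
    rw [mul_zero] at h2
    refine squeeze_zero' (Eventually.of_forall fun n => by positivity) ?_ h2
    filter_upwards [eventually_ge_atTop 2] with n hn
    obtain ⟨k1, k2, k3, k4⟩ := hk1 n (by omega)
    have hn0 : (0 : ℝ) < n := by exact_mod_cast (by omega : 0 < n)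
    have hn1 : (n : ℝ) / 2 ≤ ((n - 1 : ℕ) : ℝ) := by
      rw [Nat.cast_sub (by omega)]
      have : (2 : ℝ) ≤ n := by exact_mod_cast hn
      push_cast
      linarith
    have hx0 : 0 ≤ Real.log n := Real.log_natCast_nonneg n
    have hs : √(p⁻¹) ^ (k n - 1) ≤ Real.exp (a / 2) * Real.exp (c * a / 2 * Real.log n) := by
      rw [hsexp, ← Real.exp_add]
      gcongr
      nlinarith
    have hinv : ((n : ℝ) / 2)⁻¹ = 2 * Real.exp (-Real.log n) := by
      rw [Real.exp_neg, Real.exp_log hn0, inv_div]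
      rfl
    calc (k n : ℝ) ^ 2 / (n - 1 : ℕ) * √(p⁻¹) ^ (k n - 1) * (1 - p)⁻¹
        ≤ (c * Real.log n + 2) ^ 2 / ((n : ℝ) / 2) *
          (Real.exp (a / 2) * Real.exp (c * a / 2 * Real.log n)) * (1 - p)⁻¹ := by gcongr
      _ = 2 * Real.exp (a / 2) * (1 - p)⁻¹ * ((c * Real.log n + 2) ^ 2 *
          Real.exp (-((1 - c * a / 2) * Real.log n))) := by
          rw [div_eq_mul_inv, hinv, show -((1 - c * a / 2) * Real.log n) =
            -Real.log n + c * a / 2 * Real.log n by ring, Real.exp_add]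
          ring
      _ ≤ 2 * Real.exp (a / 2) * (1 - p)⁻¹ * ((c * Real.log n + 2) ^ 2 *
          Real.exp (-(η * Real.log n))) := by gcongr
  · have h2 := hlim.const_mul 2
    rw [mul_zero] at h2
    refine squeeze_zero' (Eventually.of_forall fun n => by positivity) ?_ h2
    filter_upwards [eventually_ge_atTop 1] with n hn
    obtain ⟨k1, k2, k3, k4⟩ := hk1 n hn
    have hn0 : (0 : ℝ) < n := by exact_mod_cast hn
    have hx0 : 0 ≤ Real.log n := Real.log_natCast_nonneg n
    set x := Real.log n with hx
    have hn' : (n : ℝ) = Real.exp x := (Real.exp_log hn0).symm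
    have hy : 1 ≤ c * x + 2 := by nlinarith [mul_nonneg hc0.le hx0]
    have hy2 : c * x + 2 ≤ (c * x + 2) ^ 2 := by nlinarith
    have h3 : (n : ℝ) * (1 - p) ^ (k n - 1) ≤ Real.exp (-(η * x)) := by
      rw [hn', hqexp, ← Real.exp_add]
      gcongr
      nlinarith
    have h4 : (n : ℝ) * p ^ k n ≤ Real.exp (-(η * x)) := by
      rw [hn', hpexp, ← Real.exp_add]
      gcongr
      nlinarith
    have hE := Real.exp_pos (-(η * x))
    calc (n : ℝ) * (k n * (1 - p) ^ (k n - 1) + p ^ k n)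
        = k n * (n * (1 - p) ^ (k n - 1)) + n * p ^ k n := by ring
      _ ≤ (c * x + 2) * Real.exp (-(η * x)) + Real.exp (-(η * x)) := by gcongr
      _ ≤ 2 * ((c * x + 2) ^ 2 * Real.exp (-(η * x))) := by nlinarith

/-- Above the threshold, cliques without exceptional vertices exist. -/
theorem aas_exists_good_clique {p : I} (hp0 : 0 < (p : ℝ)) (hp1 : (p : ℝ) < 1)
    (h : (1 - (p : ℝ)) ^ 2 < p) (D : ∀ n, Finset (Fin n)) (hD : ∀ n, (D n).card ≤ 1) :
    AAS p fun n G => ∃ A : Finset (Fin n), 3 ≤ A.card ∧ Disjoint (D n) A ∧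
      G ∈ isolatedClique (D n) A ∧ G ∉ exceptionalVertex (D n) A := by
  obtain ⟨k, hk3, hρ, hβ⟩ := exists_clique_size hp0 hp1 h
  have hu := (hρ.const_mul 8).add (hβ.const_mul 2)
  simp only [mul_zero, add_zero] at hu
  refine AAS.of_le hu ?_
  filter_upwards [hk3, hρ.eventually_le_const (by norm_num : (0 : ℝ) < 1 / 2),
    eventually_ge_atTop 2] with n hk3 hρn hn
  have hq0 : 0 < 1 - (p : ℝ) := by linarith
  have hDc : n - 1 ≤ (D n)ᶜ.card := by
    rw [Finset.card_compl, Fintype.card_fin]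
    have := hD n
    omega
  have hn1 : (0 : ℝ) < (n - 1 : ℕ) := by exact_mod_cast (by omega : 0 < n - 1)
  have hs1 : 1 ≤ √((p : ℝ)⁻¹) ^ (k n - 1) :=
    one_le_pow₀ (Real.one_le_sqrt.2 ((one_le_inv₀ hp0).2 hp1.le))
  have hq1' : 1 ≤ (1 - (p : ℝ))⁻¹ := (one_le_inv₀ hq0).2 (by linarith)
  -- The other factors of the small quantity are at least one, so already `k² ≤ n - 1`.
  have hkn : k n ≤ n - 1 := by
    have h1 : (k n : ℝ) ^ 2 / (n - 1 : ℕ) ≤ 1 := by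
      calc (k n : ℝ) ^ 2 / (n - 1 : ℕ) = (k n : ℝ) ^ 2 / (n - 1 : ℕ) * 1 * 1 := by ring
        _ ≤ (k n : ℝ) ^ 2 / (n - 1 : ℕ) * √((p : ℝ)⁻¹) ^ (k n - 1) * (1 - (p : ℝ))⁻¹ := by gcongr
        _ ≤ 1 := by linarith
    rw [div_le_one hn1] at h1
    have h2 : k n ^ 2 ≤ n - 1 := by exact_mod_cast h1
    nlinarith
  have hρ' : (k n : ℝ) ^ 2 / (D n)ᶜ.card * √((p : ℝ)⁻¹) ^ (k n - 1) * (1 - (p : ℝ))⁻¹ ≤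
      (k n : ℝ) ^ 2 / (n - 1 : ℕ) * √((p : ℝ)⁻¹) ^ (k n - 1) * (1 - (p : ℝ))⁻¹ := by gcongr
  have key := real_all_exceptional_le hp0 hp1 (hD n) (by omega : 1 ≤ k n) (hkn.trans hDc) hρ' hρn
  rw [Fintype.card_fin] at key
  refine le_trans (measureReal_mono ?_) key
  intro G hG A hA hF
  by_contra hB
  obtain ⟨h1, h2⟩ := Finset.mem_powersetCard.1 hA
  exact hG ⟨A, by omega, Finset.disjoint_left.2 fun x hx hxA => Finset.mem_compl.1 (h1 hxA) hx,
    hF, hB⟩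

lemma isCliqueKind_coe {V : Type*} {G : SimpleGraph V} {A : Finset V}
    (hA : 2 ≤ A.card) (hcl : ∀ a ∈ A, ∀ b ∈ A, a ≠ b → G.Adj a b) :
    IsCliqueKind G A (∀ w ∉ A, ∃ a ∈ A, G.Adj w a) (∀ w ∉ A, ∃ a ∈ A, ¬ G.Adj w a) :=
  ⟨Finset.one_lt_card_iff_nontrivial.1 hA, hcl, Iff.rfl, Iff.rfl⟩

lemma IsCliqueKind.congr {V : Type*} {G : SimpleGraph V} {A : Set V} {d m d' m' : Prop}
    (h : IsCliqueKind G A d m) (hd : d ↔ d') (hm : m ↔ m') : IsCliqueKind G A d' m' :=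
  ⟨h.1, h.2.1, h.2.2.1.trans hd, h.2.2.2.trans hm⟩

/-- A clique without exceptional vertices is dominating and maximal. Outer vertices have two
neighbours in it, so deleting one member `v` keeps domination but loses maximality, as `v` extends
the rest. A clique isolated from vertex `0` is not dominating, and the absence of exceptional
vertices makes it maximal. -/
theorem aas_cliqueKind_of_lt {p : I} (hp0 : 0 < (p : ℝ)) (hp1 : (p : ℝ) < 1)
    (h : (1 - (p : ℝ)) ^ 2 < p) :
    AAS p fun _ G => (∃ A, IsCliqueKind G A True True) ∧ (∃ A, IsCliqueKind G A True False) ∧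
      ∃ A, IsCliqueKind G A False True := by
  have h1 := aas_exists_good_clique hp0 hp1 h (fun _ => ∅) (by simp)
  have h2 := aas_exists_good_clique hp0 hp1 h
    (fun n => if hn : 0 < n then {⟨0, hn⟩} else ∅) (fun n => by split_ifs <;> simp)
  refine (h1.and h2).mono ?_
  filter_upwards [eventually_ge_atTop 1] with n hn G
  rintro ⟨⟨A, hA3, -, hA, hA'⟩, ⟨B, hB3, hB0, hB, hB'⟩⟩
  have hcl := forall_cliqueEdges_iff.1 hA.1
  simp only [exceptionalVertex, Set.mem_ofPred_eq, not_exists, not_and, not_or, not_forall] at hA'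
  have hnbr : ∀ w ∉ A, ∀ v ∈ A, ∃ a ∈ A.erase v, G.Adj w a := by
    intro w hw v hv
    obtain ⟨a, ha, h⟩ := (hA' w hw (by simp)).1 v hv
    exact ⟨a, ha, not_not.1 h⟩
  obtain ⟨v, hv⟩ := Finset.card_pos.1 (by omega : 0 < A.card)
  refine ⟨⟨A, (isCliqueKind_coe (by omega) hcl).congr (iff_true_intro fun w hw => ?_)
      (iff_true_intro fun w hw => ?_)⟩, ⟨(A.erase v : Finset (Fin n)),
    (isCliqueKind_coe (A := A.erase v) ?_ ?_).congr (iff_true_intro fun w hw => ?_)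
      (iff_false_intro fun hm => ?_)⟩, ⟨B, (isCliqueKind_coe (by omega)
        (forall_cliqueEdges_iff.1 hB.1)).congr (iff_false_intro fun hd => ?_)
      (iff_true_intro fun w hw => ?_)⟩⟩
  · obtain ⟨a, ha, h⟩ := hnbr w hw v hv
    exact ⟨a, Finset.mem_of_mem_erase ha, h⟩
  · obtain ⟨a, ha, h⟩ := (hA' w hw (by simp)).2
    exact ⟨a, ha, h⟩
  · rw [Finset.card_erase_of_mem hv]
    omega
  · exact fun a ha b hb => hcl a (Finset.mem_of_mem_erase ha) b (Finset.mem_of_mem_erase hb)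
  · by_cases hwA : w ∈ A
    · obtain ⟨a, ha⟩ := Finset.card_pos.1
        (by rw [Finset.card_erase_of_mem hv]; omega : 0 < (A.erase v).card)
      exact ⟨a, ha, hcl w hwA a (Finset.mem_of_mem_erase ha) fun h => hw (h ▸ ha)⟩
    · exact hnbr w hwA v hv
  · obtain ⟨a, ha, h⟩ := hm v (by simp)
    exact h (hcl v hv a (Finset.mem_of_mem_erase ha) (Finset.ne_of_mem_erase ha).symm)
  · have h0 : 0 < n := hn
    simp only [h0, dite_true] at hB0 hB
    obtain ⟨a, ha, h⟩ := hd ⟨0, h0⟩ (Finset.disjoint_singleton_left.1 hB0)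
    exact hB.2 s(⟨0, h0⟩, a) (Finset.mem_image.2 ⟨(⟨0, h0⟩, a), by simp [ha], rfl⟩) h
  · have h0 : 0 < n := hn
    simp only [h0, dite_true] at hB0 hB hB'
    by_cases hw0 : w = ⟨0, h0⟩
    · subst hw0
      obtain ⟨a, ha⟩ := Finset.card_pos.1 (by omega : 0 < B.card)
      exact ⟨a, ha, hB.2 s(⟨0, h0⟩, a) (Finset.mem_image.2 ⟨(⟨0, h0⟩, a), by simp [ha], rfl⟩)⟩
    · simp only [exceptionalVertex, Set.mem_ofPred_eq, not_exists, not_and, not_or,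
        not_forall] at hB'
      obtain ⟨a, ha, h⟩ := (hB' w hw (by simp [hw0])).2
      exact ⟨a, ha, h⟩

end Supercritical

/-! ### No dominating cliques when `p < (1 - p)²` -/

section Subcritical

open SimpleGraph ProbabilityTheory

/-- The first moment bound for dominating cliques. -/
lemma real_exists_dominating_clique_le (p : I) (n : ℕ) :
    (binomialRandom (Fin n) p).real {G | ∃ A : Finset (Fin n),
      (∀ a ∈ A, ∀ b ∈ A, a ≠ b → G.Adj a b) ∧ ∀ w ∉ A, ∃ a ∈ A, G.Adj w a} ≤
    ∑ k ∈ Finset.range (n + 1),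
      (n.choose k : ℝ) * ((p : ℝ) ^ k.choose 2 * (1 - (1 - (p : ℝ)) ^ k) ^ (n - k)) := by
  have hsub : {G : SimpleGraph (Fin n) | ∃ A : Finset (Fin n),
      (∀ a ∈ A, ∀ b ∈ A, a ≠ b → G.Adj a b) ∧ ∀ w ∉ A, ∃ a ∈ A, G.Adj w a} ⊆
      ⋃ A ∈ (Finset.univ : Finset (Fin n)).powerset,
        {G | (∀ e ∈ cliqueEdges A, e ∈ G.edgeSet) ∧ ∀ w ∈ Aᶜ, ∃ a ∈ A, G.Adj w a} := by
    rintro G ⟨A, h1, h2⟩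
    simp only [Set.mem_iUnion]
    exact ⟨A, by simp, forall_cliqueEdges_iff.2 h1, by simpa using h2⟩
  refine (measureReal_mono hsub (measure_ne_top _ _)).trans
    ((measureReal_biUnion_finset_le _ _).trans (le_of_eq ?_))
  have h : ∀ A ∈ (Finset.univ : Finset (Fin n)).powerset, (binomialRandom (Fin n) p).real
      {G | (∀ e ∈ cliqueEdges A, e ∈ G.edgeSet) ∧ ∀ w ∈ Aᶜ, ∃ a ∈ A, G.Adj w a} =
      (p : ℝ) ^ A.card.choose 2 * (1 - (1 - (p : ℝ)) ^ A.card) ^ (n - A.card) := by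
    intro A _
    rw [real_clique_dominating p subset_rfl disjoint_compl_left, Finset.card_compl,
      Fintype.card_fin]
  rw [Finset.sum_congr rfl h, Finset.sum_powerset_apply_card
    (fun k => (p : ℝ) ^ k.choose 2 * (1 - (1 - (p : ℝ)) ^ k) ^ (n - k))]
  simp [nsmul_eq_mul]

/-- The probability of domination is at most exponentially small in the expected number of
undominated vertices. -/
lemma one_sub_pow_le_exp {x : ℝ} (hx0 : 0 ≤ x) (hx1 : x ≤ 1) (n k : ℕ) :
    (1 - x) ^ (n - k) ≤ Real.exp (k * x) * Real.exp (-(n * x)) := by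
  have h1 : 1 - x ≤ Real.exp (-x) := Real.one_sub_le_exp_neg x
  have h2 : (n : ℝ) - k ≤ (n - k : ℕ) := by
    rw [sub_le_iff_le_add]
    exact_mod_cast (by omega : n ≤ n - k + k)
  calc (1 - x) ^ (n - k) ≤ Real.exp (-x) ^ (n - k) := by
        gcongr
    _ = Real.exp (-((n - k : ℕ) * x)) := by rw [← Real.exp_nat_mul]; ring_nf
    _ ≤ Real.exp (k * x + -(n * x)) := by
        gcongr
        nlinarith [mul_le_mul_of_nonneg_right h2 hx0]
    _ = _ := Real.exp_add _ _

/-- Consecutive terms have ratio `(k + 1) (p / q²)^k · e / q`, which tends to zero. This series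
dominates the first moment, because `y^k e^(-y) ≤ k!`. -/
lemma summable_factorial_mul {p q : ℝ} (hp0 : 0 < p) (hq0 : 0 < q) (h : p < q ^ 2) :
    Summable fun k : ℕ => (k.factorial : ℝ) * (Real.exp k * p ^ k.choose 2 / q ^ k ^ 2) := by
  refine summable_of_ratio_test_tendsto_lt_one (l := 0) zero_lt_one
    (Eventually.of_forall fun k => by positivity) ?_
  have hr0 : 0 ≤ p / q ^ 2 := by positivity
  have hr1 : p / q ^ 2 < 1 := (div_lt_one (by positivity)).2 h
  have h1 := (tendsto_self_mul_const_pow_of_lt_one hr0 hr1).add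
    (tendsto_pow_atTop_nhds_zero_of_lt_one hr0 hr1)
  have h2 := h1.mul_const (Real.exp 1 / q)
  simp only [add_zero, zero_mul] at h2
  refine h2.congr fun k => ?_
  rw [Real.norm_of_nonneg (by positivity), Real.norm_of_nonneg (by positivity),
    Nat.factorial_succ, Nat.choose_succ_succ' k 1, Nat.choose_one_right]
  have e : (k + 1) ^ 2 = k ^ 2 + 2 * k + 1 := by ring
  rw [e, pow_add, pow_add, pow_add, pow_mul, div_pow]
  push_cast
  rw [Real.exp_add]
  field_simp

/-- With `y = n q^k`, each term is at most a constant depending on `k` times `y^k e^(-y)`. For fixed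
`k` this vanishes as `y → ∞`, and dominated convergence passes to the sum. -/
lemma tendsto_sum_dominating_clique {p : ℝ} (hp0 : 0 < p) (hp1 : p < 1) (h : p < (1 - p) ^ 2) :
    Tendsto (fun n : ℕ => ∑ k ∈ Finset.range (n + 1),
      (n.choose k : ℝ) * (p ^ k.choose 2 * (1 - (1 - p) ^ k) ^ (n - k))) atTop (𝓝 0) := by
  set q := 1 - p with hq
  have hq0 : 0 < q := by linarith
  have hq1 : q ≤ 1 := by linarith
  have hle : ∀ n k : ℕ, (n.choose k : ℝ) * (p ^ k.choose 2 * (1 - q ^ k) ^ (n - k)) ≤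
      (Real.exp k * p ^ k.choose 2 / q ^ k ^ 2) * ((n * q ^ k) ^ k * Real.exp (-(n * q ^ k))) := by
    intro n k
    have hx0 : 0 ≤ q ^ k := by positivity
    have hx1 : q ^ k ≤ 1 := pow_le_one₀ hq0.le hq1
    have h1 : (n.choose k : ℝ) ≤ (n : ℝ) ^ k := by exact_mod_cast Nat.choose_le_pow n k
    have h2 : (1 - q ^ k) ^ (n - k) ≤ Real.exp k * Real.exp (-(n * q ^ k)) := by
      refine (one_sub_pow_le_exp hx0 hx1 n k).trans ?_
      gcongr
      exact mul_le_of_le_one_right (Nat.cast_nonneg k) hx1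
    have h3 : 0 ≤ (1 - q ^ k) ^ (n - k) := pow_nonneg (by linarith) _
    calc (n.choose k : ℝ) * (p ^ k.choose 2 * (1 - q ^ k) ^ (n - k))
        ≤ (n : ℝ) ^ k * (p ^ k.choose 2 * (Real.exp k * Real.exp (-(n * q ^ k)))) := by gcongr
      _ = _ := by
        rw [mul_pow, ← pow_mul, ← sq]
        field_simp
  have hnn : ∀ n k : ℕ, 0 ≤ (n.choose k : ℝ) * (p ^ k.choose 2 * (1 - q ^ k) ^ (n - k)) := by
    intro n k
    have : 0 ≤ 1 - q ^ k := sub_nonneg.2 (pow_le_one₀ hq0.le hq1)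
    positivity
  have key := tendsto_tsum_of_dominated_convergence (𝓕 := atTop)
    (f := fun n k : ℕ => (n.choose k : ℝ) * (p ^ k.choose 2 * (1 - q ^ k) ^ (n - k)))
    (g := fun _ => (0 : ℝ)) (summable_factorial_mul hp0 hq0 h) (fun k => ?_)
    (Eventually.of_forall fun n k => ?_)
  · rw [tsum_zero] at key
    refine key.congr fun n => ?_
    refine tsum_eq_sum fun k hk => ?_
    rw [Nat.choose_eq_zero_of_lt (by simpa using hk)]
    simp
  · have h1 : Tendsto (fun n : ℕ => (n : ℝ) * q ^ k) atTop atTop :=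
      tendsto_natCast_atTop_atTop.atTop_mul_const (by positivity)
    have h2 := ((Real.tendsto_pow_mul_exp_neg_atTop_nhds_zero k).comp h1).const_mul
      (Real.exp k * p ^ k.choose 2 / q ^ k ^ 2)
    rw [mul_zero] at h2
    exact squeeze_zero (fun n => hnn n k) (fun n => hle n k) h2
  · rw [Real.norm_of_nonneg (hnn n k)]
    refine (hle n k).trans ?_
    rw [mul_comm]
    gcongr
    have h1 := Real.pow_div_factorial_le_exp (n * q ^ k) (by positivity) k
    rw [div_le_iff₀ (by positivity)] at h1
    calc (n * q ^ k) ^ k * Real.exp (-(n * q ^ k))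
        ≤ Real.exp (n * q ^ k) * k.factorial * Real.exp (-(n * q ^ k)) := by gcongr
      _ = k.factorial := by
        rw [mul_right_comm, ← Real.exp_add]
        simp

theorem aas_no_dominating_clique {p : I} (hp0 : 0 < (p : ℝ)) (hp1 : (p : ℝ) < 1)
    (h : (p : ℝ) < (1 - p) ^ 2) :
    AAS p fun n G => ¬ ∃ A : Set (Fin n), (∀ a ∈ A, ∀ b ∈ A, a ≠ b → G.Adj a b) ∧
      ∀ w ∉ A, ∃ a ∈ A, G.Adj w a := by
  classical
  refine AAS.of_le (tendsto_sum_dominating_clique hp0 hp1 h) (Eventually.of_forall fun n =>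
    le_trans (measureReal_mono ?_) (real_exists_dominating_clique_le p n))
  intro G hG
  obtain ⟨A, h1, h2⟩ := not_not.1 hG
  exact ⟨A.toFinset, by simpa using h1, by simpa using h2⟩

/-- Take an inclusion-maximal clique among those containing the edge `st`. -/
lemma exists_maximal_clique {V : Type*} [Finite V] {G : SimpleGraph V} {s t : V} (h : G.Adj s t) :
    ∃ A : Set V, A.Nontrivial ∧ (∀ u ∈ A, ∀ v ∈ A, u ≠ v → G.Adj u v) ∧
      ∀ w ∉ A, ∃ a ∈ A, ¬ G.Adj w a := by
  obtain ⟨A, hA, hmax⟩ := (Set.toFinite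
    {A : Set V | s ∈ A ∧ t ∈ A ∧ ∀ u ∈ A, ∀ v ∈ A, u ≠ v → G.Adj u v}).exists_maximal
    ⟨{s, t}, by simp, by simp, by simp [h, h.symm]⟩
  refine ⟨A, ⟨s, hA.1, t, hA.2.1, h.ne⟩, hA.2.2, fun w hw => ?_⟩
  by_contra hc
  push Not at hc
  refine hw (hmax (y := insert w A) ⟨by simp [hA.1], by simp [hA.2.1], ?_⟩ (Set.subset_insert _ _)
    (Set.mem_insert _ _))
  rintro u (rfl | hu) v (rfl | hv) huv
  · exact absurd rfl huv
  · exact hc v hv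
  · exact (hc u hu).symm
  · exact hA.2.2 u hu v hv huv

end Subcritical

/-! ### The zero-one law away from the threshold -/

section ZeroOne

open SimpleGraph ProbabilityTheory

/-- Off the threshold, the kinds of cliques that occur are asymptotically determined. -/
lemma exists_aas_cliqueKind {p : I} (hp0 : 0 < (p : ℝ)) (hp1 : (p : ℝ) < 1)
    (h : (p : ℝ) ≠ (1 - p) ^ 2) :
    ∃ τ : Prop → Prop → Prop, AAS p fun _ G => ∀ d m, (∃ A, IsCliqueKind G A d m) ↔ τ d m := by
  have e : ∀ b : Prop, b = True ∨ b = False := fun b => by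
    by_cases hb : b <;> simp [hb]
  have hext := aas_ext hp0 hp1
  rcases lt_or_gt_of_ne h with h | h
  -- Without dominating cliques exactly the kinds with `d` false remain: an inclusion-maximal
  -- clique, and a single edge.
  · refine ⟨fun d _ => ¬ d, (hext.and (aas_no_dominating_clique hp0 hp1 h)).mono ?_⟩
    filter_upwards [eventually_ge_atTop 1] with n hn G
    rintro ⟨hG, hno⟩ d m
    have : Nonempty (Fin n) := ⟨⟨0, hn⟩⟩
    rcases e d with rfl | rfl
    · simp only [not_true_eq_false, iff_false]
      rintro ⟨A, hA⟩
      exact hno ⟨A, hA.2.1, hA.2.2.1.2 trivial⟩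
    · simp only [not_false_eq_true, iff_true]
      rcases e m with rfl | rfl
      · obtain ⟨s⟩ := this
        obtain ⟨t, ⟨-, ht⟩, -⟩ := hG.exists_pattern (fun _ => True) s s s s s s
        obtain ⟨A, h1, h2, h3⟩ := exists_maximal_clique (ht.2 trivial)
        exact ⟨A, h1, h2, iff_false_intro fun hd => hno ⟨A, h2, hd⟩, iff_true_intro h3⟩
      · exact hG.exists_edge_kind
  · refine ⟨fun _ _ => True, (hext.and (aas_cliqueKind_of_lt hp0 hp1 h)).mono ?_⟩
    filter_upwards [eventually_ge_atTop 1] with n hn G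
    rintro ⟨hG, h1, h2, h3⟩ d m
    have : Nonempty (Fin n) := ⟨⟨0, hn⟩⟩
    rw [iff_true]
    rcases e d with rfl | rfl <;> rcases e m with rfl | rfl
    exacts [h1, h2, h3, hG.exists_edge_kind]

lemma tendsto_prob_of_aas {p : I} {φ : Sentence₁} (h : AAS p fun _ G => Models G φ) :
    Tendsto (prob p φ) atTop (𝓝 1) := by
  have h' := Tendsto.const_sub 1 h
  rw [sub_zero] at h'
  refine h'.congr fun n => ?_
  rw [← probReal_compl_eq_one_sub (Set.toFinite _).measurableSet, prob]
  congr 1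
  ext G
  simp

lemma tendsto_prob_of_aas_not {p : I} {φ : Sentence₁} (h : AAS p fun _ G => ¬ Models G φ) :
    Tendsto (prob p φ) atTop (𝓝 0) := by
  refine Tendsto.congr (fun n => ?_) h
  simp [prob]

/-- Typical graphs all have the same profile of cliques and independent sets, so one typical model
of `φ`, of any order, makes every typical graph a model; otherwise none is. -/
theorem zeroOneLaw_of_ne {p : I} (hp0 : 0 < (p : ℝ)) (hp1 : (p : ℝ) < 1)
    (h : (p : ℝ) ≠ (1 - p) ^ 2) (h' : 1 - (p : ℝ) ≠ p ^ 2) : ZeroOneLaw p (E₁ 2) := by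
  intro φ hφ
  obtain ⟨τ, hτ⟩ := exists_aas_cliqueKind hp0 hp1 h
  obtain ⟨τ', hτ'⟩ := exists_aas_cliqueKind (p := σ p) (by simpa using hp1) (by simpa using hp0)
    (by simpa using h')
  have hgood := (aas_ext hp0 hp1).and (hτ.and hτ'.compl)
  by_cases hex : ∃ (n : ℕ) (G : SimpleGraph (Fin n)), 1 ≤ n ∧ (Ext G ∧
      (∀ d m, (∃ A, IsCliqueKind G A d m) ↔ τ d m) ∧
      ∀ d m, (∃ A, IsCliqueKind Gᶜ A d m) ↔ τ' d m) ∧ Models G φ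
  · obtain ⟨n, G, hn, ⟨hG, hK, hK'⟩, hM⟩ := hex
    refine ⟨1, by simp, tendsto_prob_of_aas (hgood.mono ?_)⟩
    filter_upwards [eventually_ge_atTop 1] with n' hn' G' hG'
    have : Nonempty (Fin n) := ⟨⟨0, hn⟩⟩
    have : Nonempty (Fin n') := ⟨⟨0, hn'⟩⟩
    exact hG.models_of_models hG'.1 (fun d m => ((hK d m).trans (hG'.2.1 d m).symm).1)
      (fun d m => ((hK' d m).trans (hG'.2.2 d m).symm).1) hφ hM
  · refine ⟨0, by simp, tendsto_prob_of_aas_not (hgood.mono ?_)⟩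
    filter_upwards [eventually_ge_atTop 1] with n' hn' G' hG' hM
    exact hex ⟨n', G', hn', hG', hM⟩

end ZeroOne

/-! ### Extendable dominating cliques -/

section CriticalSentence

variable {V : Type*}

/-- Some clique is dominating but not maximal. -/
def HasExtendableDomClique (G : SimpleGraph V) : Prop :=
  ∃ X : Set V, (∀ u ∈ X, ∀ v ∈ X, u ≠ v → G.Adj u v) ∧ (∀ w ∉ X, ∃ a ∈ X, G.Adj w a) ∧
    ∃ v ∉ X, ∀ a ∈ X, G.Adj v a

/-- The atomic formula `X xᵢ`. -/
def memFormula {k : ℕ} (i : Fin k) : lang.BoundedFormula Empty k :=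
  .rel (show lang.Relations 1 from Rel.mem) ![.var (Sum.inr i)]

/-- The formula `x₀ ∼ x₁`. -/
def adjFormula : lang.BoundedFormula Empty 2 :=
  .rel (show lang.Relations 2 from Rel.adj) ![.var (Sum.inr 0), .var (Sum.inr 1)]

/-- The formula `x₀ = x₁`. -/
def eqFormula : lang.BoundedFormula Empty 2 :=
  .equal (.var (Sum.inr 0)) (.var (Sum.inr 1))

/-- The sentence stating that `X` is a dominating, non-maximal clique with respect to the adjacency
relation given by `A`. -/
def extendableDomClique (A : lang.BoundedFormula Empty 2) : Sentence₁ where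
  fo := ((memFormula 0).imp ((memFormula 1).imp (eqFormula.not.imp A))).all.all ⊓
    (((memFormula 0).not.imp ((memFormula 1 ⊓ A).ex)).all ⊓
      ((memFormula 0).not ⊓ ((memFormula 1).imp A).all).ex)

lemma qdepth_extendableDomClique {A : lang.BoundedFormula Empty 2} (hA : qdepth A = 0) :
    extendableDomClique A ∈ E₁ 2 := by
  have hinf : ∀ {k : ℕ} (f g : lang.BoundedFormula Empty k),
      qdepth (f ⊓ g) = max (qdepth f) (qdepth g) := fun f g => by
    change max (max (qdepth f) (max (qdepth g) 0)) 0 = _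
    simp
  have h : qdepth (extendableDomClique A).fo = 2 := by
    simp [extendableDomClique, hinf, qdepth, Language.BoundedFormula.ex, Language.BoundedFormula.not,
      memFormula, eqFormula, hA]
  exact h

lemma realize_memFormula (G : SimpleGraph V) (X : Set V) {k : ℕ} (i : Fin k) (x : Fin k → V) :
    @Language.BoundedFormula.Realize lang V (str G X) _ _ (memFormula i) default x ↔ x i ∈ X :=
  Iff.rfl

lemma realize_eqFormula (G : SimpleGraph V) (X : Set V) (x : Fin 2 → V) :
    @Language.BoundedFormula.Realize lang V (str G X) _ _ eqFormula default x ↔ x 0 = x 1 :=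
  Iff.rfl

lemma realize_adjFormula (G : SimpleGraph V) (X : Set V) (x : Fin 2 → V) :
    @Language.BoundedFormula.Realize lang V (str G X) _ _ adjFormula default x ↔
      G.Adj (x 0) (x 1) :=
  Iff.rfl

/-- The adjacency formula is a parameter, so that the same sentence can speak about `G` and about
its complement. -/
lemma models_extendableDomClique {A : lang.BoundedFormula Empty 2} (G H : SimpleGraph V)
    (hA : ∀ X : Set V, ∀ x : Fin 2 → V, @Language.BoundedFormula.Realize lang V (str G X) _ _ A
      default x ↔ H.Adj (x 0) (x 1)) :
    Models G (extendableDomClique A) ↔ HasExtendableDomClique H := by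
  refine exists_congr fun X => ?_
  let := str G X
  have e0 : ∀ (a b : V), (Fin.snoc (Fin.snoc default a : Fin 1 → V) b : Fin 2 → V) 0 = a :=
    fun a b => rfl
  have e1 : ∀ (a b : V), (Fin.snoc (Fin.snoc default a : Fin 1 → V) b : Fin 2 → V) 1 = b :=
    fun a b => rfl
  have e2 : ∀ (a : V), (Fin.snoc default a : Fin 1 → V) 0 = a := fun a => rfl
  simp only [Language.Sentence.Realize, Language.Formula.Realize, extendableDomClique,
    Language.BoundedFormula.realize_inf, Language.BoundedFormula.realize_all,
    Language.BoundedFormula.realize_imp, Language.BoundedFormula.realize_not,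
    Language.BoundedFormula.realize_ex, realize_memFormula, realize_eqFormula, hA, e0, e1, e2]
  refine and_congr ⟨fun h u hu v hv huv => h u v hu hv huv,
    fun h u v hu hv huv => h u hu v hv huv⟩ Iff.rfl

lemma models_adjFormula (G : SimpleGraph V) :
    Models G (extendableDomClique adjFormula) ↔ HasExtendableDomClique G :=
  models_extendableDomClique G G fun X x => realize_adjFormula G X x

lemma models_compl_adjFormula (G : SimpleGraph V) :
    Models G (extendableDomClique (eqFormula.not ⊓ adjFormula.not)) ↔
      HasExtendableDomClique Gᶜ := by
  refine models_extendableDomClique G Gᶜ fun X x => ?_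
  let := str G X
  rw [Language.BoundedFormula.realize_inf, Language.BoundedFormula.realize_not,
    Language.BoundedFormula.realize_not, realize_eqFormula, realize_adjFormula,
    SimpleGraph.compl_adj]

end CriticalSentence

/-! ### Exponential bounds for Poisson weights away from the mean -/

section PoissonTails

/-- Chernoff bound: `x^k / k! ≤ t^(-k) e^(tx)`, with any fixed `t` strictly between `1` and `1 / r`.
-/
lemma exists_poisson_upper_tail {r : ℝ} (hr0 : 0 < r) (hr1 : r < 1) :
    ∃ c > 0, ∀ (k : ℕ) (x : ℝ), 0 ≤ x → x ≤ r * k →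
      x ^ k * Real.exp (-x) / k.factorial ≤ Real.exp (-(c * k)) := by
  obtain ⟨t, ht1, ht2⟩ := exists_between ((one_lt_div hr0).2 hr1)
  have ht0 : 0 < t := by linarith
  have hrt : r * t < 1 := by rwa [lt_div_iff₀' hr0] at ht2
  refine ⟨(t - 1) * (1 / t - r), mul_pos (by linarith) ?_, fun k x hx0 hx => ?_⟩
  · rw [sub_pos, lt_div_iff₀ ht0]
    exact hrt
  have h1 := Real.pow_div_factorial_le_exp (t * x) (by positivity) k
  have h2 : (1 / t) ^ k ≤ Real.exp (-(k * (1 - 1 / t))) := by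
    have : 1 / t ≤ Real.exp (-(1 - 1 / t)) := by
      have := Real.one_sub_le_exp_neg (1 - 1 / t)
      linarith
    calc (1 / t) ^ k ≤ Real.exp (-(1 - 1 / t)) ^ k := by gcongr
      _ = _ := by rw [← Real.exp_nat_mul]; ring_nf
  calc x ^ k * Real.exp (-x) / k.factorial
      = ((t * x) ^ k / k.factorial) * (1 / t) ^ k * Real.exp (-x) := by
        rw [mul_pow, one_div, inv_pow]
        field_simp
    _ ≤ Real.exp (t * x) * Real.exp (-(k * (1 - 1 / t))) * Real.exp (-x) := by gcongr
    _ = Real.exp ((t - 1) * x - k * (1 - 1 / t)) := by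
        rw [← Real.exp_add, ← Real.exp_add]
        ring_nf
    _ ≤ Real.exp (-((t - 1) * (1 / t - r) * k)) := by
        gcongr
        have e : 1 - 1 / t = (t - 1) * (1 / t) := by field_simp
        have : (t - 1) * x ≤ (t - 1) * (r * k) := by
          gcongr
        rw [e]
        linarith

/-- The same exponential tilting, now with `t` strictly between `1 / R` and `1`. -/
lemma exists_poisson_lower_tail {R : ℝ} (hR : 1 < R) :
    ∃ c > 0, ∀ (k : ℕ) (x : ℝ), R * k ≤ x →
      x ^ k * Real.exp (-x) / k.factorial ≤ Real.exp (-(c * x)) := by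
  have hR0 : 0 < R := by linarith
  obtain ⟨t, ht1, ht2⟩ := exists_between ((div_lt_one hR0).2 hR)
  have ht0 : 0 < t := lt_trans (by positivity) ht1
  have hRt : 1 < t * R := by rwa [div_lt_iff₀ hR0] at ht1
  refine ⟨(1 - t) * (1 - 1 / (t * R)), mul_pos (by linarith) ?_, fun k x hx => ?_⟩
  · rw [sub_pos, div_lt_one (by positivity)]
    exact hRt
  have hx0 : 0 ≤ x := le_trans (by positivity) hx
  have h1 := Real.pow_div_factorial_le_exp (t * x) (by positivity) k
  have h2 : (1 / t) ^ k ≤ Real.exp (k * (1 / t - 1)) := by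
    have : 1 / t ≤ Real.exp (1 / t - 1) := by
      have := Real.add_one_le_exp (1 / t - 1)
      linarith
    calc (1 / t) ^ k ≤ Real.exp (1 / t - 1) ^ k := by gcongr
      _ = _ := by rw [← Real.exp_nat_mul]
  calc x ^ k * Real.exp (-x) / k.factorial
      = ((t * x) ^ k / k.factorial) * (1 / t) ^ k * Real.exp (-x) := by
        rw [mul_pow, one_div, inv_pow]
        field_simp
    _ ≤ Real.exp (t * x) * Real.exp (k * (1 / t - 1)) * Real.exp (-x) := by gcongr
    _ = Real.exp (k * (1 / t - 1) - (1 - t) * x) := by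
        rw [← Real.exp_add, ← Real.exp_add]
        ring_nf
    _ ≤ Real.exp (-((1 - t) * (1 - 1 / (t * R)) * x)) := by
        gcongr
        have hk : (k : ℝ) ≤ x / R := by
          rw [le_div_iff₀ hR0]
          linarith
        have e : 1 / t - 1 = (1 - t) / t := by field_simp
        have : (k : ℝ) * ((1 - t) / t) ≤ x / R * ((1 - t) / t) := by
          gcongr
        have e2 : x / R * ((1 - t) / t) = (1 - t) * (1 / (t * R)) * x := by field_simp
        rw [e]
        linarith

end PoissonTails

/-! ### Orders at which the first moment vanishes -/

section CriticalUpper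

open SimpleGraph ProbabilityTheory

/-- The first moment bound for extendable dominating cliques. -/
lemma real_extendableDomClique_le (p : I) (n : ℕ) :
    (binomialRandom (Fin n) p).real {G | HasExtendableDomClique G} ≤
    ∑ k ∈ Finset.range (n + 1), (n.choose k : ℝ) * ((n - k : ℕ) *
      ((p : ℝ) ^ (k + 1).choose 2 * (1 - (1 - (p : ℝ)) ^ k) ^ (n - (k + 1)))) := by
  classical
  have hsub : {G : SimpleGraph (Fin n) | HasExtendableDomClique G} ⊆
      ⋃ A ∈ (Finset.univ : Finset (Fin n)).powerset, ⋃ v ∈ Aᶜ,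
        {G | (∀ e ∈ cliqueEdges (insert v A), e ∈ G.edgeSet) ∧
          ∀ w ∈ (insert v A)ᶜ, ∃ a ∈ A, G.Adj w a} := by
    rintro G ⟨X, h1, h2, v, hv, h3⟩
    simp only [Set.mem_iUnion]
    refine ⟨X.toFinset, by simp, v, by simpa using hv, forall_cliqueEdges_iff.2 ?_, ?_⟩
    · intro a ha b hb hab
      simp only [Finset.mem_insert, Set.mem_toFinset] at ha hb
      rcases ha with rfl | ha <;> rcases hb with rfl | hb
      · exact absurd rfl hab
      · exact h3 b hb
      · exact (h3 a ha).symm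
      · exact h1 a ha b hb hab
    · intro w hw
      simp only [Finset.mem_compl, Finset.mem_insert, Set.mem_toFinset, not_or] at hw
      simpa using h2 w hw.2
  refine (measureReal_mono hsub (measure_ne_top _ _)).trans
    ((measureReal_biUnion_finset_le _ _).trans ?_)
  have h : ∀ A ∈ (Finset.univ : Finset (Fin n)).powerset, (binomialRandom (Fin n) p).real
      (⋃ v ∈ Aᶜ, {G | (∀ e ∈ cliqueEdges (insert v A), e ∈ G.edgeSet) ∧
          ∀ w ∈ (insert v A)ᶜ, ∃ a ∈ A, G.Adj w a}) ≤
      (n - A.card : ℕ) * ((p : ℝ) ^ (A.card + 1).choose 2 *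
        (1 - (1 - (p : ℝ)) ^ A.card) ^ (n - (A.card + 1))) := by
    intro A _
    refine (measureReal_biUnion_finset_le _ _).trans ?_
    have hc : Aᶜ.card = n - A.card := by rw [Finset.card_compl, Fintype.card_fin]
    rw [← hc, ← nsmul_eq_mul]
    refine Finset.sum_le_card_nsmul _ _ _ fun v hv => le_of_eq ?_
    rw [real_clique_dominating p (Finset.subset_insert _ _) disjoint_compl_left, Finset.card_compl,
      Fintype.card_fin, Finset.card_insert_of_notMem (Finset.mem_compl.1 hv)]
  refine (Finset.sum_le_sum h).trans (le_of_eq ?_)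
  rw [Finset.sum_powerset_apply_card (fun k => ((n - k : ℕ) : ℝ) * ((p : ℝ) ^ (k + 1).choose 2 *
        (1 - (1 - (p : ℝ)) ^ k) ^ (n - (k + 1))))]
  simp [nsmul_eq_mul]

/-- Each of the first `k + 1` terms of the geometric series is at least `q ^ k`. This makes the
correction for the clique's own vertices a bounded factor. -/
lemma succ_mul_pow_le {q : ℝ} (hq0 : 0 ≤ q) (hq1 : q < 1) (k : ℕ) :
    ((k + 1 : ℕ) : ℝ) * q ^ k ≤ (1 - q)⁻¹ := by
  rw [← tsum_geometric_of_lt_one hq0 hq1]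
  refine le_trans ?_ ((summable_geometric_of_lt_one hq0 hq1).sum_le_tsum (Finset.range (k + 1))
    fun _ _ => by positivity)
  rw [← nsmul_eq_mul]
  refine (Finset.card_nsmul_le_sum (Finset.range (k + 1)) (fun j => q ^ j) (q ^ k)
    fun j hj => ?_).trans' (by simp)
  exact pow_le_pow_of_le_one hq0 hq1.le (Nat.lt_succ_iff.1 (Finset.mem_range.1 hj))

/-- At the threshold, the first moment is governed by Poisson probabilities. -/
lemma critical_term_le {p q : ℝ} (hq0 : 0 < q) (hq1 : q < 1) (hpq : p = q ^ 2) (n k : ℕ) :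
    (n.choose k : ℝ) * ((n - k : ℕ) * (p ^ (k + 1).choose 2 * (1 - q ^ k) ^ (n - (k + 1)))) ≤
      Real.exp (1 - q)⁻¹ * ((n * q ^ k) *
        ((n * q ^ k) ^ k * Real.exp (-(n * q ^ k)) / k.factorial)) := by
  have hx0 : 0 ≤ q ^ k := by positivity
  have hx1 : q ^ k ≤ 1 := pow_le_one₀ hq0.le hq1.le
  have h1 : (n.choose k : ℝ) ≤ (n : ℝ) ^ k / k.factorial := Nat.choose_le_pow_div k n
  have h2 : (1 - q ^ k) ^ (n - (k + 1)) ≤ Real.exp (1 - q)⁻¹ * Real.exp (-(n * q ^ k)) := by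
    refine (one_sub_pow_le_exp hx0 hx1 n (k + 1)).trans ?_
    gcongr
    exact succ_mul_pow_le hq0.le hq1 k
  have h3 : 0 ≤ (1 - q ^ k) ^ (n - (k + 1)) := pow_nonneg (by linarith) _
  -- Here `p = q²` enters: the edge probability becomes `q^(k(k+1))`, which combines with the powers
  -- of `n` to a power of `n q^k`.
  have h4 : p ^ (k + 1).choose 2 = (q ^ k) ^ (k + 1) := by
    rw [hpq, ← pow_mul, ← pow_mul]
    congr 1
    rw [mul_comm 2, Nat.choose_two_right, Nat.div_mul_cancel (Nat.even_mul_pred_self _).two_dvd]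
    simp [mul_comm]
  have h5 : ((n - k : ℕ) : ℝ) ≤ n := by exact_mod_cast Nat.sub_le n k
  calc (n.choose k : ℝ) * ((n - k : ℕ) * (p ^ (k + 1).choose 2 * (1 - q ^ k) ^ (n - (k + 1))))
      ≤ (n : ℝ) ^ k / k.factorial * (n * ((q ^ k) ^ (k + 1) *
        (Real.exp (1 - q)⁻¹ * Real.exp (-(n * q ^ k))))) := by
        rw [h4]
        gcongr
    _ = _ := by ring

/-- Half of the exponential decay absorbs the linear factor. -/
lemma mul_exp_neg_le {c x : ℝ} (hc : 0 < c) :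
    x * Real.exp (-(c * x)) ≤ 2 / c * Real.exp (-(c / 2 * x)) := by
  have h1 : c / 2 * x ≤ Real.exp (c / 2 * x) := by linarith [Real.add_one_le_exp (c / 2 * x)]
  have h2 : x ≤ 2 / c * Real.exp (c / 2 * x) := by
    rw [div_mul_eq_mul_div, le_div_iff₀ hc]
    linarith
  calc x * Real.exp (-(c * x)) ≤ 2 / c * Real.exp (c / 2 * x) * Real.exp (-(c * x)) := by gcongr
    _ = _ := by
      rw [mul_assoc, ← Real.exp_add]
      ring_nf

/-- Along a suitable sequence of orders the first moment tends to zero. -/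
theorem exists_seq_tendsto_zero {p : I} {q : ℝ} (hq0 : 0 < q) (hq1 : q < 1) (hq : q = 1 - p)
    (hpq : (p : ℝ) = q ^ 2) :
    ∃ u : ℕ → ℕ, Tendsto u atTop atTop ∧
      Tendsto (fun i => (binomialRandom (Fin (u i)) p).real {G | HasExtendableDomClique G})
        atTop (𝓝 0) := by
  set w := √q with hw
  have hw0 : 0 < w := Real.sqrt_pos.2 hq0
  have hw1 : w < 1 := by
    rw [hw, Real.sqrt_lt' one_pos]
    linarith
  have hww : w * w = q := Real.mul_self_sqrt hq0.le
  have hqw : q ≤ w := by nlinarith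
  obtain ⟨c₁, hc₁, hup⟩ := exists_poisson_upper_tail hw0 hw1
  obtain ⟨c₂, hc₂, hlow⟩ := exists_poisson_lower_tail ((one_lt_div hw0).2 hw1)
  -- With this order the mean `u i * q ^ k` is about `i / w` at `k = i` and about `i * w` at `k = i
  -- + 1`, as `w² = q`. So it jumps over the diagonal, staying a factor `1 / w` from `k` on either
  -- side.
  set u : ℕ → ℕ := fun i => ⌈i * (q ^ i)⁻¹ / w⌉₊ with hu
  have hu1 : ∀ i, i * (q ^ i)⁻¹ / w ≤ u i := fun i => Nat.le_ceil _
  have hu2 : ∀ i, (u i : ℝ) ≤ i * (q ^ i)⁻¹ / w + 1 := fun i =>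
    (Nat.ceil_lt_add_one (by positivity)).le
  set C := Real.exp (1 - q)⁻¹ with hC
  set f : ℕ → ℕ → ℝ := fun i k => ((u i).choose k : ℝ) * ((u i - k : ℕ) *
    ((p : ℝ) ^ (k + 1).choose 2 * (1 - q ^ k) ^ (u i - (k + 1)))) with hf
  have hf0 : ∀ i k, 0 ≤ f i k := by
    intro i k
    have h1 : 0 ≤ 1 - q ^ k := sub_nonneg.2 (pow_le_one₀ hq0.le hq1.le)
    have h2 := p.2.1
    positivity
  have hlo : ∀ i k, k ≤ i → f i k ≤ C * (2 / c₂ * Real.exp (-(c₂ / 2 * i))) := by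
    intro i k hki
    set x := (u i : ℝ) * q ^ k with hx
    have hxi : i / w ≤ x := by
      have h1 : q ^ i ≤ q ^ k := pow_le_pow_of_le_one hq0.le hq1.le hki
      calc (i : ℝ) / w = i * (q ^ i)⁻¹ / w * q ^ i := by field_simp
        _ ≤ u i * q ^ k := by
          gcongr
          exact hu1 i
    have hxi' : (i : ℝ) ≤ x := by
      refine le_trans ?_ hxi
      rw [le_div_iff₀ hw0]
      nlinarith [Nat.cast_nonneg (α := ℝ) i]
    have hxk : 1 / w * k ≤ x := by
      refine le_trans ?_ hxi
      rw [div_mul_eq_mul_div, one_mul]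
      gcongr
    refine (critical_term_le hq0 hq1 hpq (u i) k).trans ?_
    refine mul_le_mul_of_nonneg_left ?_ (Real.exp_pos _).le
    calc x * (x ^ k * Real.exp (-x) / k.factorial) ≤ x * Real.exp (-(c₂ * x)) := by
          gcongr
          exact hlow k x hxk
      _ ≤ 2 / c₂ * Real.exp (-(c₂ / 2 * x)) := mul_exp_neg_le hc₂
      _ ≤ 2 / c₂ * Real.exp (-(c₂ / 2 * i)) := by gcongr
  have hhi : ∀ i k, i < k → f i k ≤ C * (2 / c₁ * Real.exp (-(c₁ / 2 * k))) := by
    intro i k hik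
    set x := (u i : ℝ) * q ^ k with hx
    have hxk : x ≤ w * k := by
      have h1 : q ^ k ≤ q ^ (i + 1) := pow_le_pow_of_le_one hq0.le hq1.le hik
      have h2 : q ^ (i + 1) ≤ w := (pow_le_of_le_one hq0.le hq1.le (by omega)).trans hqw
      have h3 : ((i + 1 : ℕ) : ℝ) ≤ k := by exact_mod_cast hik
      calc x ≤ (i * (q ^ i)⁻¹ / w + 1) * q ^ (i + 1) := by
            rw [hx]
            gcongr
            exact hu2 i
        _ = i * (q / w) + q ^ (i + 1) := by
            rw [pow_succ]
            field_simp
        _ = i * w + q ^ (i + 1) := by rw [← hww, mul_div_assoc, div_self hw0.ne', mul_one]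
        _ ≤ w * ((i + 1 : ℕ) : ℝ) := by
            push_cast
            linarith
        _ ≤ w * k := by gcongr
    have hxk' : x ≤ k := hxk.trans (mul_le_of_le_one_left (Nat.cast_nonneg k) hw1.le)
    have hx0 : 0 ≤ x := by positivity
    refine (critical_term_le hq0 hq1 hpq (u i) k).trans ?_
    refine mul_le_mul_of_nonneg_left ?_ (Real.exp_pos _).le
    calc x * (x ^ k * Real.exp (-x) / k.factorial) ≤ k * Real.exp (-(c₁ * k)) := by
          gcongr
          exact hup k x hx0 hxk
      _ ≤ 2 / c₁ * Real.exp (-(c₁ / 2 * k)) := mul_exp_neg_le hc₁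
  have hsum : ∀ c : ℝ, 0 < c → Summable fun k : ℕ => Real.exp (-(c / 2 * k)) := by
    intro c hc
    have := Real.summable_exp_nat_mul_iff.2 (show -(c / 2) < 0 by linarith)
    refine this.congr fun k => ?_
    ring_nf
  have hbound : Summable fun k : ℕ => C * (2 / c₂ * Real.exp (-(c₂ / 2 * k))) +
      C * (2 / c₁ * Real.exp (-(c₁ / 2 * k))) :=
    (((hsum c₂ hc₂).mul_left _).mul_left _).add (((hsum c₁ hc₁).mul_left _).mul_left _)
  -- For fixed `k` eventually `k ≤ i`, so `hlo` gives the limit; `hlo` and `hhi` together give a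
  -- summable bound independent of `i`.
  have key := tendsto_tsum_of_dominated_convergence (𝓕 := atTop) (f := f) (g := fun _ => (0 : ℝ))
    hbound (fun k => ?_) (Eventually.of_forall fun i k => ?_)
  · refine ⟨u, ?_, ?_⟩
    · refine tendsto_atTop_mono (fun i => ?_) tendsto_id
      have h1 : (i : ℝ) ≤ u i := by
        refine le_trans ?_ (hu1 i)
        rw [le_div_iff₀ hw0]
        have h2 : 1 ≤ (q ^ i)⁻¹ := (one_le_inv₀ (by positivity)).2 (pow_le_one₀ hq0.le hq1.le)
        gcongr
        linarith
      exact_mod_cast h1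
    · rw [tsum_zero] at key
      refine squeeze_zero (fun _ => measureReal_nonneg) (fun i => ?_) key
      refine (real_extendableDomClique_le p (u i)).trans (le_of_eq ?_)
      rw [← hq]
      refine (tsum_eq_sum fun k hk => ?_).symm
      rw [Nat.choose_eq_zero_of_lt (by simpa using hk)]
      simp
  · have h1 : Tendsto (fun i : ℕ => C * (2 / c₂ * Real.exp (-(c₂ / 2 * i)))) atTop (𝓝 0) := by
      have := (((hsum c₂ hc₂).tendsto_atTop_zero).const_mul (2 / c₂)).const_mul C
      simpa using this
    refine squeeze_zero' (Eventually.of_forall fun i => hf0 i k) ?_ h1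
    filter_upwards [eventually_ge_atTop k] with i hi using hlo i k hi
  · rw [Real.norm_of_nonneg (hf0 i k)]
    have h1 : 0 ≤ C * (2 / c₂ * Real.exp (-(c₂ / 2 * k))) := by positivity
    have h2 : 0 ≤ C * (2 / c₁ * Real.exp (-(c₁ / 2 * k))) := by positivity
    rcases le_or_gt k i with h | h
    · refine (hlo i k h).trans (le_add_of_le_of_nonneg ?_ h2)
      gcongr
    · exact (hhi i k h).trans (le_add_of_nonneg_left h1)

end CriticalUpper

/-! ### Estimates for the second moment at the threshold -/

section CriticalEstimates

/-- A crude Stirling bound, by induction from `e ≤ (1 + 1/k)^(k+1)`. -/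
lemma factorial_mul_exp_le {k : ℕ} (hk : 1 ≤ k) :
    (k.factorial : ℝ) * Real.exp k ≤ Real.exp 1 * k * (k : ℝ) ^ k := by
  induction k, hk using Nat.le_induction with
  | base => simp
  | succ k hk ih =>
    have hk0 : (0 : ℝ) < k := by exact_mod_cast hk
    have h1 : Real.exp 1 * (k : ℝ) ^ (k + 1) ≤ ((k + 1 : ℕ) : ℝ) ^ (k + 1) := by
      have h2 : (k : ℝ) / (k + 1) ≤ Real.exp (-(1 / (k + 1))) := by
        have := Real.one_sub_le_exp_neg (1 / ((k : ℝ) + 1))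
        refine le_trans (le_of_eq ?_) this
        field_simp
        ring
      have h3 : ((k : ℝ) / (k + 1)) ^ (k + 1) ≤ Real.exp (-1) := by
        calc ((k : ℝ) / (k + 1)) ^ (k + 1) ≤ Real.exp (-(1 / (k + 1))) ^ (k + 1) := by gcongr
          _ = Real.exp (-1) := by
            rw [← Real.exp_nat_mul]
            congr 1
            push_cast
            field_simp
      rw [div_pow, div_le_iff₀ (by positivity), Real.exp_neg] at h3
      push_cast
      calc Real.exp 1 * (k : ℝ) ^ (k + 1) ≤ Real.exp 1 * ((Real.exp 1)⁻¹ * (k + 1) ^ (k + 1)) := by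
            gcongr
        _ = _ := by field_simp
    calc ((k + 1).factorial : ℝ) * Real.exp (k + 1 : ℕ)
        = (k + 1) * Real.exp 1 * (k.factorial * Real.exp k) := by
          rw [Nat.factorial_succ]
          push_cast
          rw [Real.exp_add]
          ring
      _ ≤ (k + 1) * Real.exp 1 * (Real.exp 1 * k * (k : ℝ) ^ k) := by gcongr
      _ = Real.exp 1 * (k + 1) * (Real.exp 1 * (k : ℝ) ^ (k + 1)) := by ring
      _ ≤ Real.exp 1 * (k + 1) * ((k + 1 : ℕ) : ℝ) ^ (k + 1) := by gcongr
      _ = _ := by push_cast; ring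

/-- `(1 - x)(1 + x + 2x²) = 1 + x²(1 - 2x) ≥ 1`. -/
lemma exp_neg_le_one_sub {x : ℝ} (hx : x ≤ 1 / 2) :
    Real.exp (-(x + 2 * x ^ 2)) ≤ 1 - x := by
  have h1 := Real.add_one_le_exp (x + 2 * x ^ 2)
  rw [Real.exp_neg, inv_le_iff_one_le_mul₀ (Real.exp_pos _)]
  have h2 : (1 - x) * (x + 2 * x ^ 2 + 1) ≤ (1 - x) * Real.exp (x + 2 * x ^ 2) := by
    gcongr
    linarith
  nlinarith [mul_nonneg (sq_nonneg x) (by linarith : 0 ≤ 1 - 2 * x)]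

/-- Every factor is at least `n (1 - i/n)`, and Bernoulli gives `(1 - i/n)^i ≥ 1 - i²/n ≥ 1/2`. -/
lemma pow_le_two_mul_descFactorial {n K i : ℕ} (hn : 2 * K ^ 2 ≤ n) (hi : i ≤ K) :
    (n : ℝ) ^ i ≤ 2 * n.descFactorial i := by
  rcases Nat.eq_zero_or_pos n with rfl | hn0
  · have : K = 0 := by nlinarith
    obtain rfl : i = 0 := by omega
    simp
  have hn0' : (0 : ℝ) < n := by exact_mod_cast hn0
  have h1 : ((n + 1 - i : ℕ) : ℝ) ^ i ≤ n.descFactorial i := by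
    exact_mod_cast Nat.pow_sub_le_descFactorial n i
  have hin : (i : ℝ) * i / n ≤ 1 / 2 := by
    rw [div_le_iff₀ hn0']
    have h2 : 2 * (i * i) ≤ n := by nlinarith
    have : (2 : ℝ) * (i * i) ≤ n := by exact_mod_cast h2
    linarith
  have hi1 : (i : ℝ) / n ≤ 1 := by
    rw [div_le_one hn0']
    exact_mod_cast (by nlinarith : i ≤ n)
  have h2 : (n : ℝ) * (1 - i / n) ≤ (n + 1 - i : ℕ) := by
    have : (n : ℝ) ≤ (n + 1 - i : ℕ) + i := by exact_mod_cast (by omega : n ≤ (n + 1 - i) + i)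
    rw [mul_sub, mul_one, mul_div_cancel₀ _ hn0'.ne']
    linarith
  have h3 : 1 / 2 ≤ (1 - (i : ℝ) / n) ^ i := by
    have := one_add_mul_le_pow (show (-2 : ℝ) ≤ -(i / n) by linarith) i
    rw [← sub_eq_add_neg] at this
    refine le_trans ?_ this
    have e : (i : ℝ) * -(i / n) = -(i * i / n) := by ring
    rw [e]
    linarith
  have h4 : (n : ℝ) ^ i * (1 / 2) ≤ n.descFactorial i := by
    calc (n : ℝ) ^ i * (1 / 2) ≤ (n : ℝ) ^ i * (1 - (i : ℝ) / n) ^ i := by gcongr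
      _ = (n * (1 - (i : ℝ) / n)) ^ i := by rw [mul_pow]
      _ ≤ ((n + 1 - i : ℕ) : ℝ) ^ i := by
        have : 0 ≤ 1 - (i : ℝ) / n := by linarith
        gcongr
      _ ≤ _ := h1
  linarith

/-- The contribution of the pairs of cliques with an intersection of size `i`. -/
lemma critical_overlap_le {q w : ℝ} (hq0 : 0 < q) (hq1 : q < 1) (hw0 : 0 < w) (hw1 : w < 1)
    (hwq : w ^ 2 = q) {k n i : ℕ} (hk : 1 ≤ k) (hn : 2 * (k + 1) ^ 2 ≤ n)
    (hlam : (k : ℝ) ≤ n * q ^ k) (hi : i ≤ k)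
    {ε : ℝ} (hε : ε = ((k + 1 : ℕ) : ℝ) ^ 3 * w ^ (k + 1)) (hε1 : ε ≤ 1 / 2) :
    ((k + 1).choose i : ℝ) * ((k + 1).descFactorial i / n.descFactorial i) *
      ((q ^ 2)⁻¹ ^ i.choose 2 * Real.exp ((k + 1 : ℕ) * q ^ (k - i))) ≤
      2 * Real.exp 2 * Real.exp q⁻¹ * (ε ^ i + ε ^ (k + 1 - i)) := by
  set K := k + 1 with hK
  have hk0 : (0 : ℝ) < k := by exact_mod_cast hk
  have hK0 : (0 : ℝ) < (K : ℝ) := by positivity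
  have hK1 : (1 : ℝ) ≤ (K : ℝ) := by exact_mod_cast (by omega : 1 ≤ K)
  have hε0 : 0 < ε := by rw [hε]; positivity
  obtain ⟨m, hm⟩ : ∃ m, K = i + m := ⟨K - i, by omega⟩
  have hm1 : 1 ≤ m := by omega
  have hdn : (0 : ℝ) < n.descFactorial i := by
    exact_mod_cast Nat.pos_of_ne_zero (Nat.descFactorial_eq_zero_iff_lt.not.2 (by nlinarith))
  -- reduction to powers of `q`
  have hKk : (K : ℝ) ^ i ≤ Real.exp 1 * k ^ i := by
    have h1 : (K : ℝ) ≤ Real.exp (1 / k) * k := by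
      have := Real.add_one_le_exp (1 / (k : ℝ))
      calc (K : ℝ) = (1 / k + 1) * k := by rw [hK]; push_cast; field_simp; ring
        _ ≤ _ := by gcongr
    calc (K : ℝ) ^ i ≤ (Real.exp (1 / k) * k) ^ i := by gcongr
      _ = Real.exp (i * (1 / k)) * k ^ i := by rw [mul_pow, ← Real.exp_nat_mul]
      _ ≤ Real.exp 1 * k ^ i := by
        gcongr
        rw [mul_one_div, div_le_one hk0]
        exact_mod_cast hi
  have hKn : (K : ℝ) ^ i ≤ 2 * Real.exp 1 * n.descFactorial i * q ^ (i * k) := by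
    have h1 := pow_le_two_mul_descFactorial hn (by omega : i ≤ K)
    calc (K : ℝ) ^ i ≤ Real.exp 1 * k ^ i := hKk
      _ ≤ Real.exp 1 * (n * q ^ k) ^ i := by gcongr
      _ = Real.exp 1 * (n ^ i * q ^ (i * k)) := by rw [mul_pow, ← pow_mul, mul_comm k i]
      _ ≤ Real.exp 1 * ((2 * n.descFactorial i) * q ^ (i * k)) := by gcongr
      _ = _ := by ring
  have hpow : q ^ (i * k) * (q ^ 2)⁻¹ ^ i.choose 2 = (q ^ m) ^ i := by
    have e : i * k = m * i + 2 * i.choose 2 := by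
      rw [mul_comm 2, Nat.choose_two_right, Nat.div_mul_cancel (Nat.even_mul_pred_self i).two_dvd]
      rcases Nat.eq_zero_or_pos i with rfl | hi0
      · simp
      · obtain ⟨j, rfl⟩ : ∃ j, i = j + 1 := ⟨i - 1, by omega⟩
        have : k = j + m := by omega
        rw [this, Nat.add_sub_cancel]
        ring
    rw [e, inv_pow, ← pow_mul, ← pow_mul, pow_add]
    field_simp
  -- For small intersections `d ≤ 1` suffices. For large ones Stirling gives `d` a factor `exp
  -- (-K)`, which cancels the growth of `exp (K * q ^ (m - 1))`.
  set d : ℝ := K.descFactorial i / (K : ℝ) ^ i with hd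
  have hmain : ((K.choose i : ℕ) : ℝ) * (K.descFactorial i / n.descFactorial i) *
      ((q ^ 2)⁻¹ ^ i.choose 2 * Real.exp (K * q ^ (k - i))) ≤
      2 * Real.exp 1 * (K.choose i * d * (q ^ m) ^ i * Real.exp (K * q ^ (k - i))) := by
    have h1 : (K.descFactorial i : ℝ) / n.descFactorial i ≤
        2 * Real.exp 1 * (d * q ^ (i * k)) := by
      rw [div_le_iff₀ hdn, hd]
      calc (K.descFactorial i : ℝ) = K.descFactorial i / (K : ℝ) ^ i * (K : ℝ) ^ i := by field_simp
        _ ≤ K.descFactorial i / (K : ℝ) ^ i *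
            (2 * Real.exp 1 * n.descFactorial i * q ^ (i * k)) := by gcongr
        _ = _ := by ring
    calc _ ≤ (K.choose i : ℝ) * (2 * Real.exp 1 * (d * q ^ (i * k))) *
          ((q ^ 2)⁻¹ ^ i.choose 2 * Real.exp (K * q ^ (k - i))) := by gcongr
      _ = 2 * Real.exp 1 * (K.choose i * d * (q ^ (i * k) * (q ^ 2)⁻¹ ^ i.choose 2) *
          Real.exp (K * q ^ (k - i))) := by ring
      _ = _ := by rw [hpow]
  refine hmain.trans ?_
  have hd0 : 0 ≤ d := by positivity
  have hki : k - i = m - 1 := by omega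
  have hmi : K - i = m := by omega
  have hexp1 : 1 ≤ Real.exp q⁻¹ := Real.one_le_exp (by positivity)
  rw [hki, hmi]
  rcases le_or_gt K (2 * m) with hcase | hcase
  · -- small intersections
    have hqm : q ^ m ≤ w ^ K := by
      rw [← hwq, ← pow_mul]
      exact pow_le_pow_of_le_one hw0.le hw1.le hcase
    have h1 : (K : ℝ) * w ^ K ≤ ε := by
      rw [hε]
      gcongr
      exact le_self_pow₀ hK1 (by norm_num)
    have h2 : (K : ℝ) * q ^ (m - 1) ≤ q⁻¹ := by
      have e : q ^ (m - 1) = q ^ m * q⁻¹ := by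
        rw [← Nat.sub_add_cancel hm1, pow_succ, Nat.add_sub_cancel]
        field_simp
      rw [e, ← mul_assoc]
      have h3 : (K : ℝ) * q ^ m ≤ 1 := by
        calc (K : ℝ) * q ^ m ≤ K * w ^ K := by gcongr
          _ ≤ 1 := by linarith
      exact mul_le_of_le_one_left (by positivity) h3
    have h3 : (K.choose i : ℝ) ≤ (K : ℝ) ^ i := by exact_mod_cast Nat.choose_le_pow K i
    have h4 : d ≤ 1 := by
      rw [hd, div_le_one (by positivity)]
      exact_mod_cast Nat.descFactorial_le_pow K i
    calc 2 * Real.exp 1 * (K.choose i * d * (q ^ m) ^ i * Real.exp (K * q ^ (m - 1)))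
        ≤ 2 * Real.exp 2 * ((K : ℝ) ^ i * 1 * (w ^ K) ^ i * Real.exp q⁻¹) := by
          gcongr
          norm_num
      _ = 2 * Real.exp 2 * Real.exp q⁻¹ * (K * w ^ K) ^ i := by
          rw [mul_pow]
          ring
      _ ≤ 2 * Real.exp 2 * Real.exp q⁻¹ * ε ^ i := by gcongr
      _ ≤ _ := by
          gcongr
          exact le_add_of_nonneg_right (by positivity)
  · -- large intersections
    have hqi : (q ^ m) ^ i ≤ (w ^ K) ^ m := by
      rw [← pow_mul, mul_comm m i, pow_mul]
      refine pow_le_pow_left₀ (by positivity) ?_ m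
      rw [← hwq, ← pow_mul]
      exact pow_le_pow_of_le_one hw0.le hw1.le (by omega)
    have h3 : (K.choose i : ℝ) ≤ (K : ℝ) ^ m := by
      rw [hm, Nat.choose_symm_add, ← hm]
      exact_mod_cast Nat.choose_le_pow K m
    have h4 : d ≤ Real.exp 1 * K * K ^ m * Real.exp (-K) := by
      have h5 := factorial_mul_exp_le (by omega : 1 ≤ K)
      have h6 : (K.descFactorial i : ℝ) ≤ K.factorial := by
        have := Nat.factorial_mul_descFactorial (by omega : i ≤ K)
        exact_mod_cast this ▸ Nat.le_mul_of_pos_left _ (Nat.factorial_pos _)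
      rw [hd, div_le_iff₀ (by positivity), Real.exp_neg]
      calc (K.descFactorial i : ℝ) ≤ K.factorial := h6
        _ = K.factorial * Real.exp K * (Real.exp K)⁻¹ := by field_simp
        _ ≤ Real.exp 1 * K * (K : ℝ) ^ K * (Real.exp K)⁻¹ := by gcongr
        _ = _ := by
          have hKK : (K : ℝ) ^ K = (K : ℝ) ^ i * (K : ℝ) ^ m := by rw [← pow_add, ← hm]
          rw [hKK]
          ring
    have h5 : Real.exp (K * q ^ (m - 1)) ≤ Real.exp K := by
      gcongr
      exact mul_le_of_le_one_right hK0.le (pow_le_one₀ hq0.le hq1.le)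
    have h6 : (K : ℝ) ≤ (K : ℝ) ^ m := le_self_pow₀ hK1 (by omega)
    calc 2 * Real.exp 1 * (K.choose i * d * (q ^ m) ^ i * Real.exp (K * q ^ (m - 1)))
        ≤ 2 * Real.exp 1 * ((K : ℝ) ^ m * (Real.exp 1 * K ^ m * K ^ m * Real.exp (-K)) *
          (w ^ K) ^ m * Real.exp K) := by
          gcongr
          refine h4.trans ?_
          gcongr
      _ = 2 * (Real.exp 1 * Real.exp 1) * (((K : ℝ) ^ 3 * w ^ K) ^ m) := by
          rw [Real.exp_neg, mul_pow]
          field_simp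
          ring
      _ = 2 * Real.exp 2 * ε ^ m := by
          rw [← hε, ← Real.exp_add]
          norm_num
      _ = 2 * Real.exp 2 * 1 * ε ^ m := by ring
      _ ≤ 2 * Real.exp 2 * Real.exp q⁻¹ * ε ^ m := by gcongr
      _ ≤ _ := by
          gcongr
          exact le_add_of_nonneg_left (by positivity)

/-- The expected number of cliques compensates the domination probability. -/
lemma critical_expectation_ge {q : ℝ} (hq0 : 0 < q) {k n : ℕ} (hk : 1 ≤ k)
    (hn : 2 * (k + 1) ^ 2 ≤ n) (hlam : (k : ℝ) ≤ n * q ^ k) :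
    Real.exp (k + 1 : ℕ) ≤ 2 * Real.exp 2 *
      ((q ^ 2) ^ (k + 1).choose 2 * n.choose (k + 1) * (k + 1 : ℕ)) := by
  have hk0 : (0 : ℝ) < k := by exact_mod_cast hk
  have hpow : (q ^ 2) ^ (k + 1).choose 2 = (q ^ k) ^ (k + 1) := by
    rw [← pow_mul, ← pow_mul]
    congr 1
    rw [mul_comm 2, Nat.choose_two_right, Nat.div_mul_cancel (Nat.even_mul_pred_self _).two_dvd]
    simp [mul_comm]
  have hch : (n.choose (k + 1) : ℝ) * (k + 1 : ℕ) = n.descFactorial (k + 1) / k.factorial := by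
    rw [eq_div_iff (by positivity), Nat.descFactorial_eq_factorial_mul_choose, Nat.factorial_succ]
    push_cast
    ring
  have h1 := pow_le_two_mul_descFactorial hn le_rfl
  have h2 := factorial_mul_exp_le hk
  have h3 : (k : ℝ) ^ (k + 1) ≤ (n * q ^ k) ^ (k + 1) := by gcongr
  rw [mul_assoc ((q ^ 2) ^ _), hch, hpow]
  rw [mul_div_assoc', mul_div_assoc', le_div_iff₀ (by positivity)]
  calc Real.exp (k + 1 : ℕ) * k.factorial = Real.exp 1 * (k.factorial * Real.exp k) := by
        push_cast
        rw [Real.exp_add]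
        ring
    _ ≤ Real.exp 1 * (Real.exp 1 * k * (k : ℝ) ^ k) := by gcongr
    _ = Real.exp 2 * (k : ℝ) ^ (k + 1) := by
        rw [show (2 : ℝ) = 1 + 1 by norm_num, Real.exp_add]
        ring
    _ ≤ Real.exp 2 * (n * q ^ k) ^ (k + 1) := by gcongr
    _ = Real.exp 2 * (n ^ (k + 1) * (q ^ k) ^ (k + 1)) := by rw [mul_pow]
    _ ≤ Real.exp 2 * ((2 * n.descFactorial (k + 1)) * (q ^ k) ^ (k + 1)) := by gcongr
    _ = _ := by ring

end CriticalEstimates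

/-! ### Pair probabilities for extendable dominating cliques -/

section CriticalLower

open SimpleGraph ProbabilityTheory

variable {V : Type*} [Fintype V] [DecidableEq V]

/-- The graphs in which `C` is a clique whose subset `C \ {v}` dominates the complement of `C`. -/
def extendableAt (C : Finset V) (v : V) : Set (SimpleGraph V) :=
  {G | (∀ e ∈ cliqueEdges C, e ∈ G.edgeSet) ∧ ∀ w ∈ Cᶜ, ∃ a ∈ C.erase v, G.Adj w a}

/-- The size `k + 2` leaves `C.erase v` nonempty, so that it dominates `v` as well. -/
lemma hasExtendableDomClique_of_extendableAt {C : Finset V} {v : V} (hv : v ∈ C) {k : ℕ}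
    (hC : C.card = k + 2) {G : SimpleGraph V} (h : G ∈ extendableAt C v) :
    HasExtendableDomClique G := by
  have hcl := forall_cliqueEdges_iff.1 h.1
  refine ⟨C.erase v, fun a ha b hb hab => ?_, fun w hw => ?_, v, by simp, fun a ha => ?_⟩
  · exact hcl a (Finset.mem_of_mem_erase ha) b (Finset.mem_of_mem_erase hb) hab
  · by_cases hwC : w ∈ C
    · obtain rfl : w = v := by
        by_contra hne
        exact hw (Finset.mem_coe.2 (Finset.mem_erase.2 ⟨hne, hwC⟩))
      obtain ⟨a, ha⟩ : (C.erase w).Nonempty := by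
        rw [← Finset.card_pos, Finset.card_erase_of_mem hv, hC]
        omega
      exact ⟨a, ha, hcl w hv a (Finset.mem_of_mem_erase ha) (Finset.ne_of_mem_erase ha).symm⟩
    · exact h.2 w (Finset.mem_compl.2 hwC)
  · exact hcl v hv a (Finset.mem_of_mem_erase ha) (Finset.ne_of_mem_erase ha).symm

lemma real_extendableAt (p : I) {C : Finset V} {v : V} (hv : v ∈ C) {k : ℕ}
    (hC : C.card = k + 1) :
    (binomialRandom V p).real (extendableAt C v) =
      (p : ℝ) ^ (k + 1).choose 2 * (1 - (1 - (p : ℝ)) ^ k) ^ (Fintype.card V - (k + 1)) := by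
  rw [extendableAt, real_clique_dominating p (Finset.erase_subset _ _) disjoint_compl_left,
    Finset.card_compl, Finset.card_erase_of_mem hv, hC, Nat.add_sub_cancel]

/-- Only domination of vertices outside both cliques is kept. With `x = q^k` and `y` the probability
of missing both dominating sets, each such vertex contributes `1 - 2x + y`. Against independence
this costs `exp (n * y)`, while the remaining errors are exponentials of multiples of `(k + 1) * x`,
hence bounded. -/
lemma real_extendableAt_inter_le {p : I} {q : ℝ} (hp0 : 0 < (p : ℝ)) (hq0 : 0 < q) (hq1 : q < 1)
    (hq : q = 1 - p) {k : ℕ} (hx : q ^ k ≤ 1 / 2)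
    (hlam : Fintype.card V * q ^ k ≤ (k + 1 : ℕ)) {C C' : Finset V} {v v' : V} (hv : v ∈ C)
    (hv' : v' ∈ C') (hC : C.card = k + 1) (hC' : C'.card = k + 1) :
    (binomialRandom V p).real (extendableAt C v ∩ extendableAt C' v') ≤
      ((p : ℝ) ^ (k + 1).choose 2 * (1 - q ^ k) ^ (Fintype.card V - (k + 1))) ^ 2 *
      Real.exp (8 * (1 - q)⁻¹) * ((p : ℝ)⁻¹ ^ (C ∩ C').card.choose 2 *
        Real.exp (Fintype.card V * q ^ (C.erase v ∪ C'.erase v').card)) := by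
  set n := Fintype.card V with hn
  set x := q ^ k with hxdef
  set y := q ^ (C.erase v ∪ C'.erase v').card with hy
  have hx0 : 0 < x := by positivity
  have hBk : (C.erase v).card = k := by rw [Finset.card_erase_of_mem hv, hC, Nat.add_sub_cancel]
  have hBk' : (C'.erase v').card = k := by
    rw [Finset.card_erase_of_mem hv', hC', Nat.add_sub_cancel]
  have hyx : y ≤ x := pow_le_pow_of_le_one hq0.le hq1.le
    (hBk ▸ Finset.card_le_card Finset.subset_union_left)
  have hKx : ((k + 1 : ℕ) : ℝ) * x ≤ (1 - q)⁻¹ := succ_mul_pow_le hq0.le hq1 k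
  have hsub : extendableAt C v ∩ extendableAt C' v' ⊆
      {G | (∀ e ∈ cliqueEdges C ∪ cliqueEdges C', e ∈ G.edgeSet) ∧ ∀ w ∈ (C ∪ C')ᶜ,
        (∃ a ∈ C.erase v, G.Adj w a) ∧ ∃ a ∈ C'.erase v', G.Adj w a} := by
    rintro G ⟨h1, h2⟩
    refine ⟨fun e he => ?_, fun w hw => ?_⟩
    · rcases Finset.mem_union.1 he with he | he
      exacts [h1.1 e he, h2.1 e he]
    · rw [Finset.mem_compl, Finset.mem_union, not_or] at hw
      exact ⟨h1.2 w (Finset.mem_compl.2 hw.1), h2.2 w (Finset.mem_compl.2 hw.2)⟩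
  refine (measureReal_mono hsub (measure_ne_top _ _)).trans ?_
  rw [real_cliques_dominating p (Finset.erase_subset _ _) (Finset.erase_subset _ _)
    disjoint_compl_left, ← hq, hBk, hBk', ← hxdef, ← hy]
  have hedge : (p : ℝ) ^ (cliqueEdges C ∪ cliqueEdges C').card =
      ((p : ℝ) ^ (k + 1).choose 2) ^ 2 * (p : ℝ)⁻¹ ^ (C ∩ C').card.choose 2 := by
    have h := card_cliqueEdges_union C C'
    rw [hC, hC'] at h
    rw [inv_pow, eq_mul_inv_iff_mul_eq₀ (by positivity), ← pow_add, h, ← two_mul, mul_comm, pow_mul]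
  have hW : (n : ℝ) ≤ ((C ∪ C')ᶜ.card : ℝ) + 2 * (k + 1 : ℕ) := by
    have h1 := Finset.card_union_le C C'
    have h2 := Finset.card_compl_add_card (C ∪ C')
    exact_mod_cast (by omega : n ≤ (C ∪ C')ᶜ.card + 2 * (k + 1))
  -- The at most `2(k + 1)` vertices of `C ∪ C'` account for the last factor.
  have hdom : (1 - x - x + y) ^ (C ∪ C')ᶜ.card ≤
      Real.exp (-(2 * (n * x))) * Real.exp (n * y) * Real.exp (4 * ((k + 1 : ℕ) * x)) := by
    have h0 : 0 ≤ 1 - x - x + y := by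
      have : 0 < y := by positivity
      linarith
    have h1 : 1 - x - x + y ≤ Real.exp (-(2 * x - y)) := by
      have := Real.one_sub_le_exp_neg (2 * x - y)
      linarith
    calc (1 - x - x + y) ^ (C ∪ C')ᶜ.card ≤ Real.exp (-(2 * x - y)) ^ (C ∪ C')ᶜ.card := by gcongr
      _ = Real.exp (-((C ∪ C')ᶜ.card * (2 * x - y))) := by
        rw [← Real.exp_nat_mul]
        ring_nf
      _ ≤ Real.exp (-(2 * (n * x)) + n * y + 4 * ((k + 1 : ℕ) * x)) := by
        gcongr
        have h2 : 0 ≤ 2 * x - y := by linarith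
        have h3 : 0 ≤ ((k + 1 : ℕ) : ℝ) * y := by positivity
        nlinarith [mul_le_mul_of_nonneg_right hW h2]
      _ = _ := by rw [Real.exp_add, Real.exp_add]
  have hsq : Real.exp (-(2 * (n * x))) ≤
      ((1 - x) ^ (n - (k + 1))) ^ 2 * Real.exp (4 * ((k + 1 : ℕ) * x)) := by
    have h1 : Real.exp (-(x + 2 * x ^ 2)) ^ n ≤ (1 - x) ^ (n - (k + 1)) := by
      calc Real.exp (-(x + 2 * x ^ 2)) ^ n ≤ (1 - x) ^ n := by
            gcongr
            exact exp_neg_le_one_sub hx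
        _ ≤ _ := pow_le_pow_of_le_one (by linarith) (by linarith) (Nat.sub_le _ _)
    have h2 : (n : ℝ) * x ^ 2 ≤ (k + 1 : ℕ) * x := by
      have := mul_le_mul_of_nonneg_right hlam hx0.le
      nlinarith
    calc Real.exp (-(2 * (n * x)))
        ≤ Real.exp (2 * (n * -(x + 2 * x ^ 2)) + 4 * ((k + 1 : ℕ) * x)) := by
          gcongr
          nlinarith
      _ = (Real.exp (-(x + 2 * x ^ 2)) ^ n) ^ 2 * Real.exp (4 * ((k + 1 : ℕ) * x)) := by
          rw [Real.exp_add, ← Real.exp_nat_mul, ← Real.exp_nat_mul]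
          norm_num
      _ ≤ _ := by gcongr
  have h1x : 0 ≤ 1 - x := by linarith
  rw [hedge]
  calc ((p : ℝ) ^ (k + 1).choose 2) ^ 2 * (p : ℝ)⁻¹ ^ (C ∩ C').card.choose 2 *
        (1 - x - x + y) ^ (C ∪ C')ᶜ.card
      ≤ ((p : ℝ) ^ (k + 1).choose 2) ^ 2 * (p : ℝ)⁻¹ ^ (C ∩ C').card.choose 2 *
        (((1 - x) ^ (n - (k + 1))) ^ 2 * Real.exp (4 * ((k + 1 : ℕ) * x)) * Real.exp (n * y) *
          Real.exp (4 * ((k + 1 : ℕ) * x))) := by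
        gcongr
        refine hdom.trans ?_
        gcongr
    _ = ((p : ℝ) ^ (k + 1).choose 2 * (1 - x) ^ (n - (k + 1))) ^ 2 *
        (Real.exp (4 * ((k + 1 : ℕ) * x)) * Real.exp (4 * ((k + 1 : ℕ) * x))) *
        ((p : ℝ)⁻¹ ^ (C ∩ C').card.choose 2 * Real.exp (n * y)) := by ring
    _ ≤ _ := by
        rw [← Real.exp_add]
        gcongr
        linarith

end CriticalLower

/-! ### The second moment at the threshold -/

section CriticalLower

open SimpleGraph ProbabilityTheory

variable {V : Type*} [Fintype V] [DecidableEq V]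

/-- The pairs with a fixed first clique `C` and a given second clique `C'`. -/
lemma sum_real_extendableAt_inter_le {p : I} {q : ℝ} (hp0 : 0 < (p : ℝ)) (hq0 : 0 < q)
    (hq1 : q < 1) (hq : q = 1 - p) {k : ℕ} (hx : q ^ k ≤ 1 / 2)
    (hlam : Fintype.card V * q ^ k ≤ (k + 1 : ℕ)) {C C' : Finset V} {v : V} (hv : v ∈ C)
    (hC : C.card = k + 1) (hC' : C'.card = k + 1) :
    ∑ v' ∈ C', (binomialRandom V p).real (extendableAt C v ∩ extendableAt C' v') ≤
      ((p : ℝ) ^ (k + 1).choose 2 * (1 - q ^ k) ^ (Fintype.card V - (k + 1))) ^ 2 *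
      Real.exp (8 * (1 - q)⁻¹) *
      ((k + 1 : ℕ) * (if (C ∩ C').card ≤ k then (p : ℝ)⁻¹ ^ (C ∩ C').card.choose 2 *
        Real.exp ((k + 1 : ℕ) * q ^ (k - (C ∩ C').card)) else 0) +
      if C' = C then (p : ℝ)⁻¹ ^ (k + 1).choose 2 *
        (Real.exp (k + 1 : ℕ) + k * Real.exp ((k + 1 : ℕ) * q)) else 0) := by
  set n := Fintype.card V with hn
  have hBk : (C.erase v).card = k := by rw [Finset.card_erase_of_mem hv, hC, Nat.add_sub_cancel]
  have hny : ∀ m j : ℕ, k + j ≤ m → (n : ℝ) * q ^ m ≤ (k + 1 : ℕ) * q ^ j := by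
    intro m j h
    calc (n : ℝ) * q ^ m ≤ n * q ^ (k + j) := by
          gcongr ?_ * ?_
          exact pow_le_pow_of_le_one hq0.le hq1.le h
      _ = n * q ^ k * q ^ j := by rw [pow_add, mul_assoc]
      _ ≤ _ := by gcongr
  refine (Finset.sum_le_sum fun v' hv' =>
    real_extendableAt_inter_le hp0 hq0 hq1 hq hx hlam hv hv' hC hC').trans ?_
  rw [← Finset.mul_sum]
  refine mul_le_mul_of_nonneg_left ?_ (by positivity)
  rw [← Finset.mul_sum]
  -- For equal cliques, `v' = v` gives the same dominating set, of size `k`; otherwise the two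
  -- dominating sets together fill `C`, which saves a factor `q` in the exponent.
  by_cases hCC : C' = C
  · subst hCC
    rw [Finset.inter_self, hC, if_neg (by omega), if_pos rfl, mul_zero, zero_add]
    refine mul_le_mul_of_nonneg_left ?_ (by positivity)
    rw [← Finset.add_sum_erase _ _ hv]
    refine add_le_add ?_ ?_
    · gcongr
      rw [Finset.union_self, hBk]
      exact hlam
    · refine (Finset.sum_le_card_nsmul _ _ (Real.exp ((k + 1 : ℕ) * q)) fun v' hv' =>
        Real.exp_le_exp.2 ?_).trans_eq (by rw [hBk, nsmul_eq_mul])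
      have hun : C'.erase v ∪ C'.erase v' = C' := by
        ext a
        simp only [Finset.mem_union, Finset.mem_erase]
        have := Finset.ne_of_mem_erase hv'
        constructor
        · rintro (h | h) <;> exact h.2
        · intro ha
          by_cases hav : a = v
          · subst hav
            exact Or.inr ⟨this.symm, ha⟩
          · exact Or.inl ⟨hav, ha⟩
      rw [hun, hC]
      simpa using hny (k + 1) 1 le_rfl
  · have hi : (C ∩ C').card ≤ k := by
      by_contra hlt
      have h1 : C ∩ C' = C := Finset.eq_of_subset_of_card_le Finset.inter_subset_left (by omega)
      have h2 : C ∩ C' = C' := Finset.eq_of_subset_of_card_le Finset.inter_subset_right (by omega)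
      exact hCC (h2.symm.trans h1)
    rw [if_pos hi, if_neg hCC, add_zero, mul_left_comm]
    refine mul_le_mul_of_nonneg_left ?_ (by positivity)
    refine (Finset.sum_le_card_nsmul _ _ (Real.exp ((k + 1 : ℕ) * q ^ (k - (C ∩ C').card)))
      fun v' hv' => Real.exp_le_exp.2 (hny _ _ ?_)).trans_eq (by rw [hC', nsmul_eq_mul])
    -- The dominating sets have size `k` and meet within `C ∩ C'`, so their union has at least `k +
    -- (k - |C ∩ C'|)` elements.
    have h1 := Finset.card_union_add_card_inter (C.erase v) (C'.erase v')
    have h2 : (C.erase v ∩ C'.erase v').card ≤ (C ∩ C').card :=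
      Finset.card_le_card (Finset.inter_subset_inter (Finset.erase_subset _ _)
        (Finset.erase_subset _ _))
    rw [hBk, Finset.card_erase_of_mem hv', hC'] at h1
    omega

lemma sum_pow_add_pow_le {ε : ℝ} (hε0 : 0 ≤ ε) (hε1 : ε ≤ 1 / 2) (k : ℕ) :
    ∑ i ∈ Finset.range (k + 1), (ε ^ i + ε ^ (k + 1 - i)) ≤ 4 := by
  have hgeom : ∑ i ∈ Finset.range (k + 1), ε ^ i ≤ 2 := by
    have h1 : ∑ i ∈ Finset.range (k + 1), ε ^ i ≤ ∑' i, ε ^ i :=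
      (summable_geometric_of_lt_one hε0 (by linarith)).sum_le_tsum _ fun _ _ => by positivity
    rw [tsum_geometric_of_lt_one hε0 (by linarith)] at h1
    refine h1.trans (inv_le_of_inv_le₀ (by norm_num) ?_)
    linarith
  have hrefl : ∑ i ∈ Finset.range (k + 1), ε ^ (k + 1 - i) ≤ ∑ i ∈ Finset.range (k + 1), ε ^ i := by
    rw [← Finset.sum_range_reflect (fun i => ε ^ i)]
    refine Finset.sum_le_sum fun i hi => pow_le_pow_of_le_one hε0 (by linarith) ?_
    omega
  rw [Finset.sum_add_distrib]
  linarith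

/-- The second moment bound at the threshold. -/
theorem le_real_hasExtendableDomClique {p : I} {q w : ℝ} (hq0 : 0 < q) (hq1 : q < 1)
    (hq : q = 1 - p) (hpq : (p : ℝ) = q ^ 2) (hw0 : 0 < w) (hw1 : w < 1) (hwq : w ^ 2 = q)
    {k n : ℕ} (hk : 1 ≤ k) (hn : 2 * (k + 1) ^ 2 ≤ n) (hlam : (k : ℝ) ≤ n * q ^ k)
    (hlam' : n * q ^ k ≤ (k + 1 : ℕ)) (hx : q ^ k ≤ 1 / 2)
    (hε1 : ((k + 1 : ℕ) : ℝ) ^ 3 * w ^ (k + 1) ≤ 1 / 2) :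
    (Real.exp (8 * (1 - q)⁻¹) * (2 * Real.exp 2 * Real.exp q⁻¹ * 4 +
      2 * Real.exp 2 * (1 + (1 - q)⁻¹)))⁻¹ ≤
      (binomialRandom (Fin n) p).real {G | HasExtendableDomClique G} := by
  have hp0 : 0 < (p : ℝ) := by rw [hpq]; positivity
  have hq1' : 0 < 1 - q := by linarith
  have hcard : Fintype.card (Fin n) = n := Fintype.card_fin n
  set H := Real.exp (8 * (1 - q)⁻¹) with hH
  set D := 2 * Real.exp 2 * Real.exp q⁻¹ with hD
  set E := 2 * Real.exp 2 * (1 + (1 - q)⁻¹) with hE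
  set π := (p : ℝ) ^ (k + 1).choose 2 * (1 - q ^ k) ^ (n - (k + 1)) with hπ
  set s : Finset (Σ _ : Finset (Fin n), Fin n) :=
    (Finset.univ.powersetCard (k + 1)).sigma fun C => C with hs
  set F : (Σ _ : Finset (Fin n), Fin n) → Set (SimpleGraph (Fin n)) :=
    fun a => extendableAt a.1 a.2 with hF
  set N : ℝ := ((n.choose (k + 1) : ℕ) : ℝ) with hN
  have hN0 : 0 < N := by
    rw [hN]
    exact_mod_cast Nat.choose_pos (by nlinarith)
  have hπ0 : 0 < π := by
    have : 0 < 1 - q ^ k := by linarith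
    positivity
  have hmem : ∀ a ∈ s, a.1.card = k + 1 ∧ a.2 ∈ a.1 := by
    intro a ha
    rw [hs, Finset.mem_sigma, Finset.mem_powersetCard] at ha
    exact ⟨ha.1.2, ha.2⟩
  have hscard : (s.card : ℝ) = N * (k + 1 : ℕ) := by
    rw [hs, Finset.card_sigma, Finset.sum_congr rfl
      (fun C hC => (Finset.mem_powersetCard.1 hC).2), Finset.sum_const, Finset.card_powersetCard,
      Finset.card_univ, hcard, smul_eq_mul]
    push_cast
    rfl
  have hM : ∑ a ∈ s, (binomialRandom (Fin n) p).real (F a) = N * (k + 1 : ℕ) * π := by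
    rw [Finset.sum_congr rfl fun a ha => real_extendableAt p (hmem a ha).2 (hmem a ha).1,
      Finset.sum_const, nsmul_eq_mul, hscard, ← hq, hcard]
  -- Cut off at `k`: intersection size `k + 1` means equal cliques, which `R` accounts for.
  set g : ℕ → ℝ := fun j => if j ≤ k then (p : ℝ)⁻¹ ^ j.choose 2 *
    Real.exp ((k + 1 : ℕ) * q ^ (k - j)) else 0 with hg
  have hg0 : ∀ j, 0 ≤ g j := by
    intro j
    simp only [hg]
    split_ifs
    · positivity
    · exact le_rfl
  set R := (p : ℝ)⁻¹ ^ (k + 1).choose 2 *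
        (Real.exp (k + 1 : ℕ) + k * Real.exp ((k + 1 : ℕ) * q)) with hR
  have hsumg : ∑ j ∈ Finset.range (k + 1 + 1), ((k + 1).choose j : ℝ) *
      ((k + 1).descFactorial j / n.descFactorial j) * g j ≤ D * 4 := by
    rw [Finset.sum_range_succ]
    have hlast : g (k + 1) = 0 := by simp [hg]
    rw [hlast, mul_zero, add_zero]
    calc ∑ j ∈ Finset.range (k + 1), ((k + 1).choose j : ℝ) *
          ((k + 1).descFactorial j / n.descFactorial j) * g j
        ≤ ∑ j ∈ Finset.range (k + 1), D * ((((k + 1 : ℕ) : ℝ) ^ 3 * w ^ (k + 1)) ^ j +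
          (((k + 1 : ℕ) : ℝ) ^ 3 * w ^ (k + 1)) ^ (k + 1 - j)) := by
          refine Finset.sum_le_sum fun j hj => ?_
          have hjk : j ≤ k := Nat.lt_succ_iff.1 (Finset.mem_range.1 hj)
          simp only [hg, if_pos hjk, hpq]
          exact critical_overlap_le hq0 hq1 hw0 hw1 hwq hk hn hlam hjk rfl hε1
      _ ≤ D * 4 := by
          rw [← Finset.mul_sum]
          gcongr
          exact sum_pow_add_pow_le (by positivity) hε1 k
  -- The diagonal is harmless because the expected number of cliques is large enough to compensate
  -- the domination probability.
  have hRle : R ≤ E * (N * (k + 1 : ℕ)) := by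
    have h1 := critical_expectation_ge hq0 hk hn hlam
    rw [← hpq] at h1
    have h2 : (k : ℝ) * Real.exp ((k + 1 : ℕ) * q) ≤ (1 - q)⁻¹ * Real.exp (k + 1 : ℕ) := by
      have h3 := Real.add_one_le_exp ((1 - q) * (k + 1 : ℕ))
      have h4 : (k : ℝ) ≤ (1 - q)⁻¹ * Real.exp ((1 - q) * (k + 1 : ℕ)) := by
        rw [inv_mul_eq_div, le_div_iff₀ hq1']
        push_cast at h3 ⊢
        nlinarith
      calc (k : ℝ) * Real.exp ((k + 1 : ℕ) * q)
          ≤ (1 - q)⁻¹ * Real.exp ((1 - q) * (k + 1 : ℕ)) * Real.exp ((k + 1 : ℕ) * q) := by gcongr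
        _ = _ := by
          rw [mul_assoc, ← Real.exp_add]
          ring_nf
    rw [hR, inv_pow, inv_mul_eq_div, div_le_iff₀ (by positivity)]
    calc Real.exp (k + 1 : ℕ) + k * Real.exp ((k + 1 : ℕ) * q)
        ≤ (1 + (1 - q)⁻¹) * Real.exp (k + 1 : ℕ) := by linarith
      _ ≤ (1 + (1 - q)⁻¹) * (2 * Real.exp 2 *
          ((p : ℝ) ^ (k + 1).choose 2 * N * (k + 1 : ℕ))) := by gcongr
      _ = _ := by rw [hE]; ring
  have hrow : ∀ a ∈ s, ∑ b ∈ s, (binomialRandom (Fin n) p).real (F a ∩ F b) ≤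
      π ^ 2 * H * ((D * 4 + E) * (N * (k + 1 : ℕ))) := by
    intro a ha
    obtain ⟨haC, hav⟩ := hmem a ha
    have haU : a.1 ∈ (Finset.univ : Finset (Fin n)).powersetCard (k + 1) :=
      Finset.mem_powersetCard.2 ⟨Finset.subset_univ _, haC⟩
    rw [hs, Finset.sum_sigma]
    calc ∑ C' ∈ Finset.univ.powersetCard (k + 1), ∑ v' ∈ C',
          (binomialRandom (Fin n) p).real (F a ∩ F ⟨C', v'⟩)
        ≤ ∑ C' ∈ Finset.univ.powersetCard (k + 1), π ^ 2 * H *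
          ((k + 1 : ℕ) * g (a.1 ∩ C').card + if C' = a.1 then R else 0) := by
          refine Finset.sum_le_sum fun C' hC' => ?_
          have := sum_real_extendableAt_inter_le hp0 hq0 hq1 hq hx (by rwa [hcard]) hav haC
            (Finset.mem_powersetCard.1 hC').2
          rwa [hcard] at this
      _ = π ^ 2 * H * ((k + 1 : ℕ) *
          ∑ C' ∈ Finset.univ.powersetCard (k + 1), g (a.1 ∩ C').card + R) := by
          rw [← Finset.mul_sum, Finset.sum_add_distrib, ← Finset.mul_sum, Finset.sum_ite_eq',
            if_pos haU]
      _ ≤ π ^ 2 * H * ((k + 1 : ℕ) * (N * (D * 4)) + E * (N * (k + 1 : ℕ))) := by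
          gcongr
          have h1 := sum_powersetCard_inter_le haU hg0
          rw [Finset.card_univ, hcard] at h1
          refine h1.trans ?_
          gcongr
      _ = _ := by ring
  have hexists : {G : SimpleGraph (Fin n) | ∃ a ∈ s, G ∈ F a} ⊆ {G | HasExtendableDomClique G} := by
    rintro G ⟨a, ha, hG⟩
    obtain ⟨j, rfl⟩ : ∃ j, k = j + 1 := ⟨k - 1, by omega⟩
    exact hasExtendableDomClique_of_extendableAt (hmem a ha).2 (hmem a ha).1 hG
  refine (inv_le_real_exists (binomialRandom (Fin n) p) s F (by positivity) ?_ ?_).trans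
    (measureReal_mono hexists (measure_ne_top _ _))
  · rw [hM]
    positivity
  · rw [hM]
    refine (Finset.sum_le_card_nsmul _ _ _ hrow).trans (le_of_eq ?_)
    rw [nsmul_eq_mul, hscard]
    ring

/-- Along a suitable sequence of orders, extendable dominating cliques keep a positive
probability. -/
theorem exists_seq_le_real {p : I} {q : ℝ} (hq0 : 0 < q) (hq1 : q < 1) (hq : q = 1 - p)
    (hpq : (p : ℝ) = q ^ 2) :
    ∃ c > 0, ∃ u : ℕ → ℕ, Tendsto u atTop atTop ∧
      ∀ᶠ k in atTop, c ≤ (binomialRandom (Fin (u k)) p).real {G | HasExtendableDomClique G} := by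
  set w := √q with hw
  have hw0 : 0 < w := Real.sqrt_pos.2 hq0
  have hw1 : w < 1 := by
    rw [hw, Real.sqrt_lt' one_pos]
    linarith
  have hwq : w ^ 2 = q := Real.sq_sqrt hq0.le
  have hq1' : 0 < 1 - q := by linarith
  have hu1 : ∀ k : ℕ, k * (q ^ k)⁻¹ ≤ (⌈k * (q ^ k)⁻¹⌉₊ : ℝ) := fun k => Nat.le_ceil _
  have hu2 : ∀ k : ℕ, (⌈k * (q ^ k)⁻¹⌉₊ : ℝ) ≤ k * (q ^ k)⁻¹ + 1 := fun k =>
    (Nat.ceil_lt_add_one (by positivity)).le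
  have hlim : ∀ r : ℝ, 0 ≤ r → r < 1 →
      Tendsto (fun k : ℕ => ((k + 1 : ℕ) : ℝ) ^ 3 * r ^ (k + 1)) atTop (𝓝 0) := fun r h0 h1 =>
    (tendsto_pow_const_mul_const_pow_of_abs_lt_one 3 (by rwa [abs_of_nonneg h0])).comp
      (tendsto_add_atTop_nat 1)
  -- The order `⌈k q^(-k)⌉` puts the mean `n q^k` between `k` and `k + 1`, at the peak of the
  -- Poisson weight.
  refine ⟨(Real.exp (8 * (1 - q)⁻¹) * (2 * Real.exp 2 * Real.exp q⁻¹ * 4 +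
      2 * Real.exp 2 * (1 + (1 - q)⁻¹)))⁻¹, by positivity, fun k => ⌈k * (q ^ k)⁻¹⌉₊, ?_, ?_⟩
  · refine tendsto_atTop_mono (fun k => ?_) tendsto_id
    have h1 : (k : ℝ) ≤ k * (q ^ k)⁻¹ := le_mul_of_one_le_right (Nat.cast_nonneg k)
      ((one_le_inv₀ (by positivity)).2 (pow_le_one₀ hq0.le hq1.le))
    exact_mod_cast h1.trans (hu1 k)
  · filter_upwards [eventually_ge_atTop 1, (hlim w hw0.le hw1).eventually_le_const
      (show (0 : ℝ) < 1 / 2 by norm_num), (hlim q hq0.le hq1).eventually_le_const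
      (show (0 : ℝ) < q / 2 by linarith)] with k hk hε hδ
    have hk1 : (1 : ℝ) ≤ k := by exact_mod_cast hk
    have hK1 : (1 : ℝ) ≤ (k + 1 : ℕ) := by exact_mod_cast Nat.le_add_left 1 k
    have hx0 : 0 < q ^ k := by positivity
    have hKx : ((k + 1 : ℕ) : ℝ) ^ 3 * q ^ k ≤ 1 / 2 := by
      rw [pow_succ q, ← mul_assoc] at hδ
      nlinarith
    have hx : q ^ k ≤ 1 / 2 :=
      le_trans (le_mul_of_one_le_left hx0.le (one_le_pow₀ hK1)) hKx
    refine le_real_hasExtendableDomClique hq0 hq1 hq hpq hw0 hw1 hwq hk ?_ ?_ ?_ hx hε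
    · have h1 : (2 * (k + 1) ^ 2 : ℝ) ≤ k * (q ^ k)⁻¹ := by
        rw [← div_eq_mul_inv, le_div_iff₀ hx0]
        have h2 : ((k + 1 : ℕ) : ℝ) ^ 2 * q ^ k ≤ ((k + 1 : ℕ) : ℝ) ^ 3 * q ^ k := by
          gcongr ?_ * _
          exact pow_le_pow_right₀ hK1 (by norm_num)
        push_cast at h2 hKx
        linarith
      exact_mod_cast h1.trans (hu1 k)
    · calc (k : ℝ) = k * (q ^ k)⁻¹ * q ^ k := by field_simp
        _ ≤ _ := by
          gcongr
          exact hu1 k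
    · calc (⌈k * (q ^ k)⁻¹⌉₊ : ℝ) * q ^ k ≤ (k * (q ^ k)⁻¹ + 1) * q ^ k := by
            gcongr
            exact hu2 k
        _ = k + q ^ k := by field_simp
        _ ≤ (k + 1 : ℕ) := by
            push_cast
            linarith

end CriticalLower

/-! ### Failure of convergence and the golden ratio values -/

section CriticalLaw

open SimpleGraph

/-- At the threshold, the probability of an extendable dominating clique does not converge. -/
theorem not_tendsto_real_hasExtendableDomClique {p : I} (hp0 : 0 < (p : ℝ)) (hp1 : (p : ℝ) < 1)
    (hpq : (p : ℝ) = (1 - p) ^ 2) (c : ℝ) :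
    ¬ Tendsto (fun n => (binomialRandom (Fin n) p).real {G | HasExtendableDomClique G})
      atTop (𝓝 c) := by
  intro h
  have hq0 : 0 < 1 - (p : ℝ) := by linarith
  have hq1 : 1 - (p : ℝ) < 1 := by linarith
  obtain ⟨u, hu, hu0⟩ := exists_seq_tendsto_zero hq0 hq1 rfl hpq
  obtain ⟨δ, hδ, t, ht, htδ⟩ := exists_seq_le_real hq0 hq1 rfl hpq
  obtain rfl : c = 0 := tendsto_nhds_unique (h.comp hu) hu0
  exact hδ.not_ge (ge_of_tendsto (h.comp ht) htδ)

theorem not_convergenceLaw {p : I} (hp0 : 0 < (p : ℝ)) (hp1 : (p : ℝ) < 1)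
    (h : (p : ℝ) = (1 - p) ^ 2 ∨ 1 - (p : ℝ) = p ^ 2) : ¬ ConvergenceLaw p (E₁ 2) := by
  intro hconv
  rcases h with h | h
  · obtain ⟨c, hc⟩ := hconv _ (qdepth_extendableDomClique (A := adjFormula) rfl)
    refine not_tendsto_real_hasExtendableDomClique hp0 hp1 h c (hc.congr fun n => ?_)
    simp only [prob, models_adjFormula]
  · obtain ⟨c, hc⟩ := hconv _
      (qdepth_extendableDomClique (A := eqFormula.not ⊓ adjFormula.not) rfl)
    have hσ : ((σ p : I) : ℝ) = 1 - p := unitInterval.coe_symm_eq p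
    refine not_tendsto_real_hasExtendableDomClique (p := σ p) (by rw [hσ]; linarith)
      (by rw [hσ]; linarith) (by rw [hσ]; linarith [h]) c (hc.congr fun n => ?_)
    simp only [prob, models_compl_adjFormula]
    exact real_compl_mem p {G | HasExtendableDomClique G}

lemma ZeroOneLaw.convergenceLaw {p : I} {L : Set Sentence₁} (h : ZeroOneLaw p L) :
    ConvergenceLaw p L := fun φ hφ =>
  let ⟨c, _, hc⟩ := h φ hφ
  ⟨c, hc⟩

/-- Each quadratic has exactly one root in the unit interval; the other roots are `(3 + √5) / 2 > 1`
and `-(√5 + 1) / 2 < 0`. -/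
lemma mem_golden_iff {p : ℝ} (hp : p ∈ Set.Ioo (0 : ℝ) 1) :
    p ∈ ({(3 - √5) / 2, (√5 - 1) / 2} : Set ℝ) ↔ p = (1 - p) ^ 2 ∨ 1 - p = p ^ 2 := by
  obtain ⟨h0, h1⟩ := hp
  have h5 : √5 * √5 = 5 := Real.mul_self_sqrt (by norm_num)
  have h5' : 0 ≤ √5 := Real.sqrt_nonneg 5
  rw [Set.mem_insert_iff, Set.mem_singleton_iff]
  constructor
  · rintro (h | h)
    · left
      rw [h]
      linarith
    · right
      rw [h]
      linarith
  · rintro (h | h)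
    · left
      have : (p - (3 - √5) / 2) * (p - (3 + √5) / 2) = 0 := by linarith
      rcases mul_eq_zero.1 this with h | h
      · linarith
      · linarith
    · right
      have : (p - (√5 - 1) / 2) * (p + (√5 + 1) / 2) = 0 := by linarith
      rcases mul_eq_zero.1 this with h | h
      · linarith
      · linarith

end CriticalLaw

end EMSO

theorem theorem2 (p : ℝ) (hp : p ∈ Set.Ioo (0 : ℝ) 1) :
    (EMSO.ZeroOneLaw ⟨p, Set.Ioo_subset_Icc_self hp⟩ (EMSO.E₁ 2) ↔
      p ∉ ({(3 - √5) / 2, (√5 - 1) / 2} : Set ℝ)) ∧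
    (p ∈ ({(3 - √5) / 2, (√5 - 1) / 2} : Set ℝ) →
      ¬ EMSO.ConvergenceLaw ⟨p, Set.Ioo_subset_Icc_self hp⟩ (EMSO.E₁ 2)) := by
  rw [EMSO.mem_golden_iff hp]
  have hnot := EMSO.not_convergenceLaw (p := ⟨p, Set.Ioo_subset_Icc_self hp⟩) hp.1 hp.2
  refine ⟨⟨fun h hcrit => hnot hcrit h.convergenceLaw, fun h => ?_⟩, hnot⟩
  rw [not_or] at h
  exact EMSO.zeroOneLaw_of_ne hp.1 hp.2 h.1 h.2
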